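/- **Conventions.** Let $C\subseteq\omega$ be a cohesive set (infinite, and for every c.e. set $W$ either $C\setminus W$ or $C\cap W$ is finite). "For almost every $i$" means for all but finitely many $i\in C$. For uniformly computable structures $A_i$ (presented on sets of natural numbers), $\prod_C A_i$ is the set of partial computable functions $\varphi$ that are defined for almost every $i$ and satisfy $\varphi(i)\in A_i$ wherever defined, modulo agreement for almost every $i$; relations and operations are defined almost everywhere. Elements of $\prod_C\mathbb N$, with its order, are called hyper-naturals. For $N=[\varphi]\in\prod_C\mathbb N$ put $\prod_{C,N}A_i:=\prod_C A_{\varphi(i)}$ (for a chosen representative $\varphi$; up to canonical isomorphism the choice is irrelevant). $\mathcal T_A$ is the set of finite tuples of elements of $A$, with the extension order $\preceq$, concatenation ${}^\wedge$ and arity $|\cdot|$. For fields $K_i\supseteq F$, $HAut(\prod_C K_i/\prod_C F)$ is the group of permutations $\sigma$ of $\prod_C\mathcal T_{K_i}$ that preserve $\preceq$, ${}^\wedge$ and the arity $|\cdot|$ (with values in $\prod_C\mathbb N$), satisfy $\sigma(p(\vec a))=p(\sigma(\vec a))$ for all $p\in\prod_C\mathbb Z[x_1,x_2,\dots]$ and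 all $\vec a$ with $|\vec a|=\mathrm{var}(p)$ (here $\mathrm{var}(p)$ is the largest index of a variable occurring in $p$, and $p(\vec a)$ is regarded as a 1-tuple), and fix the image of $\prod_C\mathcal T_F$ pointwise. $HAut(\prod_{C,N}K_i/\prod_C F)$ is defined in the same way from $\prod_{C,N}\mathcal T_{K_i}$. A Galois extension $K/F$ is *fully computable* if $F$, $K$ and the inclusion $F\to K$ are computable and there are finite Galois sub-extensions $K_0\subsetneq K_1\subsetneq\cdots$ of $K/F$ with $K=\bigcup_i K_i$ such that the following are uniformly computable: the fields $K_i$; the inclusions $F\to K_i$, $K_i\to K$, $K_i\to K_{i+1}$; the finite groups $G_i=Gal(K_i/F)$, including their orders; the quotient maps $f_{m,n}:G_m\to G_n$ for $n<m$; and the actions of $G_i$ on $K_i$. (Such an extension is necessarily infinite.) **Theorem.** Let $K/F$ be a fully computable (infinite) Galois extension, with $K_i$ and $G_i$ as above. Then $$HAut\Bigl(\prod_C K/\prod_C F\Bigr)\;\cong\;\varprojlim_{N\in\prod_C\mathbb N}HAut\Bigl(\prod_{C,N}K_i/\prod_C F\Bigr)\;\cong\;\varprojlim_{N\in\prod_C\mathbb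 N}\ \prod_{C,N}G_i .$$ More precisely: for hyper-naturals $N<M$, restriction to $\prod_{C,N}\mathcal T_{K_i}\subseteq\prod_{C,M}\mathcal T_{K_i}$ is a well-defined group homomorphism $HAut(\prod_{C,M}K_i/\prod_CF)\to HAut(\prod_{C,N}K_i/\prod_CF)$, and the first limit is taken along these maps. The second limit is taken along the maps $\prod_{C,M}G_i\to\prod_{C,N}G_i$, $g\mapsto[\,i\mapsto f_{M(i),N(i)}(g(i))\,]$. The first isomorphism is $\sigma\mapsto(\sigma\restriction\prod_{C,N}\mathcal T_{K_i})_N$. For each $N$ there is an isomorphism $\gamma_N:HAut(\prod_{C,N}K_i/\prod_CF)\to\prod_{C,N}G_i$ such that every $\tau$ is the coordinatewise action of $\gamma_N(\tau)$, and the second isomorphism is $(\tau_N)_N\mapsto(\gamma_N(\tau_N))_N$. -/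

import Mathlib

open Filter

namespace HyperGalois

universe u v w

/-! ## Computable presentations -/

/-- A numbering of a set `A`: a bijection of `A` with a set of natural numbers (the domain of the
presentation). -/
structure Numbering (A : Type u) where
  code : A → ℕ
  inj : Function.Injective code

/-- A sequence of presentations has uniformly computable domains. -/
def UniformDomains {A : ℕ → Type u} (ν : ∀ i, Numbering (A i)) : Prop :=
  ComputablePred fun p : ℕ × ℕ => p.2 ∈ Set.range (ν p.1).code

/-- A sequence of elements `a i ∈ A i` is uniformly computable. -/
def UniformConst {A : ℕ → Type u} (ν : ∀ i, Numbering (A i)) (a : ∀ i, A i) : Prop :=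
  Computable fun i => (ν i).code (a i)

/-- A sequence of unary maps `f i : A i → B i` is uniformly computable. -/
def UniformMap {A : ℕ → Type u} {B : ℕ → Type v} (ν : ∀ i, Numbering (A i))
    (μ : ∀ i, Numbering (B i)) (f : ∀ i, A i → B i) : Prop :=
  ∃ c : ℕ × ℕ → ℕ, Computable c ∧ ∀ i a, c (i, (ν i).code a) = (μ i).code (f i a)

/-- A sequence of binary maps `f i : A i × B i → D i` is uniformly computable. -/
def UniformMap₂ {A : ℕ → Type u} {B : ℕ → Type v} {D : ℕ → Type w} (ν : ∀ i, Numbering (A i))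
    (μ : ∀ i, Numbering (B i)) (ξ : ∀ i, Numbering (D i)) (f : ∀ i, A i → B i → D i) : Prop :=
  ∃ c : ℕ × ℕ × ℕ → ℕ, Computable c ∧
    ∀ i a b, c (i, (ν i).code a, (μ i).code b) = (ξ i).code (f i a b)

/-- A uniformly computable sequence of fields. -/
structure UniformFields {A : ℕ → Type u} [∀ i, Field (A i)] (ν : ∀ i, Numbering (A i)) : Prop where
  dom : UniformDomains ν
  zero : UniformConst ν fun _ => 0
  one : UniformConst ν fun _ => 1
  neg : UniformMap ν ν fun _ x => -x
  add : UniformMap₂ ν ν ν fun _ x y => x + y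
  mul : UniformMap₂ ν ν ν fun _ x y => x * y

/-- A uniformly computable sequence of groups. -/
class UniformGroups {G : ℕ → Type u} [∀ i, Group (G i)] (ν : ∀ i, Numbering (G i)) : Prop where
  dom : UniformDomains ν
  one : UniformConst ν fun _ => 1
  inv : UniformMap ν ν fun _ x => x⁻¹
  mul : UniformMap₂ ν ν ν fun _ x y => x * y

/-- The standard presentation of the natural numbers. -/
def natNumbering : Numbering ℕ := ⟨id, Function.injective_id⟩

/-- The presentation of the set `A^{<ω}` of finite tuples induced by a presentation of `A`. -/
def Numbering.list {A : Type u} (ν : Numbering A) : Numbering (List A) :=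
  ⟨fun l => Encodable.encode (l.map ν.code),
    Encodable.encode_injective.comp (List.map_injective_iff.2 ν.inj)⟩

/-- The integral polynomial `∑ c · x₁^{k₁} ⋯ xₙ^{kₙ}` described by a list of pairs
`((k₁, …, kₙ), c)`; the variable `x_{j+1}` is `MvPolynomial.X j`. -/
noncomputable def polyOfTerms (l : List (List ℕ × ℤ)) : MvPolynomial ℕ ℤ :=
  (l.map fun t => MvPolynomial.monomial t.1.toFinsupp t.2).sum

theorem polyOfTerms_surjective (p : MvPolynomial ℕ ℤ) : ∃ l, polyOfTerms l = p := by
  induction p using MvPolynomial.induction_on' with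
  | monomial s c =>
    refine ⟨[((List.range (s.support.sup id + 1)).map s, c)], ?_⟩
    have : (((List.range (s.support.sup id + 1)).map s).toFinsupp : ℕ →₀ ℕ) = s := by
      ext j
      rw [List.toFinsupp_apply]
      by_cases hj : j < s.support.sup id + 1
      · simp [hj]
      · have h0 : s j = 0 := by
          by_contra h
          have : id j ≤ s.support.sup id := Finset.le_sup (Finsupp.mem_support_iff.2 h)
          simp only [id] at this
          omega
        rw [List.getD_eq_default _ _ (by simpa using hj), h0]
    simp [polyOfTerms, this]
  | add p q hp hq =>
    obtain ⟨l, rfl⟩ := hp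
    obtain ⟨m, rfl⟩ := hq
    exact ⟨l ++ m, by simp [polyOfTerms]⟩

/-- The codes of the lists of terms that describe the polynomial `p`. -/
def polyCodes (p : MvPolynomial ℕ ℤ) : Set ℕ :=
  {n | ∃ l, Encodable.encode l = n ∧ polyOfTerms l = p}

theorem polyCodes_nonempty (p : MvPolynomial ℕ ℤ) : (polyCodes p).Nonempty :=
  let ⟨l, hl⟩ := polyOfTerms_surjective p
  ⟨_, l, rfl, hl⟩

/-- The canonical presentation of `ℤ[x₁, x₂, …]`: the number of a polynomial is the least code of a
list of terms that describes it. -/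
noncomputable def polyNumbering : Numbering (MvPolynomial ℕ ℤ) where
  code p := sInf (polyCodes p)
  inj p q h := by
    obtain ⟨l, hl, rfl⟩ := Nat.sInf_mem (polyCodes_nonempty p)
    obtain ⟨m, hm, rfl⟩ := Nat.sInf_mem (polyCodes_nonempty q)
    have h' : Encodable.encode l = Encodable.encode m := hl.trans (h.trans hm.symm)
    rw [Encodable.encode_injective h']

/-- `var(p)`: the largest index of a variable among `x₁, x₂, …` that occurs in `p`
(`0` for constants). -/
noncomputable def numVars (p : MvPolynomial ℕ ℤ) : ℕ := p.vars.sup fun j => j + 1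

/-- The value `p(a₁, …, aₙ)` at a tuple. -/
noncomputable def evalTuple {A : Type u} [Field A] (p : MvPolynomial ℕ ℤ) (a : List A) : A :=
  MvPolynomial.aeval (fun j => a.getD j 0) p

/-! ## Cohesive sets and cohesive products -/

/-- The filter of the sets `X` with `C ⊆* X`. -/
def almostAll (C : Set ℕ) : Filter ℕ := cofinite ⊓ 𝓟 C

theorem eventually_almostAll {C : Set ℕ} {P : ℕ → Prop} :
    (∀ᶠ i in almostAll C, P i) ↔ (C \ {i | P i}).Finite := by
  rw [almostAll, eventually_inf_principal, eventually_cofinite]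
  have : {x | ¬(x ∈ C → P x)} = C \ {i | P i} := by
    ext x
    simp
  rw [this]

/-- An infinite set `C` is cohesive if `C ⊆* W` or `C ⊆* Wᶜ` for every c.e. set `W`. -/
def IsCohesive (C : Set ℕ) : Prop :=
  C.Infinite ∧ ∀ W : Set ℕ, REPred (fun n => n ∈ W) → (C \ W).Finite ∨ (C \ Wᶜ).Finite

/-- A partial computable function `i ↦ φ i ∈ A i` that is defined for almost every `i ∈ C`. The sets
`A i` may be empty: this covers partial sequences `(A i)_{i ∈ W}`. -/
structure Rep (C : Set ℕ) {A : ℕ → Type u} (ν : ∀ i, Numbering (A i)) where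
  val : ∀ i, Part (A i)
  partrec : Partrec fun i => (val i).map (ν i).code
  dom : ∀ᶠ i in almostAll C, (val i).Dom

/-- `φ ≃_C ψ`: the values are defined and equal for almost every `i ∈ C`. -/
instance Rep.setoid (C : Set ℕ) {A : ℕ → Type u} (ν : ∀ i, Numbering (A i)) :
    Setoid (Rep C ν) where
  r φ ψ := ∀ᶠ i in almostAll C, ∃ a, a ∈ φ.val i ∧ a ∈ ψ.val i
  iseqv :=
    { refl := fun φ => φ.dom.mono fun _ h => ⟨_, Part.get_mem h, Part.get_mem h⟩
      symm := fun h => h.mono fun _ ⟨a, h₁, h₂⟩ => ⟨a, h₂, h₁⟩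
      trans := fun h h' => (h.and h').mono fun _ ⟨⟨a, h₁, h₂⟩, ⟨b, h₃, h₄⟩⟩ =>
        ⟨a, h₁, by rwa [Part.mem_unique h₂ h₃]⟩ }

/-- The domain of the cohesive product `∏_C A i`. -/
def CohProd (C : Set ℕ) {A : ℕ → Type u} (ν : ∀ i, Numbering (A i)) : Type u :=
  Quotient (Rep.setoid C ν)

section Lift

variable {C : Set ℕ} {A : ℕ → Type u} {B : ℕ → Type v} {D : ℕ → Type w}
  {ν : ∀ i, Numbering (A i)} {μ : ∀ i, Numbering (B i)} {ξ : ∀ i, Numbering (D i)}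

/-- The element of the cohesive product represented by `φ`. -/
def CohProd.mk (φ : Rep C ν) : CohProd C ν := Quotient.mk _ φ

/-- The binary relation on cohesive products induced by a sequence of relations `R i`: it holds of
`[φ]`, `[ψ]` if `R i (φ i) (ψ i)` for almost every `i`. -/
def Lift₂ (R : ∀ i, A i → B i → Prop) (x : CohProd C ν) (y : CohProd C μ) : Prop :=
  ∃ φ ψ, CohProd.mk φ = x ∧ CohProd.mk ψ = y ∧
    ∀ᶠ i in almostAll C, ∃ a ∈ φ.val i, ∃ b ∈ ψ.val i, R i a b

/-- The ternary relation on cohesive products induced by a sequence of relations `R i`. -/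
def Lift₃ (R : ∀ i, A i → B i → D i → Prop) (x : CohProd C ν) (y : CohProd C μ)
    (z : CohProd C ξ) : Prop :=
  ∃ φ ψ χ, CohProd.mk φ = x ∧ CohProd.mk ψ = y ∧ CohProd.mk χ = z ∧
    ∀ᶠ i in almostAll C, ∃ a ∈ φ.val i, ∃ b ∈ ψ.val i, ∃ d ∈ χ.val i, R i a b d

theorem lift₂_mk {R : ∀ i, A i → B i → Prop} {φ : Rep C ν} {ψ : Rep C μ} :
    Lift₂ R (CohProd.mk φ) (CohProd.mk ψ) ↔
      ∀ᶠ i in almostAll C, ∃ a ∈ φ.val i, ∃ b ∈ ψ.val i, R i a b := by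
  refine ⟨?_, fun h => ⟨φ, ψ, rfl, rfl, h⟩⟩
  rintro ⟨φ', ψ', h₁, h₂, h⟩
  have e₁ : ∀ᶠ i in almostAll C, ∃ a, a ∈ φ'.val i ∧ a ∈ φ.val i := Quotient.exact h₁
  have e₂ : ∀ᶠ i in almostAll C, ∃ a, a ∈ ψ'.val i ∧ a ∈ ψ.val i := Quotient.exact h₂
  filter_upwards [e₁, e₂, h]
  rintro i ⟨a, ha, ha'⟩ ⟨b, hb, hb'⟩ ⟨a₁, ha₁, b₁, hb₁, hR⟩
  obtain rfl := Part.mem_unique ha ha₁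
  obtain rfl := Part.mem_unique hb hb₁
  exact ⟨a, ha', b, hb', hR⟩

theorem lift₃_mk {R : ∀ i, A i → B i → D i → Prop} {φ : Rep C ν} {ψ : Rep C μ} {χ : Rep C ξ} :
    Lift₃ R (CohProd.mk φ) (CohProd.mk ψ) (CohProd.mk χ) ↔
      ∀ᶠ i in almostAll C, ∃ a ∈ φ.val i, ∃ b ∈ ψ.val i, ∃ d ∈ χ.val i, R i a b d := by
  refine ⟨?_, fun h => ⟨φ, ψ, χ, rfl, rfl, rfl, h⟩⟩
  rintro ⟨φ', ψ', χ', h₁, h₂, h₃, h⟩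
  have e₁ : ∀ᶠ i in almostAll C, ∃ a, a ∈ φ'.val i ∧ a ∈ φ.val i := Quotient.exact h₁
  have e₂ : ∀ᶠ i in almostAll C, ∃ a, a ∈ ψ'.val i ∧ a ∈ ψ.val i := Quotient.exact h₂
  have e₃ : ∀ᶠ i in almostAll C, ∃ a, a ∈ χ'.val i ∧ a ∈ χ.val i := Quotient.exact h₃
  filter_upwards [e₁, e₂, e₃, h]
  rintro i ⟨a, ha, ha'⟩ ⟨b, hb, hb'⟩ ⟨d, hd, hd'⟩ ⟨a₁, ha₁, b₁, hb₁, d₁, hd₁, hR⟩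
  obtain rfl := Part.mem_unique ha ha₁
  obtain rfl := Part.mem_unique hb hb₁
  obtain rfl := Part.mem_unique hd hd₁
  exact ⟨a, ha', b, hb', d, hd', hR⟩

end Lift

/-! ## Hyper-natural numbers and products along a hyper-natural number -/

/-- Partial computable functions into `ℕ` that are defined almost everywhere. -/
abbrev Index (C : Set ℕ) : Type := Rep C fun _ => natNumbering

/-- The hyper-natural numbers `∏_C ℕ`. -/
def HyperNat (C : Set ℕ) : Type := CohProd C fun _ => natNumbering

/-- The order of `∏_C ℕ`. -/
instance (C : Set ℕ) : LT (HyperNat C) := ⟨Lift₂ fun _ n m => n < m⟩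

/-- A chosen representative of a hyper-natural number. -/
noncomputable def HyperNat.rep {C : Set ℕ} (N : HyperNat C) : Index C := Quotient.out N

/-- The index function `i ↦ i`. -/
def idIndex (C : Set ℕ) : Index C where
  val i := Part.some i
  partrec := by
    simp only [Part.map_some]
    exact Computable.id
  dom := .of_forall fun _ => trivial

/-- The reindexed sequence `i ↦ A (φ i)`; the set is empty if `φ i` is undefined. -/
abbrev Reindex {C : Set ℕ} (φ : Index C) (A : ℕ → Type u) (i : ℕ) : Type u :=
  Σ' h : (φ.val i).Dom, A ((φ.val i).get h)

/-- The presentation of `A (φ i)`. -/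
def reindexNumbering {C : Set ℕ} (φ : Index C) {A : ℕ → Type u} (ν : ∀ n, Numbering (A n)) (i : ℕ) :
    Numbering (Reindex φ A i) where
  code x := (ν _).code x.2
  inj := by
    rintro ⟨h, a⟩ ⟨_, b⟩ hab
    obtain rfl : a = b := (ν _).inj hab
    rfl

/-- The cohesive product `∏_{C,φ} A i = ∏_C A (φ i)`. -/
abbrev ProdAlong {C : Set ℕ} (φ : Index C) {A : ℕ → Type u} (ν : ∀ n, Numbering (A n)) : Type u :=
  CohProd C (reindexNumbering φ ν)

/-! ## Cohesive products of groups -/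

section Group

variable {C : Set ℕ} (φ : Index C) {G : ℕ → Type u} [∀ n, Group (G n)] (ν : ∀ n, Numbering (G n))

theorem partrec_index : Partrec φ.val :=
  φ.partrec.of_eq fun _ => Part.map_id' (fun _ => rfl) _

variable [UniformGroups ν]

/-- The constant function with value `1`. -/
def Rep.one : Rep C (reindexNumbering φ ν) where
  val i := ⟨(φ.val i).Dom, fun h => ⟨h, 1⟩⟩
  partrec := by
    have h1 : Computable fun n => (ν n).code 1 := UniformGroups.one (ν := ν)
    refine ((partrec_index φ).map (h1.comp Computable.snd).to₂).of_eq fun i => ?_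
    exact Part.ext' Iff.rfl fun _ _ => rfl
  dom := φ.dom

/-- The pointwise inverse. -/
def Rep.inv (x : Rep C (reindexNumbering φ ν)) : Rep C (reindexNumbering φ ν) where
  val i := (x.val i).map fun a => ⟨a.1, a.2⁻¹⟩
  partrec := by
    obtain ⟨c, hc, h⟩ := UniformGroups.inv (ν := ν)
    have hpair : Computable fun p : (ℕ × ℕ) × ℕ => c (p.2, p.1.2) :=
      hc.comp (Computable.snd.pair (Computable.snd.comp Computable.fst))
    refine (x.partrec.bind (Partrec.map (f := fun p : ℕ × ℕ => φ.val p.1)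
      (g := fun p n => c (n, p.2)) ((partrec_index φ).comp Computable.fst) hpair.to₂).to₂).of_eq
      fun i => ?_
    refine Part.ext' ⟨fun hd => ?_, fun hd => ?_⟩ fun h₁ h₂ => ?_
    · exact hd.1
    · exact ⟨hd, ((x.val i).get hd).1⟩
    · exact h _ _
  dom := x.dom

/-- The pointwise product. -/
def Rep.mul (x y : Rep C (reindexNumbering φ ν)) : Rep C (reindexNumbering φ ν) where
  val i := (x.val i).bind fun a => (y.val i).map fun b => ⟨a.1, a.2 * b.2⟩
  partrec := by
    obtain ⟨c, hc, h⟩ := UniformGroups.mul (ν := ν)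
    have hpair : Computable fun p : ((ℕ × ℕ) × ℕ) × ℕ => c (p.2, p.1.1.2, p.1.2) :=
      hc.comp (Computable.snd.pair ((Computable.snd.comp (Computable.fst.comp Computable.fst)).pair
        (Computable.snd.comp Computable.fst)))
    refine (x.partrec.bind (Partrec.bind (f := fun p : ℕ × ℕ =>
        (y.val p.1).map (reindexNumbering φ ν p.1).code)
      (g := fun p b => (φ.val p.1).map fun n => c (n, p.2, b))
      (y.partrec.comp Computable.fst)
      (Partrec.map (f := fun q : (ℕ × ℕ) × ℕ => φ.val q.1.1)
        (g := fun q n => c (n, q.1.2, q.2))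
        ((partrec_index φ).comp (Computable.fst.comp Computable.fst)) hpair.to₂).to₂).to₂).of_eq
      fun i => ?_
    refine Part.ext' ⟨fun hd => ?_, fun hd => ?_⟩ fun h₁ h₂ => ?_
    · exact ⟨hd.1, hd.2.1⟩
    · exact ⟨hd.1, hd.2, ((x.val i).get hd.1).1⟩
    · exact h _ _ _
  dom := (x.dom.and y.dom).mono fun _ h => ⟨h.1, h.2⟩

theorem Rep.mem_mul {x y : Rep C (reindexNumbering φ ν)} {i : ℕ} {a b : Reindex φ G i}
    (ha : a ∈ x.val i) (hb : b ∈ y.val i) :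
    (⟨a.1, a.2 * b.2⟩ : Reindex φ G i) ∈ (Rep.mul φ ν x y).val i :=
  Part.mem_bind ha (Part.mem_map _ hb)

theorem Rep.mem_inv {x : Rep C (reindexNumbering φ ν)} {i : ℕ} {a : Reindex φ G i}
    (ha : a ∈ x.val i) : (⟨a.1, a.2⁻¹⟩ : Reindex φ G i) ∈ (Rep.inv φ ν x).val i :=
  Part.mem_map (fun a : Reindex φ G i => (⟨a.1, a.2⁻¹⟩ : Reindex φ G i)) ha

/-- The group `∏_{C,φ} G i`, with the pointwise operations. -/
noncomputable instance ProdAlong.group : Group (ProdAlong φ ν) where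
  mul := Quotient.map₂ (Rep.mul φ ν) fun x x' hx y y' hy => by
    filter_upwards [show ∀ᶠ i in almostAll C, _ from hx, show ∀ᶠ i in almostAll C, _ from hy]
    rintro i ⟨a, ha, ha'⟩ ⟨b, hb, hb'⟩
    exact ⟨_, Rep.mem_mul φ ν ha hb, Rep.mem_mul φ ν ha' hb'⟩
  one := CohProd.mk (Rep.one φ ν)
  inv := Quotient.map (Rep.inv φ ν) fun x x' hx => by
    filter_upwards [show ∀ᶠ i in almostAll C, _ from hx]
    rintro i ⟨a, ha, ha'⟩
    exact ⟨_, Rep.mem_inv φ ν ha, Rep.mem_inv φ ν ha'⟩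
  mul_assoc := by
    rintro ⟨x⟩ ⟨y⟩ ⟨z⟩
    refine Quotient.sound ?_
    show ∀ᶠ i in almostAll C, _
    filter_upwards [x.dom, y.dom, z.dom] with _ hx hy hz
    have hx := Part.get_mem hx
    have hy := Part.get_mem hy
    have hz := Part.get_mem hz
    refine ⟨_, Rep.mem_mul φ ν (Rep.mem_mul φ ν hx hy) hz, ?_⟩
    have := Rep.mem_mul φ ν hx (Rep.mem_mul φ ν hy hz)
    rwa [← mul_assoc] at this
  one_mul := by
    rintro ⟨x⟩
    refine Quotient.sound ?_
    show ∀ᶠ i in almostAll C, _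
    filter_upwards [x.dom] with i hx
    have hx := Part.get_mem hx
    have h1 : (⟨((x.val i).get ‹_›).1, 1⟩ : Reindex φ G i) ∈ (Rep.one φ ν).val i := ⟨_, rfl⟩
    have := Rep.mem_mul φ ν h1 hx
    rw [one_mul] at this
    exact ⟨_, this, hx⟩
  mul_one := by
    rintro ⟨x⟩
    refine Quotient.sound ?_
    show ∀ᶠ i in almostAll C, _
    filter_upwards [x.dom] with i hx
    have hx := Part.get_mem hx
    have h1 : (⟨((x.val i).get ‹_›).1, 1⟩ : Reindex φ G i) ∈ (Rep.one φ ν).val i := ⟨_, rfl⟩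
    have := Rep.mem_mul φ ν hx h1
    rw [mul_one] at this
    exact ⟨_, this, hx⟩
  inv_mul_cancel := by
    rintro ⟨x⟩
    refine Quotient.sound ?_
    show ∀ᶠ i in almostAll C, _
    filter_upwards [x.dom] with i hx
    have hx := Part.get_mem hx
    have h1 : (⟨((x.val i).get ‹_›).1, 1⟩ : Reindex φ G i) ∈ (Rep.one φ ν).val i := ⟨_, rfl⟩
    have := Rep.mem_mul φ ν (Rep.mem_inv φ ν hx) hx
    rw [inv_mul_cancel] at this
    exact ⟨_, this, h1⟩

theorem ProdAlong.mk_mul (x y : Rep C (reindexNumbering φ ν)) :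
    (CohProd.mk x * CohProd.mk y : ProdAlong φ ν) = CohProd.mk (Rep.mul φ ν x y) := rfl

end Group

/-! ## Projective limits -/

/-- The projective limit `{(g_i) | f_{m,n}(g_m) = g_n for all n < m}`; here `f n m` is the map
`G m → G n`. -/
def projLim {I : Type u} [LT I] {G : I → Type v} [∀ i, Group (G i)]
    (f : ∀ n m : I, n < m → (G m →* G n)) : Subgroup (∀ i, G i) where
  carrier := {g | ∀ n m (h : n < m), f n m h (g m) = g n}
  mul_mem' {a b} ha hb := fun n m h => by
    rw [Pi.mul_apply, map_mul, ha n m h, hb n m h, Pi.mul_apply]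
  one_mem' := fun n m h => by simp
  inv_mem' {a} ha := fun n m h => by rw [Pi.inv_apply, map_inv, ha n m h, Pi.inv_apply]

/-! ## Hyper-automorphism groups -/

section HAut

variable {C : Set ℕ}

/-- The domain of `∏_{C,φ} 𝒯_{A i}`, where `𝒯_A` is the tree of finite tuples of elements of `A`. -/
abbrev HyperTuples (φ : Index C) {A : ℕ → Type u} (ν : ∀ n, Numbering (A n)) : Type u :=
  ProdAlong φ fun n => (ν n).list

section Tree

variable {φ : Index C} {A : ℕ → Type u} {ν : ∀ n, Numbering (A n)}

/-- The extension order `a ⪯ b`. -/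
def IsPrefix (a b : HyperTuples φ ν) : Prop := Lift₂ (fun _ s t => s.2 <+: t.2) a b

/-- `c` is the concatenation of `a` and `b`. -/
def IsConcat (a b c : HyperTuples φ ν) : Prop := Lift₃ (fun _ s t r => r.2 = s.2 ++ t.2) a b c

/-- The hyper-natural number `N` is the arity of `a`. -/
def IsArity (a : HyperTuples φ ν) (N : HyperNat C) : Prop :=
  Lift₂ (fun _ s n => s.2.length = n) a N

end Tree

/-- The group `HAut(∏_{C,φ} 𝒯_{A i})`: the permutations of `∏_{C,φ} 𝒯_{A i}` that preserve the
extension order, concatenation and arity. -/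
def treeHAut (φ : Index C) {A : ℕ → Type u} (ν : ∀ n, Numbering (A n)) :
    Subgroup (Equiv.Perm (HyperTuples φ ν)) where
  carrier := {σ | (∀ a b, IsPrefix a b ↔ IsPrefix (σ a) (σ b)) ∧
    (∀ a b c, IsConcat a b c ↔ IsConcat (σ a) (σ b) (σ c)) ∧
    ∀ a N, IsArity a N ↔ IsArity (σ a) N}
  mul_mem' {σ τ} hσ hτ :=
    ⟨fun a b => (hτ.1 a b).trans (hσ.1 _ _), fun a b c => (hτ.2.1 a b c).trans (hσ.2.1 _ _ _),
      fun a N => (hτ.2.2 a N).trans (hσ.2.2 _ N)⟩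
  one_mem' := ⟨fun _ _ => Iff.rfl, fun _ _ _ => Iff.rfl, fun _ _ => Iff.rfl⟩
  inv_mem' {σ} hσ :=
    ⟨fun a b => by simpa using (hσ.1 (σ⁻¹ a) (σ⁻¹ b)).symm,
      fun a b c => by simpa using (hσ.2.1 (σ⁻¹ a) (σ⁻¹ b) (σ⁻¹ c)).symm,
      fun a N => by simpa using (hσ.2.2 (σ⁻¹ a) N).symm⟩

section Fields

variable {F : Type v} [Field F] (νF : Numbering F) (φ : Index C) {A : ℕ → Type u}
  [∀ n, Field (A n)] [∀ n, Algebra F (A n)] (ν : ∀ n, Numbering (A n))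

/-- The integral hyper-polynomials `∏_C ℤ[x₁, x₂, …]`. -/
abbrev HyperPoly (C : Set ℕ) : Type := CohProd C fun _ => polyNumbering

variable {φ ν} in
/-- `|a| = var(p)`, and `b` is the value `p(a)`, regarded as a `1`-tuple. -/
def IsValue (p : HyperPoly C) (a b : HyperTuples φ ν) : Prop :=
  Lift₃ (fun _ q s t => s.2.length = numVars q ∧ t.2 = [evalTuple q s.2]) p a b

variable {φ ν} in
/-- `a` lies in the image of `∏_C 𝒯_F`. -/
def IsBaseTuple (a : HyperTuples φ ν) : Prop :=
  ∃ c : CohProd C fun _ => νF.list,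
    Lift₂ (fun i l (s : Reindex φ (fun n => List (A n)) i) =>
      s.2 = l.map (algebraMap F (A ((φ.val i).get s.1)))) c a

/-- The group `HAut(∏_{C,φ} A i / ∏_C F)`: the elements of `HAut(∏_{C,φ} 𝒯_{A i})` that commute
with the integral hyper-polynomials and fix `∏_C 𝒯_F` pointwise. -/
def HAut : Subgroup (Equiv.Perm (HyperTuples φ ν)) where
  carrier := {σ | σ ∈ treeHAut φ ν ∧
    (∀ (p : HyperPoly C) a b, IsValue p a b ↔ IsValue p (σ a) (σ b)) ∧
    ∀ a, IsBaseTuple νF a → σ a = a}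
  mul_mem' {σ τ} hσ hτ :=
    ⟨mul_mem hσ.1 hτ.1, fun p a b => (hτ.2.1 p a b).trans (hσ.2.1 p _ _), fun a ha => by
      rw [Equiv.Perm.mul_apply, hτ.2.2 a ha, hσ.2.2 a ha]⟩
  one_mem' := ⟨one_mem _, fun _ _ _ => Iff.rfl, fun _ _ => rfl⟩
  inv_mem' {σ} hσ :=
    ⟨inv_mem hσ.1, fun p a b => by simpa using (hσ.2.1 p (σ⁻¹ a) (σ⁻¹ b)).symm, fun a ha => by
      rw [Equiv.Perm.inv_eq_iff_eq, hσ.2.2 a ha]⟩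

end Fields

section Restriction

variable {φ ψ : Index C} {A : ℕ → Type u} {B : ℕ → Type v} [∀ n, Field (A n)] [∀ n, Field (B n)]
  {ν : ∀ n, Numbering (A n)} {μ : ∀ n, Numbering (B n)}
  (K : Type w) [Field K] [∀ n, Algebra (A n) K] [∀ n, Algebra (B n) K]

/-- For subfields `A n`, `B n` of `K`: the hyper-tuples `a` and `b` are equal as hyper-tuples of
elements of `K`. -/
def SameTuple (a : HyperTuples φ ν) (b : HyperTuples ψ μ) : Prop :=
  Lift₂ (fun i (s : Reindex φ (fun n => List (A n)) i) (t : Reindex ψ (fun n => List (B n)) i) =>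
    s.2.map (algebraMap (A ((φ.val i).get s.1)) K) =
      t.2.map (algebraMap (B ((ψ.val i).get t.1)) K)) a b

/-- `τ` is the restriction of `σ`: every `a` in the smaller set also lies in the larger one, and
`τ a` and `σ a` are equal. -/
def IsRestriction (σ : Equiv.Perm (HyperTuples ψ μ)) (τ : Equiv.Perm (HyperTuples φ ν)) : Prop :=
  ∀ a, ∃ b, SameTuple K a b ∧ SameTuple K (τ a) (σ b)

end Restriction

end HAut

/-! ## Fully computable Galois extensions -/

section Galois

variable {F : Type u} {K : Type v} [Field F] [Field K] [Algebra F K]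

/-- The restriction homomorphism `Gal(L'/F) → Gal(L/F)` for `L ≤ L'`. -/
noncomputable def galRestrict {L L' : FiniteGaloisIntermediateField F K} (h : L ≤ L') :
    (L' ≃ₐ[F] L') →* (L ≃ₐ[F] L) :=
  letI : Algebra L L' := (IntermediateField.inclusion h).toRingHom.toAlgebra
  haveI : IsScalarTower F L L' := IsScalarTower.of_algebraMap_eq fun _ => rfl
  AlgEquiv.restrictNormalHom L

theorem galRestrict_apply {L L' : FiniteGaloisIntermediateField F K} (h : L ≤ L')
    (g : L' ≃ₐ[F] L') (x : L) :
    ((galRestrict h g x : L) : K) = (g (IntermediateField.inclusion h x) : L') := by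
  let _ : Algebra L L' := (IntermediateField.inclusion h).toRingHom.toAlgebra
  have : IsScalarTower F L L' := IsScalarTower.of_algebraMap_eq fun _ => rfl
  exact congrArg (Subtype.val) (AlgEquiv.restrictNormal_commutes g L x)

end Galois

/-- The data of a fully computable Galois extension `K/F`: presentations of `F`, `K`, of finite
Galois sub-extensions `L 0 ⊊ L 1 ⊊ ⋯` with union `K`, and of the finite groups `Gal(L i / F)`, such
that everything in sight is uniformly computable. A finite group is given together with its
order. -/
structure FullyComputable (F : Type u) (K : Type v) [Field F] [Field K] [Algebra F K] where
  νF : Numbering F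
  νK : Numbering K
  L : ℕ → FiniteGaloisIntermediateField F K
  νL : ∀ i, Numbering (L i)
  νG : ∀ i, Numbering (L i ≃ₐ[F] L i)
  baseField : UniformFields fun _ : ℕ => νF
  topField : UniformFields fun _ : ℕ => νK
  fields : UniformFields νL
  base_top : UniformMap (fun _ : ℕ => νF) (fun _ : ℕ => νK) fun _ => algebraMap F K
  base_field : UniformMap (fun _ => νF) νL fun i => algebraMap F (L i)
  field_top : UniformMap νL (fun _ => νK) fun i => algebraMap (L i) K
  lt_succ : ∀ i, L i < L (i + 1)
  field_succ : UniformMap νL (fun i => νL (i + 1)) fun i =>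
    IntermediateField.inclusion (lt_succ i).le
  union : ∀ x : K, ∃ i, x ∈ (L i).toIntermediateField
  groups : UniformGroups νG
  order : Computable fun i => Nat.card (L i ≃ₐ[F] L i)
  quotients : ∃ q : ℕ × ℕ × ℕ → ℕ, Computable q ∧
    ∀ n m (h : n < m) (g : L m ≃ₐ[F] L m),
      q (n, m, (νG m).code g) = (νG n).code (galRestrict (strictMono_nat_of_lt_succ lt_succ h).le g)
  actions : UniformMap₂ νG νL νL fun _ g x => g x

namespace FullyComputable

variable {F : Type u} {K : Type v} [Field F] [Field K] [Algebra F K] (E : FullyComputable F K)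

/-- The Galois group `Gal(L n / F)`. -/
abbrev Gal (n : ℕ) : Type v := E.L n ≃ₐ[F] E.L n

instance : UniformGroups E.νG := E.groups

/-- The quotient map `Gal(L m / F) → Gal(L n / F)` for `n < m` (and the trivial map otherwise). -/
noncomputable def galMap (n m : ℕ) : E.Gal m →* E.Gal n :=
  open Classical in
  if h : n < m then galRestrict (strictMono_nat_of_lt_succ E.lt_succ h).le else 1

variable {C : Set ℕ}

/-- The group `HAut(∏_C K / ∏_C F)`. -/
abbrev HAutTop (C : Set ℕ) :
    Subgroup (Equiv.Perm (HyperTuples (idIndex C) fun _ => E.νK)) :=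
  HAut E.νF (idIndex C) fun _ => E.νK

/-- The group `HAut(∏_{C,N} L i / ∏_C F)`. -/
noncomputable abbrev HAutAt (N : HyperNat C) : Subgroup (Equiv.Perm (HyperTuples N.rep E.νL)) :=
  HAut E.νF N.rep E.νL

/-- The group `∏_{C,N} Gal(L i / F)`. -/
noncomputable abbrev GalAt (N : HyperNat C) : Type v := ProdAlong N.rep E.νG

theorem galMap_of_lt {n m : ℕ} (h : n < m) :
    E.galMap n m = galRestrict (strictMono_nat_of_lt_succ E.lt_succ h).le := dif_pos h

theorem galMap_of_not_lt {n m : ℕ} (h : ¬n < m) : E.galMap n m = 1 := dif_neg h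

theorem exists_galMap_code : ∃ c : ℕ × ℕ × ℕ → ℕ, Computable c ∧
    ∀ n m (g : E.Gal m), c (n, m, (E.νG m).code g) = (E.νG n).code (E.galMap n m g) := by
  obtain ⟨q, hq, h⟩ := E.quotients
  have h1 : Computable fun n => (E.νG n).code 1 := UniformGroups.one (ν := E.νG)
  have hlt' : Computable fun p : ℕ × ℕ × ℕ => decide (p.1 < p.2.1) :=
    (Primrec.nat_lt.comp Primrec.fst (Primrec.fst.comp Primrec.snd)).decide.to_comp
  have h1' : Computable fun p : ℕ × ℕ × ℕ => (E.νG p.1).code 1 := h1.comp Computable.fst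
  refine ⟨_, Computable.cond hlt' hq h1', fun n m g => ?_⟩
  by_cases hnm : n < m
  · rw [E.galMap_of_lt hnm, ← h n m hnm g]
    exact congrArg (fun b => cond b _ _) (decide_eq_true hnm)
  · rw [E.galMap_of_not_lt hnm]
    exact congrArg (fun b => cond b _ _) (decide_eq_false hnm)

/-- The pointwise quotient map `i ↦ f_{M(i),N(i)}(g(i))` on representatives. -/
noncomputable def quotRep (φ ψ : Index C) (x : Rep C (reindexNumbering ψ E.νG)) :
    Rep C (reindexNumbering φ E.νG) where
  val i := (x.val i).bind fun g => ⟨(φ.val i).Dom, fun h => ⟨h, E.galMap _ _ g.2⟩⟩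
  partrec := by
    obtain ⟨c, hc, h⟩ := E.exists_galMap_code
    have hpair : Computable fun p : ((ℕ × ℕ) × ℕ) × ℕ => c (p.1.2, p.2, p.1.1.2) :=
      hc.comp ((Computable.snd.comp Computable.fst).pair
        (Computable.snd.pair (Computable.snd.comp (Computable.fst.comp Computable.fst))))
    refine (x.partrec.bind (Partrec.bind (f := fun p : ℕ × ℕ => φ.val p.1)
      (g := fun p n => (ψ.val p.1).map fun m => c (n, m, p.2))
      ((partrec_index φ).comp Computable.fst)
      (Partrec.map (f := fun p : (ℕ × ℕ) × ℕ => ψ.val p.1.1)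
        (g := fun p m => c (p.2, m, p.1.2))
        ((partrec_index ψ).comp (Computable.fst.comp Computable.fst)) hpair.to₂).to₂).to₂).of_eq
      fun i => ?_
    refine Part.ext' ⟨fun hd => ?_, fun hd => ?_⟩ fun h₁ h₂ => ?_
    · exact ⟨hd.1, hd.2.1⟩
    · exact ⟨hd.1, hd.2, ((x.val i).get hd.1).1⟩
    · exact h _ _ _
  dom := (x.dom.and φ.dom).mono fun _ h => ⟨h.1, h.2⟩

theorem mem_quotRep {φ ψ : Index C} {x : Rep C (reindexNumbering ψ E.νG)} {i : ℕ}
    {g : Reindex ψ E.Gal i} (hg : g ∈ x.val i) (h : (φ.val i).Dom) :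
    (⟨h, E.galMap _ _ g.2⟩ : Reindex φ E.Gal i) ∈ (E.quotRep φ ψ x).val i :=
  Part.mem_bind hg ⟨h, rfl⟩

/-- The induced homomorphism `f_{M,N} : ∏_{C,M} Gal(L i / F) → ∏_{C,N} Gal(L i / F)`, given by
`f_{M,N}(g)(i) = f_{M(i),N(i)}(g(i))`. -/
noncomputable def quot (N M : HyperNat C) : E.GalAt M →* E.GalAt N :=
  MonoidHom.mk' (Quotient.map (E.quotRep N.rep M.rep) fun x x' hx => by
    filter_upwards [show ∀ᶠ i in almostAll C, _ from hx, N.rep.dom]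
    rintro i ⟨a, ha, ha'⟩ hN
    exact ⟨_, E.mem_quotRep ha hN, E.mem_quotRep ha' hN⟩) <| by
    rintro ⟨x⟩ ⟨y⟩
    refine Quotient.sound ?_
    show ∀ᶠ i in almostAll C, _
    filter_upwards [x.dom, y.dom, N.rep.dom] with i hx hy hN
    have hx := Part.get_mem hx
    have hy := Part.get_mem hy
    refine ⟨_, E.mem_quotRep (Rep.mem_mul _ _ hx hy) hN, ?_⟩
    have := Rep.mem_mul _ _ (E.mem_quotRep hx hN) (E.mem_quotRep hy hN)
    rwa [← map_mul] at this

/-- The permutation `τ` of the hyper-tuples over `∏_{C,N} L i` is the coordinatewise action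
`τ(a)(i) = g(i)(a(i))` of `g`. -/
def ActsAs {N : HyperNat C} (g : E.GalAt N) (τ : Equiv.Perm (HyperTuples N.rep E.νL)) : Prop :=
  ∀ a, Lift₃ (fun i (g : Reindex N.rep E.Gal i) (s t : Reindex N.rep (fun n => List (E.L n)) i) =>
    t.2 = s.2.map g.2) g a (τ a)

end FullyComputable

end HyperGalois

open HyperGalois

/-!
The hyper-automorphisms over `∏_C F` turn out to be exactly the coordinatewise actions of elements of
the cohesive products of Galois groups, and all isomorphisms of the theorem follow from this.

*Sequences instead of classes.* `K` is infinite and has a computable numbering, so it can be made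
`Primcodable` in a way that respects the numbering (`Numbering.exists_primcodable`). A hyper-tuple
over subfields of `K` is then the same thing as a sequence of tuples in `K`, up to equality for
almost every `i ∈ C`, that agrees almost everywhere with a partial computable function
(`tupleSeq`, `HyperComputable`, `EffectiveEmbedding.exists_tuple`), and the relations on
hyper-tuples become relations that hold for almost every `i`. Computability enters only through
r.e. relations: they are closed under the relevant connectives and quantifiers, they have partial
computable sections (`rePred_uniformize`), and along a cohesive set they satisfy an overspill
principle (`HyperComputable.dichotomy`): either almost no instance is inhabited, or a
hyper-computable sequence inhabits almost all instances.

*Hyper-automorphisms are coordinatewise.* Let `f` be a map on hyper-tuples over `L (φ i)` that fixes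
hyper-tuples over `F` and preserves arity, concatenation and the polynomial `x₁ x₂ + x₃`. Since a
hyper-tuple can be split at a coordinate of hyper-finite index, `f` acts on the coordinates
(`IsHyperHom.getElem?_eq`). The intermediate results of Horner's rule form a hyper-tuple, and by
overspill its image satisfies the same recursion, as a failure would occur at some hyper-finite
index. Hence `f` commutes with polynomials over `F` of hyper-finite degree
(`IsHyperHom.onElem_horner`). Take a sequence of generators `a i` of `L (φ i) / F` and monic
polynomials over `F` of degree `[L (φ i) : F]` that vanish at the conjugates of `a i`. Then `f a` is
a root, so `f a = g a` for some `g ∈ ∏_{C,φ} Gal(L i / F)`. All elements are polynomials in `a`, so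
`f` agrees with `g` on them, and another overspill gives the same for hyper-tuples
(`IsHyperHom.exists_galSeq`).

*The isomorphisms.* Conversely the coordinatewise actions are hyper-automorphisms, and an element of
`∏_{C,φ} Gal(L i / F)` is determined by its value at `a`. This gives `γ`
(`exists_mulEquiv_galAt`), and the restriction maps are the quotient maps transported along `γ`.
Every hyper-tuple over `K` is a hyper-tuple over `∏_{C,N} L i` for some `N`, and any three
hyper-naturals have a common upper bound, so compatible families of actions fit together to
hyper-automorphisms over `K` (`exists_mulEquiv_top`).
-/

namespace HyperGalois

/-! ### Recursively enumerable predicates -/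

section RE

variable {α β γ : Type*} [Primcodable α] [Primcodable β] [Primcodable γ]

theorem rePred_comp {p : β → Prop} (hp : REPred p) {f : α → β} (hf : Computable f) :
    REPred fun a => p (f a) :=
  Partrec.comp hp hf

theorem rePred_and {p q : α → Prop} (hp : REPred p) (hq : REPred q) :
    REPred fun a => p a ∧ q a := by
  have h := Partrec.bind (f := fun a => Part.assert (p a) fun _ => Part.some ())
    (g := fun a _ => Part.assert (q a) fun _ => Part.some ()) hp
    (Partrec.comp hq Computable.fst).to₂
  exact h.dom_re.of_eq fun a => by simp [Part.assert, Part.bind]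

theorem rePred_eq {f g : α → β} (hf : Computable f) (hg : Computable g) :
    REPred fun a => f a = g a := by
  classical
  exact (rePred_comp (PrimrecPred.computablePred (p := fun q : β × β => q.1 = q.2)
    Primrec.eq).to_re (hf.pair hg))

theorem rePred_ne {f g : α → β} (hf : Computable f) (hg : Computable g) :
    REPred fun a => f a ≠ g a := by
  classical
  exact (rePred_comp (PrimrecPred.computablePred (p := fun q : β × β => q.1 = q.2)
    Primrec.eq).not.to_re (hf.pair hg))

theorem rePred_mem {f : α →. β} (hf : Partrec f) : REPred fun p : α × β => p.2 ∈ f p.1 := by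
  have h := Partrec.bind (hf.comp (Computable.fst (α := α) (β := β)))
    (g := fun (p : α × β) (b : β) => Part.assert (p.2 = b) fun _ => Part.some ())
    (rePred_eq (Computable.snd.comp Computable.fst) Computable.snd)
  exact h.dom_re.of_eq fun p => by
    simp [Part.dom_iff_mem, Part.mem_bind_iff]

/-- Uniformization: a section of an r.e. relation over its domain is found by searching through all
pairs of a candidate value and a number of computation steps that confirms it. -/
theorem rePred_uniformize {V : α → β → Prop} (hV : REPred fun p : α × β => V p.1 p.2) :
    ∃ f : α →. β, Partrec f ∧ (∀ a, ∀ b ∈ f a, V a b) ∧ ∀ a, (∃ b, V a b) → (f a).Dom := by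
  obtain ⟨c, hc⟩ := Nat.Partrec.Code.exists_code.1 hV
  have key (a : α) (b : β) :
      V a b ↔ ∃ k, ((Nat.Partrec.Code.evaln k c (Encodable.encode (a, b))).isSome : Prop) := by
    have h1 : (Nat.Partrec.Code.eval c (Encodable.encode (a, b))).Dom ↔ V a b := by
      rw [hc]
      simp [Part.assert, Part.bind]
    rw [← h1, Part.dom_iff_mem]
    constructor
    · rintro ⟨x, hx⟩
      obtain ⟨k, hk⟩ := Nat.Partrec.Code.evaln_complete.1 hx
      exact ⟨k, Option.isSome_iff_exists.2 ⟨x, hk⟩⟩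
    · rintro ⟨k, hk⟩
      obtain ⟨x, hx⟩ := Option.isSome_iff_exists.1 hk
      exact ⟨x, Nat.Partrec.Code.evaln_complete.2 ⟨k, hx⟩⟩
  let F : α → ℕ → Option β := fun a n =>
    (Encodable.decode (α := β) n.unpair.1).bind fun b =>
      (Nat.Partrec.Code.evaln n.unpair.2 c (Encodable.encode (a, b))).map fun _ => b
  have hF : Computable₂ F := by
    have hdec : Primrec fun q : α × ℕ => Encodable.decode (α := β) q.2.unpair.1 :=
      Primrec.decode.comp (Primrec.fst.comp (Primrec.unpair.comp Primrec.snd))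
    have hev : Primrec fun r : (α × ℕ) × β =>
        Nat.Partrec.Code.evaln r.1.2.unpair.2 c (Encodable.encode (r.1.1, r.2)) :=
      Nat.Partrec.Code.primrec_evaln.comp
        (((Primrec.snd.comp (Primrec.unpair.comp (Primrec.snd.comp Primrec.fst))).pair
          (Primrec.const c)).pair
          (Primrec.encode.comp ((Primrec.fst.comp Primrec.fst).pair Primrec.snd)))
    exact (Primrec.option_bind hdec
      (Primrec.option_map hev (Primrec.snd.comp Primrec.fst).to₂).to₂).to_comp
  refine ⟨fun a => Nat.rfindOpt (F a), Partrec.rfindOpt hF, fun a b hb => ?_, fun a h => ?_⟩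
  · obtain ⟨n, hn⟩ := Nat.rfindOpt_spec hb
    obtain ⟨b', _, hn⟩ := Option.bind_eq_some_iff.1 (Option.mem_def.1 hn)
    obtain ⟨x, hx, rfl⟩ := Option.map_eq_some_iff.1 hn
    exact (key a _).2 ⟨_, Option.isSome_iff_exists.2 ⟨x, hx⟩⟩
  · obtain ⟨b, hb⟩ := h
    obtain ⟨k, hk⟩ := (key a b).1 hb
    obtain ⟨x, hx⟩ := Option.isSome_iff_exists.1 hk
    exact Nat.rfindOpt_dom.2 ⟨Nat.pair (Encodable.encode b) k, b, by
      simp only [Encodable.encode_prod_val] at hx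
      simp [F, hx]⟩

theorem rePred_exists {V : α → β → Prop} (hV : REPred fun p : α × β => V p.1 p.2) :
    REPred fun a => ∃ b, V a b := by
  obtain ⟨f, hf, h₁, h₂⟩ := rePred_uniformize hV
  exact hf.dom_re.of_eq fun a => ⟨fun h => ⟨_, h₁ a _ (Part.get_mem h)⟩, h₂ a⟩

theorem rePred_forall_lt {V : α → ℕ → Prop} (hV : REPred fun p : α × ℕ => V p.1 p.2) {n : α → ℕ}
    (hn : Computable n) : REPred fun a => ∀ j < n a, V a j := by
  have h := Partrec.nat_rec hn (Computable.const ()).partrec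
    (h := fun (a : α) (q : ℕ × Unit) => Part.assert (V a q.1) fun _ => Part.some ())
    (rePred_comp hV (Computable.fst.pair (Computable.fst.comp Computable.snd)))
  refine h.dom_re.of_eq fun a => ?_
  induction n a with
  | zero => simp
  | succ m ih =>
    rw [Nat.forall_lt_succ_right, ← ih]
    simp [Part.assert, Part.bind]

theorem rePred_forall₂ {V : α → β → γ → Prop}
    (hV : REPred fun p : α × β × γ => V p.1 p.2.1 p.2.2) {l : α → List β} {m : α → List γ}
    (hl : Computable l) (hm : Computable m) : REPred fun a => List.Forall₂ (V a) (l a) (m a) := by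
  have hlen := rePred_eq (Computable.list_length.comp hl) (Computable.list_length.comp hm)
  have hbody : REPred fun p : α × ℕ => ∃ q : β × γ,
      (l p.1)[p.2]? = some q.1 ∧ (m p.1)[p.2]? = some q.2 ∧ V p.1 q.1 q.2 := by
    refine rePred_exists (V := fun (p : α × ℕ) (q : β × γ) => _) (rePred_and ?_ (rePred_and ?_ ?_))
    · exact rePred_eq (Computable.list_getElem?.comp
        (hl.comp (Computable.fst.comp Computable.fst)) (Computable.snd.comp Computable.fst))
        (Computable.option_some.comp (Computable.fst.comp Computable.snd))
    · exact rePred_eq (Computable.list_getElem?.comp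
        (hm.comp (Computable.fst.comp Computable.fst)) (Computable.snd.comp Computable.fst))
        (Computable.option_some.comp (Computable.snd.comp Computable.snd))
    · exact rePred_comp hV ((Computable.fst.comp Computable.fst).pair Computable.snd)
  refine (rePred_and hlen (rePred_forall_lt (V := fun a j => ∃ q : β × γ,
    (l a)[j]? = some q.1 ∧ (m a)[j]? = some q.2 ∧ V a q.1 q.2) hbody
    (Computable.list_length.comp hl))).of_eq fun a => ?_
  rw [List.forall₂_iff_get]
  refine and_congr_right fun hlen => forall_congr' fun j => ⟨fun h h₁ h₂ => ?_, fun h hj => ?_⟩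
  · obtain ⟨q, hq₁, hq₂, hq⟩ := h h₁
    rw [List.getElem?_eq_getElem h₁, Option.some_inj] at hq₁
    rw [List.getElem?_eq_getElem h₂, Option.some_inj] at hq₂
    simpa [hq₁, hq₂] using hq
  · exact ⟨((l a)[j], (m a)[j]'(hlen ▸ hj)), List.getElem?_eq_getElem hj,
      List.getElem?_eq_getElem _, h hj _⟩

theorem rePred_forall_mem {V : α → β → Prop} (hV : REPred fun p : α × β => V p.1 p.2)
    {l : α → List β} (hl : Computable l) : REPred fun a => ∀ b ∈ l a, V a b :=
  (rePred_forall₂ (V := fun a b (_ : β) => V a b) (rePred_comp hV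
    (Computable.fst.pair (Computable.fst.comp Computable.snd))) hl hl).of_eq fun a => by
    rw [List.forall₂_same]

theorem computable_list_foldl {l : α → List β} {s : α → γ} {h : α → γ × β → γ}
    (hl : Computable l) (hs : Computable s) (hh : Computable₂ h) :
    Computable fun a => (l a).foldl (fun c b => h a (c, b)) (s a) := by
  have hstep : Computable₂ fun (a : α) (q : ℕ × γ) =>
      Option.casesOn (motive := fun _ => γ) (l a)[q.1]? q.2 fun b => h a (q.2, b) :=
    Computable.option_casesOn
      (Computable.list_getElem?.comp (hl.comp Computable.fst)
        (Computable.fst.comp Computable.snd))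
      (Computable.snd.comp Computable.snd)
      (hh.comp (Computable.fst.comp Computable.fst)
        ((Computable.snd.comp (Computable.snd.comp Computable.fst)).pair Computable.snd)).to₂
  refine (Computable.nat_rec (Computable.list_length.comp hl) hs hstep).of_eq fun a => ?_
  have key (j : ℕ) (hj : j ≤ (l a).length) :
      Nat.rec (motive := fun _ => γ) (s a) (fun y IH =>
        Option.casesOn (motive := fun _ => γ) (l a)[y]? IH fun b => h a (IH, b)) j =
      ((l a).take j).foldl (fun c b => h a (c, b)) (s a) := by
    induction j with
    | zero => rfl
    | succ j ih =>
      rw [List.take_succ_eq_append_getElem hj, List.foldl_append, ← ih (Nat.le_of_succ_le hj)]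
      simp [List.getElem?_eq_getElem (Nat.lt_of_succ_le hj)]
  simpa using key _ le_rfl

end RE

/-! ### Infinite computable sets as primitively recursively coded types -/

/-- An infinite set with a numbering of computable range is in computable bijection with `ℕ`, by
counting the codes that precede a given one. -/
theorem Numbering.exists_primcodable {A : Type*} [Infinite A] (ν : Numbering A)
    (hν : ComputablePred fun n => n ∈ Set.range ν.code) :
    ∃ _ : Primcodable A, Computable ν.code := by
  classical
  let P : ℕ → Prop := fun n => n ∈ Set.range ν.code
  have hinf : {n | P n}.Infinite := Set.infinite_range_of_injective ν.inj
  have hdec : Computable fun n => decide (P n) := hν.decide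
  have hcount : Computable fun n => Nat.count P n := by
    refine (Computable.nat_rec (f := fun n : ℕ => n) (g := fun _ => 0)
      (h := fun (_ : ℕ) (q : ℕ × ℕ) => cond (decide (P q.1)) (q.2 + 1) q.2) Computable.id
      (Computable.const 0) ?_).of_eq fun n => ?_
    · exact (Computable.cond (hdec.comp (Computable.fst.comp Computable.snd))
        (Computable.succ.comp (Computable.snd.comp Computable.snd))
        (Computable.snd.comp Computable.snd)).to₂
    · induction n with
      | zero => simp
      | succ n ih =>
        rw [Nat.count_succ, ← ih]
        by_cases h : P n <;> simp [h]
  have hex : ∀ k, ∃ m, P m ∧ Nat.count P m = k := fun k =>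
    ⟨_, Nat.nth_mem_of_infinite hinf k, Nat.count_nth_of_infinite hinf k⟩
  have hnth : Computable fun k => Nat.nth P k := by
    refine (Computable.find (P := fun k m => P m ∧ Nat.count P m = k) ?_ hex).of_eq fun k => ?_
    · refine Computable.computablePred ?_
      refine (Primrec.and.to_comp.comp (hdec.comp Computable.snd)
        ((PrimrecPred.computablePred (p := fun q : ℕ × ℕ => q.1 = q.2) Primrec.eq).decide.comp
          ((hcount.comp Computable.snd).pair Computable.fst))).of_eq fun q => ?_
      simp
    · obtain ⟨h₁, h₂⟩ := Nat.find_spec (hex k)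
      rw [← Nat.nth_count h₁, h₂]
  let e : A ≃ ℕ := Equiv.ofBijective (fun a => Nat.count P (ν.code a)) ⟨fun a b h => by
      have h' := congrArg (Nat.nth P) h
      simp only at h'
      rw [Nat.nth_count (p := P) ⟨a, rfl⟩, Nat.nth_count (p := P) ⟨b, rfl⟩] at h'
      exact ν.inj h', fun k => by
      obtain ⟨a, ha⟩ := Nat.nth_mem_of_infinite hinf k
      exact ⟨a, by simp only; rw [ha, Nat.count_nth_of_infinite hinf]⟩⟩
  let _ : Primcodable A := Primcodable.ofEquiv ℕ e
  refine ⟨inferInstance, (hnth.comp (Primrec.of_equiv (e := e)).to_comp).of_eq fun a => ?_⟩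
  exact Nat.nth_count (p := P) ⟨a, rfl⟩

/-! ### Sequences that are computable almost everywhere on `C` -/

section HyperComputable

variable {α β : Type*} [Primcodable α] [Primcodable β] {C : Set ℕ}

theorem IsCohesive.neBot (hC : IsCohesive C) : (almostAll C).NeBot := by
  rw [neBot_iff]
  intro h
  have : ∀ᶠ _ in almostAll C, False := by rw [h]; exact eventually_bot
  rw [eventually_almostAll] at this
  simp only [Set.ofPred_false, Set.sdiff_empty] at this
  exact hC.1 this

theorem eventually_choice {ι α : Type*} [Nonempty α] {l : Filter ι} {r : ι → α → Prop}
    (h : ∀ᶠ i in l, ∃ a, r i a) : ∃ f : ι → α, ∀ᶠ i in l, r i (f i) := by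
  classical
  refine ⟨fun i => if hi : ∃ a, r i a then hi.choose else Classical.arbitrary α, ?_⟩
  filter_upwards [h] with i hi
  rw [dif_pos hi]
  exact hi.choose_spec

/-- The sequence `u` agrees with a partial computable function for almost every `i ∈ C`. -/
def HyperComputable (C : Set ℕ) (u : ℕ → α) : Prop :=
  ∃ p : ℕ →. α, Partrec p ∧ ∀ᶠ i in almostAll C, u i ∈ p i

namespace HyperComputable

theorem congr {u v : ℕ → α} (hu : HyperComputable C u) (h : ∀ᶠ i in almostAll C, u i = v i) :
    HyperComputable C v := by
  obtain ⟨p, hp, hpu⟩ := hu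
  refine ⟨p, hp, ?_⟩
  filter_upwards [hpu, h] with i h₁ h₂
  rwa [← h₂]

theorem of_computable {f : ℕ → α} (hf : Computable f) : HyperComputable C f :=
  ⟨_, hf.partrec, .of_forall fun _ => Part.mem_some _⟩

theorem const (a : α) : HyperComputable C fun _ => a := of_computable (Computable.const a)

theorem pair {u : ℕ → α} {v : ℕ → β} (hu : HyperComputable C u) (hv : HyperComputable C v) :
    HyperComputable C fun i => (u i, v i) := by
  obtain ⟨p, hp, hpu⟩ := hu
  obtain ⟨q, hq, hqv⟩ := hv
  refine ⟨fun i => (p i).bind fun a => (q i).map (Prod.mk a), hp.bind (Partrec.map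
    (hq.comp Computable.fst) ((Computable.snd.comp Computable.fst).pair Computable.snd).to₂), ?_⟩
  filter_upwards [hpu, hqv] with i h₁ h₂
  exact Part.mem_bind h₁ (Part.mem_map _ h₂)

theorem map {u : ℕ → α} (hu : HyperComputable C u) {f : α → β} (hf : Computable f) :
    HyperComputable C fun i => f (u i) := by
  obtain ⟨p, hp, hpu⟩ := hu
  refine ⟨fun i => (p i).map f, hp.map (hf.comp Computable.snd).to₂, ?_⟩
  filter_upwards [hpu] with i h
  exact Part.mem_map _ h

theorem index : HyperComputable C fun i => i := of_computable Computable.id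

/-- A section of an r.e. relation, evaluated along a hyper-computable parameter `u`. -/
theorem uniformize [Nonempty β] {u : ℕ → α} (hu : HyperComputable C u) {V : α → β → Prop}
    (hV : REPred fun p : α × β => V p.1 p.2) (h : ∀ᶠ i in almostAll C, ∃ b, V (u i) b) :
    ∃ w : ℕ → β, HyperComputable C w ∧ ∀ᶠ i in almostAll C, V (u i) (w i) := by
  obtain ⟨f, hf, h₁, h₂⟩ := rePred_uniformize hV
  obtain ⟨p, hp, hpu⟩ := hu
  have hd : ∀ᶠ i in almostAll C, ∃ b, b ∈ f (u i) := h.mono fun i hi => ⟨_, Part.get_mem (h₂ _ hi)⟩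
  obtain ⟨w, hw⟩ := eventually_choice hd
  refine ⟨w, ⟨fun i => (p i).bind f, hp.bind (hf.comp Computable.snd).to₂, ?_⟩,
    hw.mono fun i hi => h₁ _ _ hi⟩
  filter_upwards [hpu, hw] with i h₃ h₄
  exact Part.mem_bind h₃ h₄

/-- The overspill principle given by cohesiveness: if an r.e. relation is not almost everywhere
empty along `u`, then it is almost everywhere inhabited, and by a hyper-computable sequence. -/
theorem dichotomy [Nonempty β] (hC : IsCohesive C) {u : ℕ → α} (hu : HyperComputable C u)
    {V : α → β → Prop} (hV : REPred fun p : α × β => V p.1 p.2) :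
    (∀ᶠ i in almostAll C, ∀ b, ¬V (u i) b) ∨
      ∃ w : ℕ → β, HyperComputable C w ∧ ∀ᶠ i in almostAll C, V (u i) (w i) := by
  obtain ⟨p, hp, hpu⟩ := hu
  have hW : REPred fun i => ∃ q : α × β, q.1 ∈ p i ∧ V q.1 q.2 :=
    rePred_exists (V := fun i (q : α × β) => q.1 ∈ p i ∧ V q.1 q.2) (rePred_and
      (rePred_comp (rePred_mem hp) (Computable.fst.pair (Computable.fst.comp Computable.snd)))
      (rePred_comp hV Computable.snd))
  rcases hC.2 {i | ∃ q : α × β, q.1 ∈ p i ∧ V q.1 q.2} hW with h | h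
  · right
    refine uniformize ⟨p, hp, hpu⟩ hV ?_
    filter_upwards [hpu, eventually_almostAll.2 h]
    rintro i hi ⟨⟨a, b⟩, ha, hb⟩
    obtain rfl := Part.mem_unique hi ha
    exact ⟨b, hb⟩
  · left
    have h' : ∀ᶠ i in almostAll C, ¬∃ q : α × β, q.1 ∈ p i ∧ V q.1 q.2 :=
      eventually_almostAll.2 h
    filter_upwards [hpu, h'] with i hi hn b hb
    exact hn ⟨(u i, b), hi, hb⟩

end HyperComputable

end HyperComputable

/-! ### Elements of cohesive products as sequences -/

section Germs

variable {C : Set ℕ}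

/-- A representative of an element of a cohesive product. -/
noncomputable def CohProd.out {A : ℕ → Type*} {ν : ∀ i, Numbering (A i)} (x : CohProd C ν) :
    Rep C ν :=
  Quotient.out x

theorem CohProd.mk_out {A : ℕ → Type*} {ν : ∀ i, Numbering (A i)} (x : CohProd C ν) :
    CohProd.mk x.out = x :=
  Quotient.out_eq x

theorem CohProd.mk_eq_mk {A : ℕ → Type*} {ν : ∀ i, Numbering (A i)} {φ ψ : Rep C ν} :
    CohProd.mk φ = CohProd.mk ψ ↔ ∀ᶠ i in almostAll C, ∃ a, a ∈ φ.val i ∧ a ∈ ψ.val i :=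
  Quotient.eq (r := Rep.setoid C ν)

theorem CohProd.eq_iff {A : ℕ → Type*} {ν : ∀ i, Numbering (A i)} {x y : CohProd C ν} :
    x = y ↔ ∀ᶠ i in almostAll C, ∃ a, a ∈ x.out.val i ∧ a ∈ y.out.val i := by
  rw [← CohProd.mk_eq_mk, CohProd.mk_out, CohProd.mk_out]

theorem CohProd.out_mk {A : ℕ → Type*} {ν : ∀ i, Numbering (A i)} (φ : Rep C ν) :
    ∀ᶠ i in almostAll C, ∃ a, a ∈ (CohProd.mk φ).out.val i ∧ a ∈ φ.val i :=
  CohProd.mk_eq_mk.1 (CohProd.mk_out _)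

theorem lift₂_iff {A B : ℕ → Type*} {ν : ∀ i, Numbering (A i)} {μ : ∀ i, Numbering (B i)}
    {R : ∀ i, A i → B i → Prop} {x : CohProd C ν} {y : CohProd C μ} :
    Lift₂ R x y ↔ ∀ᶠ i in almostAll C, ∃ a ∈ x.out.val i, ∃ b ∈ y.out.val i, R i a b := by
  rw [← lift₂_mk, CohProd.mk_out, CohProd.mk_out]

theorem lift₃_iff {A B D : ℕ → Type*} {ν : ∀ i, Numbering (A i)} {μ : ∀ i, Numbering (B i)}
    {ξ : ∀ i, Numbering (D i)} {R : ∀ i, A i → B i → D i → Prop} {x : CohProd C ν}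
    {y : CohProd C μ} {z : CohProd C ξ} :
    Lift₃ R x y z ↔ ∀ᶠ i in almostAll C,
      ∃ a ∈ x.out.val i, ∃ b ∈ y.out.val i, ∃ d ∈ z.out.val i, R i a b d := by
  rw [← lift₃_mk, CohProd.mk_out, CohProd.mk_out, CohProd.mk_out]

/-- A hyper-computable sequence of codes of elements `d i ∈ D i` comes from an element of the
cohesive product. -/
theorem exists_rep {D : ℕ → Type*} {ξ : ∀ i, Numbering (D i)}
    (hξ : REPred fun p : ℕ × ℕ => p.2 ∈ Set.range (ξ p.1).code) {c : ℕ → ℕ}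
    (hc : HyperComputable C c) (h : ∀ᶠ i in almostAll C, c i ∈ Set.range (ξ i).code) :
    ∃ ρ : Rep C ξ, ∀ᶠ i in almostAll C, ∃ d ∈ ρ.val i, (ξ i).code d = c i := by
  obtain ⟨p, hp, hpc⟩ := hc
  obtain ⟨f, hf, h₁, h₂⟩ := rePred_uniformize
    (V := fun i m => m ∈ p i ∧ m ∈ Set.range (ξ i).code) (rePred_and (rePred_mem hp) hξ)
  have hdom : ∀ᶠ i in almostAll C, (f i).Dom := by
    filter_upwards [hpc, h] with i h₃ h₄
    exact h₂ i ⟨c i, h₃, h₄⟩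
  refine ⟨⟨fun i => ⟨(f i).Dom, fun hi => (h₁ i _ (Part.get_mem hi)).2.choose⟩, hf.of_eq fun i =>
    Part.ext' Iff.rfl fun h₃ h₄ => (h₁ i _ (Part.get_mem h₃)).2.choose_spec.symm, hdom⟩, ?_⟩
  filter_upwards [hpc, hdom] with i h₃ h₄
  refine ⟨_, ⟨h₄, rfl⟩, ?_⟩
  exact (h₁ i _ (Part.get_mem h₄)).2.choose_spec.trans
    (Part.mem_unique (h₁ i _ (Part.get_mem h₄)).1 h₃)

theorem rePred_range_reindex {A : ℕ → Type*} {ν : ∀ n, Numbering (A n)} (φ : Index C)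
    (hν : REPred fun p : ℕ × ℕ => p.2 ∈ Set.range (ν p.1).code) :
    REPred fun p : ℕ × ℕ => p.2 ∈ Set.range (reindexNumbering φ ν p.1).code := by
  refine (rePred_exists (V := fun (p : ℕ × ℕ) n => n ∈ φ.val p.1 ∧ p.2 ∈ Set.range (ν n).code)
    (rePred_and (rePred_comp (rePred_mem (partrec_index φ))
      ((Computable.fst.comp Computable.fst).pair Computable.snd))
      (rePred_comp hν (Computable.snd.pair
        (Computable.snd.comp Computable.fst))))).of_eq fun p => ?_
  constructor
  · rintro ⟨n, ⟨h, rfl⟩, a, ha⟩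
    exact ⟨⟨h, a⟩, ha⟩
  · rintro ⟨⟨h, a⟩, ha⟩
    exact ⟨_, ⟨h, rfl⟩, a, ha⟩

open Classical in
/-- The sequence of natural numbers given by an index function, with junk value `0`. -/
noncomputable def Rep.seq (φ : Index C) (i : ℕ) : ℕ :=
  if h : (φ.val i).Dom then (φ.val i).get h else 0

theorem Rep.seq_eq {φ : Index C} {i n : ℕ} (h : n ∈ φ.val i) : φ.seq i = n := by
  obtain ⟨h, rfl⟩ := h
  exact dif_pos h

theorem Rep.seq_mem (φ : Index C) : ∀ᶠ i in almostAll C, φ.seq i ∈ φ.val i := by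
  filter_upwards [φ.dom] with i hi
  rw [Rep.seq_eq (Part.get_mem hi)]
  exact Part.get_mem hi

theorem Rep.seq_hyperComputable (φ : Index C) : HyperComputable C φ.seq :=
  ⟨_, partrec_index φ, φ.seq_mem⟩

theorem HyperNat.lt_iff {N M : HyperNat C} :
    N < M ↔ ∀ᶠ i in almostAll C, N.rep.seq i < M.rep.seq i := by
  refine lift₂_iff.trans ⟨fun h => ?_, fun h => ?_⟩
  · filter_upwards [h]
    rintro i ⟨a, ha, b, hb, hab⟩
    rwa [Rep.seq_eq (φ := N.rep) ha, Rep.seq_eq (φ := M.rep) hb]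
  · filter_upwards [h, N.rep.seq_mem, M.rep.seq_mem] with i h h₁ h₂
    exact ⟨_, h₁, _, h₂, h⟩

theorem HyperNat.exists_seq {u : ℕ → ℕ} (hu : HyperComputable C u) :
    ∃ N : HyperNat C, ∀ᶠ i in almostAll C, N.rep.seq i = u i := by
  obtain ⟨ρ, hρ⟩ := exists_rep (ξ := fun _ => natNumbering)
    ((rePred_eq (Computable.const ()) (Computable.const ())).of_eq fun p =>
      ⟨fun _ => ⟨p.2, rfl⟩, fun _ => rfl⟩) hu (.of_forall fun i => ⟨u i, rfl⟩)
  refine ⟨CohProd.mk ρ, ?_⟩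
  filter_upwards [hρ, CohProd.out_mk ρ]
  rintro i ⟨d, hd, hdu⟩ ⟨a, ha, ha'⟩
  obtain rfl := Part.mem_unique hd ha'
  exact (Rep.seq_eq (φ := HyperNat.rep _) ha).trans hdu

/-- Any three hyper-natural numbers have a common strict upper bound. -/
theorem HyperNat.exists_gt (N₁ N₂ N₃ : HyperNat C) : ∃ M, N₁ < M ∧ N₂ < M ∧ N₃ < M := by
  obtain ⟨M, hM⟩ := HyperNat.exists_seq (((N₁.rep.seq_hyperComputable.pair
    (N₂.rep.seq_hyperComputable.pair N₃.rep.seq_hyperComputable)).map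
    (f := fun q : ℕ × ℕ × ℕ => q.1 + (q.2.1 + q.2.2) + 1)
    (Primrec.to_comp (Primrec.succ.comp (Primrec.nat_add.comp Primrec.fst
      (Primrec.nat_add.comp (Primrec.fst.comp Primrec.snd) (Primrec.snd.comp Primrec.snd)))))))
  refine ⟨M, HyperNat.lt_iff.2 ?_, HyperNat.lt_iff.2 ?_, HyperNat.lt_iff.2 ?_⟩ <;>
  · filter_upwards [hM] with i hi
    rw [hi]
    omega

end Germs

/-! ### Hyper-tuples as sequences of tuples in the top field -/

section Tuples

variable {C : Set ℕ} {φ : Index C} {B : ℕ → Type*} [∀ n, Field (B n)] {μ : ∀ n, Numbering (B n)}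
  (K : Type*) [Field K] [∀ n, Algebra (B n) K]

open Classical in
/-- The sequence of tuples of elements of `K` given by a hyper-tuple over subfields of `K`, with
junk value the empty tuple. -/
noncomputable def tupleSeq (x : HyperTuples φ μ) (i : ℕ) : List K :=
  if h : (x.out.val i).Dom then ((x.out.val i).get h).2.map (algebraMap (B _) K) else []

variable {K}

theorem tupleSeq_eq {x : HyperTuples φ μ} {i : ℕ} {a : Reindex φ (fun n => List (B n)) i}
    (h : a ∈ x.out.val i) : tupleSeq K x i = a.2.map (algebraMap (B _) K) := by
  obtain ⟨h, rfl⟩ := h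
  exact dif_pos h

theorem mem_tupleSeq {x : HyperTuples φ μ} : ∀ᶠ i in almostAll C, ∀ e ∈ tupleSeq K x i,
    e ∈ Set.range (algebraMap (B (φ.seq i)) K) := by
  filter_upwards [x.out.dom] with i hd
  have hi := Part.get_mem hd
  rw [tupleSeq_eq hi, Rep.seq_eq (Part.get_mem ((x.out.val i).get hd).1)]
  intro e he
  obtain ⟨b, -, rfl⟩ := List.mem_map.1 he
  exact ⟨b, rfl⟩

theorem map_algebraMap_injective (n : ℕ) :
    Function.Injective (List.map (algebraMap (B n) K)) :=
  List.map_injective_iff.2 (algebraMap (B n) K).injective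

theorem tupleSeq_ext {x y : HyperTuples φ μ}
    (h : ∀ᶠ i in almostAll C, tupleSeq K x i = tupleSeq K y i) : x = y := by
  rw [CohProd.eq_iff]
  filter_upwards [h, x.out.dom, y.out.dom] with i h hx hy
  have hx := Part.get_mem hx
  have hy := Part.get_mem hy
  rw [tupleSeq_eq hx, tupleSeq_eq hy] at h
  generalize (x.out.val i).get _ = a at *
  generalize (y.out.val i).get _ = b at *
  obtain ⟨_, a⟩ := a
  obtain ⟨_, b⟩ := b
  obtain rfl : a = b := map_algebraMap_injective _ h
  exact ⟨_, hx, hy⟩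

variable (K) in
theorem isPrefix_iff {x y : HyperTuples φ μ} :
    IsPrefix x y ↔ ∀ᶠ i in almostAll C, tupleSeq K x i <+: tupleSeq K y i := by
  refine lift₂_iff.trans ⟨fun h => ?_, fun h => ?_⟩
  · filter_upwards [h]
    rintro i ⟨a, ha, b, hb, h⟩
    rw [tupleSeq_eq ha, tupleSeq_eq hb]
    exact h.map _
  · filter_upwards [h, x.out.dom, y.out.dom] with i h hx hy
    have hx := Part.get_mem hx
    have hy := Part.get_mem hy
    rw [tupleSeq_eq hx, tupleSeq_eq hy] at h
    exact ⟨_, hx, _, hy, (List.prefix_map_iff_of_injective (algebraMap (B _) K).injective).1 h⟩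

variable (K) in
theorem isConcat_iff {x y z : HyperTuples φ μ} :
    IsConcat x y z ↔ ∀ᶠ i in almostAll C, tupleSeq K z i = tupleSeq K x i ++ tupleSeq K y i := by
  refine lift₃_iff.trans ⟨fun h => ?_, fun h => ?_⟩
  · filter_upwards [h]
    rintro i ⟨a, ha, b, hb, c, hc, h⟩
    rw [tupleSeq_eq ha, tupleSeq_eq hb, tupleSeq_eq hc, h, List.map_append]
  · filter_upwards [h, x.out.dom, y.out.dom, z.out.dom] with i h hx hy hz
    have hx := Part.get_mem hx
    have hy := Part.get_mem hy
    have hz := Part.get_mem hz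
    rw [tupleSeq_eq hx, tupleSeq_eq hy, tupleSeq_eq hz] at h
    refine ⟨_, hx, _, hy, _, hz, map_algebraMap_injective (K := K) _ ?_⟩
    rw [List.map_append]
    exact h

variable (K) in
theorem isArity_iff {x : HyperTuples φ μ} {N : HyperNat C} :
    IsArity x N ↔ ∀ᶠ i in almostAll C, (tupleSeq K x i).length = N.rep.seq i := by
  refine lift₂_iff.trans ⟨fun h => ?_, fun h => ?_⟩
  · filter_upwards [h]
    rintro i ⟨a, ha, n, hn, h⟩
    rw [tupleSeq_eq ha, Rep.seq_eq (φ := N.rep) hn, List.length_map, h]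
  · filter_upwards [h, x.out.dom, N.rep.seq_mem] with i h hx hN
    have hx := Part.get_mem hx
    rw [tupleSeq_eq hx, List.length_map] at h
    exact ⟨_, hx, _, hN, h⟩

open Classical in
/-- The sequence of polynomials given by a hyper-polynomial, with junk value `0`. -/
noncomputable def polySeq (p : HyperPoly C) (i : ℕ) : MvPolynomial ℕ ℤ :=
  if h : (p.out.val i).Dom then (p.out.val i).get h else 0

theorem polySeq_eq {p : HyperPoly C} {i : ℕ} {q : MvPolynomial ℕ ℤ} (h : q ∈ p.out.val i) :
    polySeq p i = q := by
  obtain ⟨h, rfl⟩ := h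
  exact dif_pos h

theorem evalTuple_map {A A' : Type*} [Field A] [Field A'] (f : A →+* A') (p : MvPolynomial ℕ ℤ)
    (a : List A) : evalTuple p (a.map f) = f (evalTuple p a) := by
  have h := MvPolynomial.map_aeval (R := ℤ) (B := A') (fun j => a.getD j 0) f p
  rw [evalTuple, evalTuple, h, MvPolynomial.aeval_def, MvPolynomial.coe_eval₂Hom]
  congr 1
  · exact RingHom.ext_int _ _
  · funext j
    conv_lhs => rw [← map_zero f]
    exact List.getD_map _ _ _

variable (K) in
theorem isValue_iff {p : HyperPoly C} {x y : HyperTuples φ μ} :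
    IsValue p x y ↔ ∀ᶠ i in almostAll C, (tupleSeq K x i).length = numVars (polySeq p i) ∧
      tupleSeq K y i = [evalTuple (polySeq p i) (tupleSeq K x i)] := by
  refine lift₃_iff.trans ⟨fun h => ?_, fun h => ?_⟩
  · filter_upwards [h]
    rintro i ⟨q, hq, a, ha, b, hb, h, h'⟩
    rw [tupleSeq_eq ha, tupleSeq_eq hb, polySeq_eq hq, List.length_map, h, h', evalTuple_map]
    exact ⟨rfl, rfl⟩
  · filter_upwards [h, p.out.dom, x.out.dom, y.out.dom] with i h hp hx hy
    have hp := Part.get_mem hp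
    have hx := Part.get_mem hx
    have hy := Part.get_mem hy
    rw [tupleSeq_eq hx, tupleSeq_eq hy, polySeq_eq hp, List.length_map, evalTuple_map] at h
    exact ⟨_, hp, _, hx, _, hy, h.1, map_algebraMap_injective (K := K) _ h.2⟩

theorem sameTuple_iff {ψ : Index C} {B' : ℕ → Type*} [∀ n, Field (B' n)]
    {μ' : ∀ n, Numbering (B' n)} [∀ n, Algebra (B' n) K] {x : HyperTuples φ μ}
    {y : HyperTuples ψ μ'} :
    SameTuple K x y ↔ ∀ᶠ i in almostAll C, tupleSeq K x i = tupleSeq K y i := by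
  refine lift₂_iff.trans ⟨fun h => ?_, fun h => ?_⟩
  · filter_upwards [h]
    rintro i ⟨a, ha, b, hb, h⟩
    rw [tupleSeq_eq ha, tupleSeq_eq hb, h]
  · filter_upwards [h, x.out.dom, y.out.dom] with i h hx hy
    have hx := Part.get_mem hx
    have hy := Part.get_mem hy
    rw [tupleSeq_eq hx, tupleSeq_eq hy] at h
    exact ⟨_, hx, _, hy, h⟩

end Tuples

/-! ### Effective embeddings into the top field -/

section Embedding

variable {C : Set ℕ} {B : ℕ → Type*} [∀ n, Field (B n)] {μ : ∀ n, Numbering (B n)}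
  {K : Type*} [Field K] [Primcodable K] [∀ n, Algebra (B n) K]

variable (μ K) in
/-- The relation between the codes of the elements of the fields `B n` and their images in `K` is
recursively enumerable, uniformly in `n`. -/
def EffectiveEmbedding : Prop :=
  REPred fun p : ℕ × ℕ × K =>
    ∃ b : B p.1, (μ p.1).code b = p.2.1 ∧ algebraMap (B p.1) K b = p.2.2

theorem EffectiveEmbedding.rePred_mem_range (h : EffectiveEmbedding μ K) :
    REPred fun p : ℕ × K => p.2 ∈ Set.range (algebraMap (B p.1) K) :=
  (rePred_exists (V := fun (p : ℕ × K) (m : ℕ) =>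
    ∃ b : B p.1, (μ p.1).code b = m ∧ algebraMap (B p.1) K b = p.2)
    (rePred_comp h ((Computable.fst.comp Computable.fst).pair
      (Computable.snd.pair (Computable.snd.comp Computable.fst))))).of_eq fun _ =>
    ⟨fun ⟨_, b, _, hb⟩ => ⟨b, hb⟩, fun ⟨b, hb⟩ => ⟨_, b, rfl, hb⟩⟩

theorem EffectiveEmbedding.rePred_list (h : EffectiveEmbedding μ K) :
    REPred fun p : ℕ × ℕ × List K => ∃ s : List (B p.1),
      (μ p.1).list.code s = p.2.1 ∧ s.map (algebraMap (B p.1) K) = p.2.2 := by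
  have h₁ : REPred fun q : (ℕ × ℕ × List K) × List ℕ => Encodable.encode q.2 = q.1.2.1 :=
    rePred_eq (Computable.encode.comp Computable.snd)
      (Computable.fst.comp (Computable.snd.comp Computable.fst))
  have h₂ : REPred fun q : (ℕ × ℕ × List K) × List ℕ => List.Forall₂ (fun (c : ℕ) (e : K) =>
      ∃ b : B q.1.1, (μ q.1.1).code b = c ∧ algebraMap (B q.1.1) K b = e) q.2 q.1.2.2 := by
    have h₃ : REPred fun q : ((ℕ × ℕ × List K) × List ℕ) × ℕ × K =>
        ∃ b : B q.1.1.1, (μ q.1.1.1).code b = q.2.1 ∧ algebraMap (B q.1.1.1) K b = q.2.2 :=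
      rePred_comp h (f := fun q : ((ℕ × ℕ × List K) × List ℕ) × ℕ × K => (q.1.1.1, q.2))
        ((Computable.fst.comp (Computable.fst.comp Computable.fst)).pair Computable.snd)
    exact rePred_forall₂ (V := fun (q : (ℕ × ℕ × List K) × List ℕ) (c : ℕ) (e : K) =>
      ∃ b : B q.1.1, (μ q.1.1).code b = c ∧ algebraMap (B q.1.1) K b = e) h₃
      (l := fun q => q.2) (m := fun q => q.1.2.2) Computable.snd
      (Computable.snd.comp (Computable.snd.comp Computable.fst))
  refine (rePred_exists (V := fun (p : ℕ × ℕ × List K) (w : List ℕ) =>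
    Encodable.encode w = p.2.1 ∧ List.Forall₂ (fun (c : ℕ) (e : K) =>
      ∃ b : B p.1, (μ p.1).code b = c ∧ algebraMap (B p.1) K b = e) w p.2.2)
    (rePred_and h₁ h₂)).of_eq ?_
  rintro ⟨n, m, l⟩
  have key (w : List ℕ) : List.Forall₂ (fun (c : ℕ) (e : K) =>
      ∃ b : B n, (μ n).code b = c ∧ algebraMap (B n) K b = e) w l ↔
      ∃ s : List (B n), s.map (μ n).code = w ∧ s.map (algebraMap (B n) K) = l := by
    constructor
    · intro hw
      induction hw with
      | nil => exact ⟨[], rfl, rfl⟩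
      | cons hb _ ih =>
        obtain ⟨b, rfl, rfl⟩ := hb
        obtain ⟨s, rfl, rfl⟩ := ih
        exact ⟨b :: s, rfl, rfl⟩
    · rintro ⟨s, rfl, rfl⟩
      rw [List.forall₂_map_left_iff, List.forall₂_map_right_iff, List.forall₂_same]
      exact fun b _ => ⟨b, rfl, rfl⟩
  simp only [key]
  constructor
  · rintro ⟨_, h, s, rfl, h'⟩
    exact ⟨s, h, h'⟩
  · rintro ⟨s, h, h'⟩
    exact ⟨_, h, s, rfl, h'⟩

theorem EffectiveEmbedding.rePred_range_list (h : EffectiveEmbedding μ K) :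
    REPred fun p : ℕ × ℕ => p.2 ∈ Set.range (μ p.1).list.code :=
  (rePred_exists (V := fun (p : ℕ × ℕ) (l : List K) => ∃ s : List (B p.1),
      (μ p.1).list.code s = p.2 ∧ s.map (algebraMap (B p.1) K) = l)
    (rePred_comp h.rePred_list ((Computable.fst.comp Computable.fst).pair
      ((Computable.snd.comp Computable.fst).pair Computable.snd)))).of_eq fun _ =>
    ⟨fun ⟨_, s, hs, _⟩ => ⟨s, hs⟩, fun ⟨s, hs⟩ => ⟨_, s, hs, rfl⟩⟩

/-- The sequence of codes of the values of a representative is hyper-computable. -/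
theorem exists_code {D : ℕ → Type*} {ξ : ∀ i, Numbering (D i)} (x : CohProd C ξ) :
    ∃ c : ℕ → ℕ, HyperComputable C c ∧
      ∀ᶠ i in almostAll C, ∃ d ∈ x.out.val i, (ξ i).code d = c i := by
  obtain ⟨c, hc⟩ := eventually_choice (l := almostAll C)
    (r := fun i m => ∃ d ∈ x.out.val i, (ξ i).code d = m)
    (x.out.dom.mono fun i hi => ⟨_, _, Part.get_mem hi, rfl⟩)
  refine ⟨c, ⟨_, x.out.partrec, ?_⟩, hc⟩
  filter_upwards [hc]
  rintro i ⟨d, hd, hdc⟩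
  rw [← hdc]
  exact Part.mem_map _ hd

variable {φ : Index C}

theorem EffectiveEmbedding.tupleSeq_hyperComputable (h : EffectiveEmbedding μ K)
    (x : HyperTuples φ μ) : HyperComputable C (tupleSeq K x) := by
  obtain ⟨c, hc, hcx⟩ := exists_code x
  have hx : ∀ᶠ i in almostAll C, ∃ s : List (B (φ.seq i)), (μ (φ.seq i)).list.code s = c i ∧
      s.map (algebraMap (B (φ.seq i)) K) = tupleSeq K x i := by
    filter_upwards [hcx]
    rintro i ⟨d, hd, hdc⟩
    rw [tupleSeq_eq hd, Rep.seq_eq (Part.get_mem d.1)]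
    exact ⟨d.2, hdc, rfl⟩
  obtain ⟨w, hw, hwx⟩ := ((φ.seq_hyperComputable.pair hc).uniformize
    (V := fun (p : ℕ × ℕ) (l : List K) => ∃ s : List (B p.1), (μ p.1).list.code s = p.2 ∧
      s.map (algebraMap (B p.1) K) = l)
    (rePred_comp h.rePred_list ((Computable.fst.comp Computable.fst).pair
      ((Computable.snd.comp Computable.fst).pair Computable.snd)))
    (hx.mono fun i hi => ⟨_, hi⟩))
  refine hw.congr ?_
  filter_upwards [hx, hwx]
  rintro i ⟨s, hs, hsx⟩ ⟨s', hs', hsx'⟩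
  rw [← hsx, ← hsx', (μ _).list.inj (hs'.trans hs.symm)]

/-- Every hyper-computable sequence of tuples over the subfields `B (φ i)` comes from a
hyper-tuple. -/
theorem EffectiveEmbedding.exists_tuple (h : EffectiveEmbedding μ K) {u : ℕ → List K}
    (hu : HyperComputable C u)
    (hmem : ∀ᶠ i in almostAll C, ∀ e ∈ u i, e ∈ Set.range (algebraMap (B (φ.seq i)) K)) :
    ∃ x : HyperTuples φ μ, ∀ᶠ i in almostAll C, tupleSeq K x i = u i := by
  have hex : ∀ᶠ i in almostAll C, ∃ s : List (B (φ.seq i)),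
      s.map (algebraMap (B (φ.seq i)) K) = u i := by
    filter_upwards [hmem] with i hi
    exact (Set.range_list_map (algebraMap _ K)).ge hi
  obtain ⟨c, hc, hcu⟩ := ((φ.seq_hyperComputable.pair hu).uniformize
    (V := fun (p : ℕ × List K) (m : ℕ) => ∃ s : List (B p.1), (μ p.1).list.code s = m ∧
      s.map (algebraMap (B p.1) K) = p.2)
    (rePred_comp h.rePred_list ((Computable.fst.comp Computable.fst).pair
      (Computable.snd.pair (Computable.snd.comp Computable.fst))))
    (hex.mono fun i ⟨s, hs⟩ => ⟨_, s, rfl, hs⟩))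
  have hcu' : ∀ᶠ i in almostAll C, ∃ d : Reindex φ (fun n => List (B n)) i,
      (reindexNumbering φ (fun n => (μ n).list) i).code d = c i ∧
        d.2.map (algebraMap (B _) K) = u i := by
    filter_upwards [hcu, φ.dom] with i hi hd
    rw [Rep.seq_eq (Part.get_mem hd)] at hi
    obtain ⟨s, hs, hsu⟩ := hi
    exact ⟨⟨hd, s⟩, hs, hsu⟩
  obtain ⟨ρ, hρ⟩ := exists_rep (rePred_range_reindex φ h.rePred_range_list) hc
    (hcu'.mono fun i ⟨d, hd, _⟩ => ⟨d, hd⟩)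
  refine ⟨CohProd.mk ρ, ?_⟩
  filter_upwards [hcu', hρ, CohProd.out_mk ρ]
  rintro i ⟨d, hd, hdu⟩ ⟨d', hd', hdc⟩ ⟨d₂, hd₂, hd₂'⟩
  obtain rfl := Part.mem_unique hd' hd₂'
  obtain rfl := (reindexNumbering φ (fun n => (μ n).list) i).inj (hd.trans hdc.symm)
  rw [tupleSeq_eq hd₂, hdu]

variable {F : Type*} [Field F] [Algebra F K] {νF : Numbering F} [∀ n, Algebra F (B n)]
  [∀ n, IsScalarTower F (B n) K]

theorem isBaseTuple_iff (hF : EffectiveEmbedding (fun _ => νF) K) (h : EffectiveEmbedding μ K)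
    {x : HyperTuples φ μ} : IsBaseTuple νF x ↔
      ∀ᶠ i in almostAll C, ∀ e ∈ tupleSeq K x i, e ∈ Set.range (algebraMap F K) := by
  constructor
  · rintro ⟨c, hc⟩
    filter_upwards [lift₂_iff.1 hc]
    rintro i ⟨l, hl, a, ha, hla⟩ e he
    rw [tupleSeq_eq ha, hla, List.map_map] at he
    obtain ⟨b, -, rfl⟩ := List.mem_map.1 he
    exact ⟨b, IsScalarTower.algebraMap_apply F (B _) K b⟩
  · intro hx
    have hex : ∀ᶠ i in almostAll C, ∃ s : List F, s.map (algebraMap F K) = tupleSeq K x i := by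
      filter_upwards [hx] with i hi
      exact (Set.range_list_map (algebraMap _ K)).ge hi
    obtain ⟨c, hc, hcu⟩ := (HyperComputable.uniformize
      (HyperComputable.index.pair (h.tupleSeq_hyperComputable x))
      (V := fun (p : ℕ × List K) (m : ℕ) => ∃ s : List F, νF.list.code s = m ∧
        s.map (algebraMap F K) = p.2)
      (rePred_comp hF.rePred_list ((Computable.fst.comp Computable.fst).pair
        (Computable.snd.pair (Computable.snd.comp Computable.fst))))
      (hex.mono fun i ⟨s, hs⟩ => ⟨_, s, rfl, hs⟩))
    obtain ⟨ρ, hρ⟩ := exists_rep (ξ := fun _ => νF.list) hF.rePred_range_list hc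
      (hcu.mono fun i ⟨d, hd, _⟩ => ⟨d, hd⟩)
    refine ⟨CohProd.mk ρ, lift₂_iff.2 ?_⟩
    filter_upwards [hcu, hρ, CohProd.out_mk ρ, x.out.dom]
    rintro i ⟨d, hd, hdu⟩ ⟨d', hd', hdc⟩ ⟨d₂, hd₂, hd₂'⟩ hxi
    have hxi := Part.get_mem hxi
    obtain rfl := Part.mem_unique hd' hd₂'
    obtain rfl := νF.list.inj (hd.trans hdc.symm)
    refine ⟨_, hd₂, _, hxi, map_algebraMap_injective (K := K) _ ?_⟩
    rw [List.map_map, ← RingHom.coe_comp, ← IsScalarTower.algebraMap_eq]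
    exact (tupleSeq_eq hxi).symm.trans hdu.symm

end Embedding

/-! ### Horner evaluation -/

section Horner

/-- The value at `x` of the polynomial with the coefficients `c`, leading coefficient first, by
Horner's rule with initial value `s`. -/
def horner {R : Type*} [Semiring R] (x s : R) (c : List R) : R := c.foldl (fun h e => h * x + e) s

theorem map_horner {R S : Type*} [Semiring R] [Semiring S] (f : R →+* S) (x s : R) (c : List R) :
    f (horner x s c) = horner (f x) (f s) (c.map f) := by
  induction c generalizing s with
  | nil => rfl
  | cons e c ih => simpa [horner] using ih (s * x + e)

open Polynomial in
theorem exists_horner_eq_aeval {F K : Type*} [Field F] [Field K] [Algebra F K] (n : ℕ) (p : F[X])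
    (hp : p.natDegree ≤ n) : ∃ c : List F, c.length = n ∧ ∀ x : K,
      horner x (algebraMap F K (p.coeff n)) (c.map (algebraMap F K)) = aeval x p := by
  induction n generalizing p with
  | zero =>
    refine ⟨[], rfl, fun x => ?_⟩
    conv_rhs => rw [eq_C_of_natDegree_le_zero hp]
    simp [horner]
  | succ n ih =>
    obtain ⟨c, hc, h⟩ := ih p.divX (by rw [natDegree_divX_eq_natDegree_tsub_one]; omega)
    refine ⟨c ++ [p.coeff 0], by simp [hc], fun x => ?_⟩
    have h' := h x
    rw [coeff_divX] at h'
    conv_rhs => rw [← divX_mul_X_add p]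
    rw [horner] at h' ⊢
    simp [h']

open Polynomial in
/-- A monic polynomial of degree at most the order of the orbit `G a` that vanishes on this orbit
has no other roots. -/
theorem exists_eq_of_horner_eq_zero {K G : Type*} [Field K] [Finite G] {a : G → K}
    (ha : Function.Injective a) {c : List K} (hc : c.length = Nat.card G)
    (h : ∀ g, horner (a g) 1 c = 0) {y : K} (hy : horner y 1 c = 0) : ∃ g, y = a g := by
  classical
  have _ := Fintype.ofFinite G
  have key : ∀ (c : List K) (p : K[X]), p.Monic →
      (horner X p (c.map C)).Monic ∧ (horner X p (c.map C)).natDegree = p.natDegree + c.length := by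
    intro c
    induction c with
    | nil => exact fun p hp => ⟨hp, rfl⟩
    | cons e c ih =>
      intro p hp
      have hm : (p * X + C e).Monic := by
        refine (hp.mul monic_X).add_of_left ?_
        rw [degree_mul_X]
        refine (degree_C_le).trans_lt ?_
        rw [degree_eq_natDegree hp.ne_zero]
        exact_mod_cast Nat.succ_pos _
      have hd : (p * X + C e).natDegree = p.natDegree + 1 := by
        rw [natDegree_add_C, natDegree_mul_X hp.ne_zero]
      obtain ⟨h₁, h₂⟩ := ih _ hm
      refine ⟨h₁, h₂.trans ?_⟩
      rw [hd, List.length_cons]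
      omega
  obtain ⟨hm, hd⟩ := key c 1 monic_one
  have heval (x : K) : (horner X 1 (c.map C)).eval x = horner x 1 c := by
    have := map_horner (evalRingHom x) X 1 (c.map C)
    simpa [Function.comp_def] using this
  by_contra! hne
  have hcard := card_le_degree_of_subset_roots (p := horner X 1 (c.map C))
    (Z := insert y (Finset.univ.image a)) (by
      intro z hz
      rw [mem_roots hm.ne_zero, IsRoot.def, heval]
      simp only [Finset.mem_val, Finset.mem_insert, Finset.mem_image, Finset.mem_univ,
        true_and] at hz
      obtain rfl | ⟨g, rfl⟩ := hz
      · exact hy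
      · exact h g)
  rw [hd, natDegree_one, hc, Finset.card_insert_of_notMem, Finset.card_image_of_injective _ ha,
    Finset.card_univ, Nat.card_eq_fintype_card] at hcard
  · omega
  · simpa [eq_comm] using hne

end Horner

/-! ### Generators of finite Galois extensions -/

section Generators

variable {F K : Type*} [Field F] [Field K] [Algebra F K] {L : FiniteGaloisIntermediateField F K}

open IntermediateField in
/-- In a finite Galois extension the generators are the elements with trivial stabilizer. -/
theorem adjoin_eq_top_iff (a : L) :
    F⟮a⟯ = ⊤ ↔ ∀ g : L ≃ₐ[F] L, g a = a → g = 1 := by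
  rw [Field.primitive_element_iff_algHom_eq_of_eval' F L
    (fun x => Normal.splits inferInstance x) a]
  constructor
  · intro h g hg
    have h' : (g : L →ₐ[F] L) = AlgHom.id F L := h hg
    ext x
    exact congrArg Subtype.val (DFunLike.congr_fun h' x)
  · intro h φ ψ hφψ
    obtain ⟨e, rfl⟩ := (Algebra.IsAlgebraic.algEquivEquivAlgHom F L).surjective φ
    obtain ⟨e', rfl⟩ := (Algebra.IsAlgebraic.algEquivEquivAlgHom F L).surjective ψ
    have h₁ : e a = e' a := hφψ
    have h₂ := h (e'⁻¹ * e) (by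
      rw [AlgEquiv.mul_apply, h₁]
      exact e'.symm_apply_apply a)
    rw [inv_mul_eq_one.1 h₂]

variable (L) in
theorem exists_trivial_stabilizer : ∃ a : L, ∀ g : L ≃ₐ[F] L, g a = a → g = 1 :=
  (Field.exists_primitive_element F L).imp fun a => (adjoin_eq_top_iff a).1

/-- A generator `a` has a monic polynomial over `F` of degree `[L : F]` that vanishes at all
conjugates of `a`. -/
theorem exists_horner_conj_eq_zero {a : L} (ha : ∀ g : L ≃ₐ[F] L, g a = a → g = 1) :
    ∃ c : List F, c.length = Nat.card (L ≃ₐ[F] L) ∧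
      ∀ g : L ≃ₐ[F] L, horner (g a : K) 1 (c.map (algebraMap F K)) = 0 := by
  have hd := (Field.primitive_element_iff_minpoly_natDegree_eq F a).1 ((adjoin_eq_top_iff a).2 ha)
  have hm := minpoly.monic (IsIntegral.of_finite F a)
  obtain ⟨c, hc, h⟩ := exists_horner_eq_aeval (K := K) (minpoly F a).natDegree (minpoly F a) le_rfl
  refine ⟨c, by rw [hc, hd, IsGalois.card_aut_eq_finrank], fun g => ?_⟩
  have h' := h (g a : K)
  rw [hm.coeff_natDegree, map_one] at h'
  rw [h']
  have h₂ : Polynomial.aeval (algebraMap L K (g a)) (minpoly F a) = 0 := by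
    rw [Polynomial.aeval_algebraMap_apply, Polynomial.aeval_algHom_apply, minpoly.aeval, map_zero,
      map_zero]
  exact h₂

open IntermediateField in
theorem exists_horner_eq {a : L} (ha : ∀ g : L ≃ₐ[F] L, g a = a → g = 1) (b : L) :
    ∃ c : List F, horner (a : K) 0 (c.map (algebraMap F K)) = b := by
  have hb : b ∈ F⟮a⟯.toSubalgebra := by
    rw [(adjoin_eq_top_iff a).2 ha]
    trivial
  rw [adjoin_simple_toSubalgebra_of_isAlgebraic (Algebra.IsAlgebraic.isAlgebraic a),
    Algebra.adjoin_singleton_eq_range_aeval] at hb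
  obtain ⟨p, hp⟩ := hb
  obtain ⟨c, -, h⟩ := exists_horner_eq_aeval (K := K) p.natDegree p le_rfl
  refine ⟨p.coeff p.natDegree :: c, ?_⟩
  have h₁ := h (a : K)
  have h₂ : Polynomial.aeval (algebraMap L K a) p = algebraMap L K b := by
    rw [Polynomial.aeval_algebraMap_apply]
    exact congrArg _ hp
  rw [horner] at h₁ ⊢
  rw [List.map_cons, List.foldl_cons, zero_mul, zero_add, h₁]
  exact h₂

end Generators

namespace FullyComputable

/-! ### Effectivity over the top field -/

theorem infinite {F K : Type*} [Field F] [Field K] [Algebra F K] (E : FullyComputable F K) :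
    Infinite K := by
  by_contra hfin
  rw [not_infinite_iff_finite] at hfin
  have hinj : Function.Injective fun i => ((E.L i).toIntermediateField : Set K) := by
    intro i j hij
    have : E.L i = E.L j := le_antisymm (fun x hx => (Set.ext_iff.1 hij x).1 hx)
      fun x hx => (Set.ext_iff.1 hij x).2 hx
    exact (strictMono_nat_of_lt_succ E.lt_succ).injective this
  exact not_finite_iff_infinite.2 (Infinite.of_injective _ hinj) inferInstance

theorem rePred_mem_range_gal {F K : Type*} [Field F] [Field K] [Algebra F K] (E : FullyComputable F K) :
    REPred fun p : ℕ × ℕ => p.2 ∈ Set.range (E.νG p.1).code :=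
  E.groups.dom.to_re

section Effective

variable {F K : Type*} [Field F] [Field K] [Algebra F K] {E : FullyComputable F K} [Primcodable K]
  {α : Type*} [Primcodable α]

variable (hK : Computable E.νK.code)
include hK

theorem computable_of_code {f : α → K} (hf : Computable fun a => E.νK.code (f a)) :
    Computable f := by
  obtain ⟨g, hg, h₁, h₂⟩ := rePred_uniformize
    (V := fun (a : α) (x : K) => E.νK.code x = E.νK.code (f a))
    (rePred_eq (hK.comp Computable.snd) (hf.comp Computable.fst))
  refine Partrec.of_eq_tot hg fun a => ?_
  have h := Part.get_mem (h₂ a ⟨f a, rfl⟩)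
  rwa [E.νK.inj (h₁ a _ h)] at h

/-- One step of Horner's rule is computable. -/
theorem computable_mul_add : Computable fun p : K × K × K => p.1 * p.2.1 + p.2.2 := by
  obtain ⟨s, hs, hs'⟩ := E.topField.add
  obtain ⟨m, hm, hm'⟩ := E.topField.mul
  refine computable_of_code hK ?_
  have hc := hs.comp ((Computable.const 0).pair ((hm.comp ((Computable.const 0).pair
    ((hK.comp Computable.fst).pair (hK.comp (Computable.fst.comp Computable.snd))))).pair
    (hK.comp (Computable.snd.comp Computable.snd))))
  refine hc.of_eq fun p => ?_
  rw [hm' 0, hs' 0]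

theorem computable_horner (s : K) : Computable fun p : K × List K => horner p.1 s p.2 := by
  have hh : Computable₂ fun (p : K × List K) (q : K × K) => q.1 * p.1 + q.2 :=
    Computable.to₂ <| (computable_mul_add hK).comp
      (g := fun r : (K × List K) × K × K => (r.2.1, r.1.1, r.2.2))
      ((Computable.fst.comp Computable.snd).pair ((Computable.fst.comp Computable.fst).pair
        (Computable.snd.comp Computable.snd)))
  exact computable_list_foldl (α := K × List K) (β := K) (γ := K) (l := fun p => p.2)
    (s := fun _ => s) Computable.snd (Computable.const s) hh

theorem effectiveEmbedding_of {B : ℕ → Type*} [∀ n, Field (B n)] [∀ n, Algebra (B n) K]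
    {μ : ∀ n, Numbering (B n)} (hdom : UniformDomains μ)
    (htop : UniformMap μ (fun _ => E.νK) fun n => algebraMap (B n) K) :
    EffectiveEmbedding μ K := by
  obtain ⟨c, hc, h⟩ := htop
  have h₁ : REPred fun p : ℕ × ℕ × K => p.2.1 ∈ Set.range (μ p.1).code :=
    rePred_comp hdom.to_re (f := fun p : ℕ × ℕ × K => (p.1, p.2.1))
      (Computable.fst.pair (Computable.fst.comp Computable.snd))
  have h₂ : REPred fun p : ℕ × ℕ × K => c (p.1, p.2.1) = E.νK.code p.2.2 :=
    rePred_eq (hc.comp (Computable.fst.pair (Computable.fst.comp Computable.snd)))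
      (hK.comp (Computable.snd.comp Computable.snd))
  refine (rePred_and h₁ h₂).of_eq fun p => ⟨?_, ?_⟩
  · rintro ⟨⟨b, hb⟩, h'⟩
    rw [← hb, h] at h'
    exact ⟨b, hb, E.νK.inj h'⟩
  · rintro ⟨b, hb, hb'⟩
    refine ⟨⟨b, hb⟩, ?_⟩
    rw [← hb, ← hb', h]

theorem effectiveEmbedding_base : EffectiveEmbedding (fun _ => E.νF) K :=
  effectiveEmbedding_of hK E.baseField.dom E.base_top

theorem effectiveEmbedding_top : EffectiveEmbedding (fun _ => E.νK) K :=
  effectiveEmbedding_of hK E.topField.dom ⟨fun p => p.2, Computable.snd, fun _ _ => rfl⟩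

theorem effectiveEmbedding_field : EffectiveEmbedding E.νL K :=
  effectiveEmbedding_of hK E.fields.dom E.field_top

theorem rePred_mem_field : REPred fun p : ℕ × K => p.2 ∈ (E.L p.1).toIntermediateField :=
  (effectiveEmbedding_field hK).rePred_mem_range.of_eq fun p =>
    ⟨fun ⟨b, hb⟩ => hb ▸ b.2, fun h => ⟨⟨p.2, h⟩, rfl⟩⟩

/-- The graphs of the actions of the groups `Gal(L n / F)` are uniformly r.e. -/
theorem rePred_action : REPred fun p : (ℕ × ℕ) × K × K =>
    ∃ g : E.Gal p.1.1, (E.νG p.1.1).code g = p.1.2 ∧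
      ∃ s : E.L p.1.1, (s : K) = p.2.1 ∧ (g s : K) = p.2.2 := by
  obtain ⟨t, ht, ht'⟩ := E.field_top
  obtain ⟨c, hc, hc'⟩ := E.actions
  have h₁ : REPred fun q : ((ℕ × ℕ) × K × K) × ℕ => q.1.1.2 ∈ Set.range (E.νG q.1.1.1).code :=
    rePred_comp E.rePred_mem_range_gal (Computable.fst.comp Computable.fst)
  have h₂ : REPred fun q : ((ℕ × ℕ) × K × K) × ℕ => q.2 ∈ Set.range (E.νL q.1.1.1).code :=
    rePred_comp E.fields.dom.to_re (f := fun q : ((ℕ × ℕ) × K × K) × ℕ => (q.1.1.1, q.2))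
      ((Computable.fst.comp (Computable.fst.comp Computable.fst)).pair Computable.snd)
  have hn : Computable fun q : ((ℕ × ℕ) × K × K) × ℕ => q.1.1.1 :=
    Computable.fst.comp (Computable.fst.comp Computable.fst)
  have h₃ : REPred fun q : ((ℕ × ℕ) × K × K) × ℕ => t (q.1.1.1, q.2) = E.νK.code q.1.2.1 :=
    rePred_eq (ht.comp (hn.pair Computable.snd))
      (hK.comp (Computable.fst.comp (Computable.snd.comp Computable.fst)))
  have h₄ : REPred fun q : ((ℕ × ℕ) × K × K) × ℕ =>
      t (q.1.1.1, c (q.1.1.1, q.1.1.2, q.2)) = E.νK.code q.1.2.2 :=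
    rePred_eq (ht.comp (hn.pair (hc.comp (hn.pair ((Computable.snd.comp
      (Computable.fst.comp Computable.fst)).pair Computable.snd)))))
      (hK.comp (Computable.snd.comp (Computable.snd.comp Computable.fst)))
  refine (rePred_exists (V := fun (p : (ℕ × ℕ) × K × K) (m : ℕ) =>
    p.1.2 ∈ Set.range (E.νG p.1.1).code ∧ m ∈ Set.range (E.νL p.1.1).code ∧
      t (p.1.1, m) = E.νK.code p.2.1 ∧ t (p.1.1, c (p.1.1, p.1.2, m)) = E.νK.code p.2.2)
    (rePred_and h₁ (rePred_and h₂ (rePred_and h₃ h₄)))).of_eq ?_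
  rintro ⟨⟨n, m⟩, x, y⟩
  dsimp only
  constructor
  · rintro ⟨_, ⟨g, hg⟩, ⟨s, rfl⟩, h, h'⟩
    rw [ht'] at h
    rw [← hg, hc', ht'] at h'
    exact ⟨g, hg, s, E.νK.inj h, E.νK.inj h'⟩
  · rintro ⟨g, hg, s, rfl, hy⟩
    refine ⟨_, ⟨g, hg⟩, ⟨s, rfl⟩, ht' _ _, ?_⟩
    rw [← hg, hc', ht', ← hy]
    rfl

omit hK [Primcodable K]

/-- R.e. relations are closed under quantification over the finite groups `Gal(L n / F)`, since
the orders of these groups are computable. -/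
theorem rePred_forall_gal {V : α → ℕ → Prop} (hV : REPred fun p : α × ℕ => V p.1 p.2) {n : α → ℕ}
    (hn : Computable n) : REPred fun a => ∀ g : E.Gal (n a), V a ((E.νG (n a)).code g) := by
  classical
  have h₁ : REPred fun q : α × List ℕ => q.2.length = Nat.card (E.Gal (n q.1)) :=
    rePred_eq (Computable.list_length.comp Computable.snd)
      (E.order.comp (hn.comp Computable.fst))
  have h₂ : REPred fun q : α × List ℕ => ∀ j < q.2.length, ∀ k < j, q.2[j]? ≠ q.2[k]? := by
    refine rePred_forall_lt (V := fun (q : α × List ℕ) j => ∀ k < j, q.2[j]? ≠ q.2[k]?)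
      (rePred_forall_lt (V := fun (r : (α × List ℕ) × ℕ) k => r.1.2[r.2]? ≠ r.1.2[k]?)
        (rePred_ne ?_ ?_) Computable.snd) (Computable.list_length.comp Computable.snd)
    · exact Computable.list_getElem?.comp
        (Computable.snd.comp (Computable.fst.comp Computable.fst))
        (Computable.snd.comp Computable.fst)
    · exact Computable.list_getElem?.comp
        (Computable.snd.comp (Computable.fst.comp Computable.fst)) Computable.snd
  have h₃ : REPred fun q : α × List ℕ =>
      ∀ m ∈ q.2, m ∈ Set.range (E.νG (n q.1)).code ∧ V q.1 m := by
    refine rePred_forall_mem (V := fun (q : α × List ℕ) m =>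
      m ∈ Set.range (E.νG (n q.1)).code ∧ V q.1 m) (rePred_and ?_ ?_) Computable.snd
    · exact rePred_comp E.rePred_mem_range_gal (f := fun r : (α × List ℕ) × ℕ => (n r.1.1, r.2))
        ((hn.comp (Computable.fst.comp Computable.fst)).pair Computable.snd)
    · exact rePred_comp hV (f := fun r : (α × List ℕ) × ℕ => (r.1.1, r.2))
        ((Computable.fst.comp Computable.fst).pair Computable.snd)
  refine (rePred_exists (V := fun (a : α) (w : List ℕ) => w.length = Nat.card (E.Gal (n a)) ∧
    (∀ j < w.length, ∀ k < j, w[j]? ≠ w[k]?) ∧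
      ∀ m ∈ w, m ∈ Set.range (E.νG (n a)).code ∧ V a m)
    (rePred_and h₁ (rePred_and h₂ h₃))).of_eq fun a => ?_
  have _ : Fintype (E.Gal (n a)) := Fintype.ofFinite _
  have hnd (w : List ℕ) : (∀ j < w.length, ∀ k < j, w[j]? ≠ w[k]?) ↔ w.Nodup := by
    rw [List.nodup_iff_getElem?_ne_getElem?]
    exact ⟨fun h k j hkj hj => (h j hj k hkj).symm, fun h j hj k hk => (h k j hk hj).symm⟩
  simp only [hnd]
  constructor
  · rintro ⟨w, hw, hnd, h⟩ g
    refine (h _ ?_).2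
    have hsub : w.toFinset ⊆ Finset.univ.image (E.νG (n a)).code := by
      intro m hm
      obtain ⟨g, rfl⟩ := (h m (List.mem_toFinset.1 hm)).1
      exact Finset.mem_image_of_mem _ (Finset.mem_univ g)
    have heq := Finset.eq_of_subset_of_card_le hsub (by
      rw [Finset.card_image_of_injective _ (E.νG (n a)).inj, List.toFinset_card_of_nodup hnd, hw,
        Finset.card_univ, Nat.card_eq_fintype_card])
    rw [← List.mem_toFinset, heq]
    exact Finset.mem_image_of_mem _ (Finset.mem_univ g)
  · intro h
    refine ⟨Finset.univ.toList.map (E.νG (n a)).code, ?_,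
      (List.nodup_map_iff (E.νG (n a)).inj).2 (Finset.nodup_toList _), ?_⟩
    · rw [List.length_map, Finset.length_toList, Finset.card_univ, Nat.card_eq_fintype_card]
    · intro m hm
      obtain ⟨g, -, rfl⟩ := List.mem_map.1 hm
      exact ⟨⟨g, rfl⟩, h g⟩

end Effective

/-! ### Elements of cohesive products of Galois groups as sequences of automorphisms -/

section GalSeq

variable {F K : Type*} [Field F] [Field K] [Algebra F K] [IsGalois F K] {E : FullyComputable F K}
  {C : Set ℕ} {φ : Index C}

open Classical in
/-- The sequence of automorphisms of `K` given by an element of `∏_{C,φ} Gal(L i / F)`: the values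
are extended to `K` in some way, and the junk value is `1`. -/
noncomputable def galSeq (x : ProdAlong φ E.νG) (i : ℕ) : K ≃ₐ[F] K :=
  if h : (x.out.val i).Dom then ((x.out.val i).get h).2.liftNormal K else 1

theorem galSeq_apply {x : ProdAlong φ E.νG} {i : ℕ} {g : Reindex φ E.Gal i} (h : g ∈ x.out.val i)
    (s : E.L ((φ.val i).get g.1)) : galSeq x i s = g.2 s := by
  obtain ⟨h, rfl⟩ := h
  rw [galSeq, dif_pos h]
  exact AlgEquiv.liftNormal_commutes _ K s

omit [IsGalois F K] in
theorem map_mem_field (g : K ≃ₐ[F] K) {n : ℕ} {e : K} (he : e ∈ (E.L n).toIntermediateField) :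
    g e ∈ (E.L n).toIntermediateField := by
  have h := AlgEquiv.restrictNormal_commutes g (E.L n) ⟨e, he⟩
  change _ = g e at h
  rw [← h]
  exact Subtype.mem _

theorem galSeq_ext {x y : ProdAlong φ E.νG} (h : ∀ᶠ i in almostAll C,
    ∀ e ∈ (E.L (φ.seq i)).toIntermediateField, galSeq x i e = galSeq y i e) : x = y := by
  rw [CohProd.eq_iff]
  filter_upwards [h, x.out.dom, y.out.dom] with i h hx hy
  have hx := Part.get_mem hx
  have hy := Part.get_mem hy
  generalize (x.out.val i).get _ = a at *
  generalize (y.out.val i).get _ = b at *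
  have ha := galSeq_apply hx
  have hb := galSeq_apply hy
  obtain ⟨hd, a⟩ := a
  obtain ⟨_, b⟩ := b
  rw [Rep.seq_eq (Part.get_mem hd)] at h
  obtain rfl : a = b := by
    ext s
    rw [← ha, ← hb]
    exact h s s.2
  exact ⟨_, hx, hy⟩

theorem galSeq_mul (x y : ProdAlong φ E.νG) : ∀ᶠ i in almostAll C,
    ∀ e ∈ (E.L (φ.seq i)).toIntermediateField,
      galSeq (x * y) i e = galSeq x i (galSeq y i e) := by
  have hxy : x * y = CohProd.mk (Rep.mul φ E.νG x.out y.out) := by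
    rw [← ProdAlong.mk_mul, CohProd.mk_out, CohProd.mk_out]
  have h := CohProd.out_mk (Rep.mul φ E.νG x.out y.out)
  rw [← hxy] at h
  filter_upwards [h, x.out.dom, y.out.dom]
  rintro i ⟨d, hd, hd'⟩ hx hy e he
  have hx := Part.get_mem hx
  have hy := Part.get_mem hy
  obtain rfl := Part.mem_unique hd' (Rep.mem_mul φ E.νG hx hy)
  generalize (x.out.val i).get _ = a at *
  generalize (y.out.val i).get _ = b at *
  rw [Rep.seq_eq (Part.get_mem a.1)] at he
  exact (galSeq_apply hd ⟨e, he⟩).trans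
    ((galSeq_apply hx (b.2 ⟨e, he⟩)).symm.trans (by rw [← galSeq_apply hy ⟨e, he⟩]))

theorem galSeq_inv (x : ProdAlong φ E.νG) : ∀ᶠ i in almostAll C,
    ∀ e ∈ (E.L (φ.seq i)).toIntermediateField, galSeq x⁻¹ i (galSeq x i e) = e := by
  have h₁ := galSeq_mul x⁻¹ x
  have h₂ := galSeq_mul (1 : ProdAlong φ E.νG) 1
  rw [inv_mul_cancel] at h₁
  rw [mul_one] at h₂
  filter_upwards [h₁, h₂] with i h₁ h₂ e he
  rw [← h₁ e he]
  exact ((galSeq 1 i).injective (h₂ e he)).symm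

theorem galSeq_quot {N M : HyperNat C} (h : N < M) (x : E.GalAt M) : ∀ᶠ i in almostAll C,
    ∀ e ∈ (E.L (N.rep.seq i)).toIntermediateField, galSeq (E.quot N M x) i e = galSeq x i e := by
  have hx : E.quot N M x = CohProd.mk (E.quotRep N.rep M.rep x.out) := by
    conv_lhs => rw [← CohProd.mk_out x]
    rfl
  have h' := CohProd.out_mk (E.quotRep N.rep M.rep x.out)
  rw [← hx] at h'
  filter_upwards [h', x.out.dom, N.rep.dom, HyperNat.lt_iff.1 h]
  rintro i ⟨d, hd, hd'⟩ hx hN hlt e he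
  have hx := Part.get_mem hx
  obtain rfl := Part.mem_unique hd' (E.mem_quotRep hx hN)
  generalize (x.out.val i).get _ = a at *
  have he' : e ∈ (E.L (M.rep.seq i)).toIntermediateField :=
    (strictMono_nat_of_lt_succ E.lt_succ hlt).le he
  rw [Rep.seq_eq (Part.get_mem hN)] at he hlt
  rw [Rep.seq_eq (Part.get_mem a.1)] at he' hlt
  refine (galSeq_apply hd ⟨e, he⟩).trans ?_
  rw [E.galMap_of_lt hlt, galRestrict_apply]
  exact (galSeq_apply hx ⟨e, he'⟩).symm

theorem actsAs_iff {N : HyperNat C} {g : E.GalAt N}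
    {τ : Equiv.Perm (HyperTuples N.rep E.νL)} : E.ActsAs g τ ↔
      ∀ a, ∀ᶠ i in almostAll C, tupleSeq K (τ a) i = (tupleSeq K a i).map (galSeq g i) := by
  refine forall_congr' fun a => lift₃_iff.trans ⟨fun h => ?_, fun h => ?_⟩
  · filter_upwards [h]
    rintro i ⟨d, hd, s, hs, t, ht, h⟩
    rw [tupleSeq_eq hs, tupleSeq_eq ht, h, List.map_map, List.map_map]
    exact List.map_congr_left fun e _ => (galSeq_apply hd e).symm
  · filter_upwards [h, g.out.dom, a.out.dom, (τ a).out.dom] with i h hg ha hτ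
    have hg := Part.get_mem hg
    have ha := Part.get_mem ha
    have hτ := Part.get_mem hτ
    refine ⟨_, hg, _, ha, _, hτ,
      map_algebraMap_injective (B := fun n => E.L n) (K := K) _ ?_⟩
    rw [tupleSeq_eq ha, tupleSeq_eq hτ, List.map_map] at h
    refine h.trans ?_
    rw [List.map_map]
    exact List.map_congr_left fun e _ => galSeq_apply hg e

/-- The values of an element of `∏_{C,φ} Gal(L i / F)` have a hyper-computable sequence of codes. -/
theorem exists_galSeq_code (x : ProdAlong φ E.νG) : ∃ c : ℕ → ℕ, HyperComputable C c ∧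
    ∀ᶠ i in almostAll C, ∃ g : E.Gal (φ.seq i), (E.νG (φ.seq i)).code g = c i ∧
      ∀ s : E.L (φ.seq i), galSeq x i s = g s := by
  obtain ⟨c, hc, hcx⟩ := exists_code x
  refine ⟨c, hc, ?_⟩
  filter_upwards [hcx]
  rintro i ⟨d, hd, hdc⟩
  rw [Rep.seq_eq (Part.get_mem d.1)]
  exact ⟨d.2, hdc, galSeq_apply hd⟩

/-- A hyper-computable sequence of codes of elements of `Gal(L (φ i) / F)` comes from an element of
`∏_{C,φ} Gal(L i / F)`. -/
theorem exists_galSeq {c : ℕ → ℕ} (hc : HyperComputable C c) (h : ∀ᶠ i in almostAll C,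
    c i ∈ Set.range (E.νG (φ.seq i)).code) :
    ∃ x : ProdAlong φ E.νG, ∀ᶠ i in almostAll C, ∃ g : E.Gal (φ.seq i),
      (E.νG (φ.seq i)).code g = c i ∧ ∀ s : E.L (φ.seq i), galSeq x i s = g s := by
  obtain ⟨ρ, hρ⟩ := exists_rep (rePred_range_reindex φ E.rePred_mem_range_gal) hc (by
    filter_upwards [h, φ.dom] with i hi hd
    rw [Rep.seq_eq (Part.get_mem hd)] at hi
    obtain ⟨g, hg⟩ := hi
    exact ⟨⟨hd, g⟩, hg⟩)
  refine ⟨CohProd.mk ρ, ?_⟩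
  filter_upwards [hρ, CohProd.out_mk ρ]
  rintro i ⟨d, hd, hdc⟩ ⟨d', hd', hd''⟩
  obtain rfl := Part.mem_unique hd hd''
  rw [Rep.seq_eq (Part.get_mem d.1)]
  exact ⟨d.2, hdc, galSeq_apply hd'⟩

omit [IsGalois F K] in
theorem mem_tupleSeq_field {x : HyperTuples φ E.νL} : ∀ᶠ i in almostAll C,
    ∀ e ∈ tupleSeq K x i, e ∈ (E.L (φ.seq i)).toIntermediateField := by
  filter_upwards [mem_tupleSeq (K := K) (x := x)] with i hi e he
  obtain ⟨b, rfl⟩ := hi e he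
  exact b.2

variable [Primcodable K] (hK : Computable E.νK.code)
include hK

omit [IsGalois F K] in
theorem exists_tuple_field {u : ℕ → List K} (hu : HyperComputable C u)
    (hmem : ∀ᶠ i in almostAll C, ∀ e ∈ u i, e ∈ (E.L (φ.seq i)).toIntermediateField) :
    ∃ x : HyperTuples φ E.νL, ∀ᶠ i in almostAll C, tupleSeq K x i = u i :=
  (effectiveEmbedding_field hK).exists_tuple hu (hmem.mono fun _ h e he => ⟨⟨e, h e he⟩, rfl⟩)

/-- The coordinatewise action of `∏_{C,φ} Gal(L i / F)` preserves hyper-computability. -/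
theorem map_galSeq_hyperComputable (x : ProdAlong φ E.νG) {u : ℕ → List K}
    (hu : HyperComputable C u)
    (hmem : ∀ᶠ i in almostAll C, ∀ e ∈ u i, e ∈ (E.L (φ.seq i)).toIntermediateField) :
    HyperComputable C fun i => (u i).map (galSeq x i) := by
  obtain ⟨c, hc, hcx⟩ := exists_galSeq_code x
  have hV : REPred fun p : ((ℕ × ℕ) × List K) × List K =>
      List.Forall₂ (fun e e' => ∃ g : E.Gal p.1.1.1, (E.νG p.1.1.1).code g = p.1.1.2 ∧
        ∃ s : E.L p.1.1.1, (s : K) = e ∧ (g s : K) = e') p.1.2 p.2 := by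
    refine rePred_forall₂ (V := fun (p : ((ℕ × ℕ) × List K) × List K) (e e' : K) =>
      ∃ g : E.Gal p.1.1.1, (E.νG p.1.1.1).code g = p.1.1.2 ∧
        ∃ s : E.L p.1.1.1, (s : K) = e ∧ (g s : K) = e') ?_ (l := fun p => p.1.2)
        (m := fun p => p.2) (Computable.snd.comp Computable.fst) Computable.snd
    exact rePred_comp (rePred_action hK)
      (f := fun q : (((ℕ × ℕ) × List K) × List K) × K × K => (q.1.1.1, q.2))
      ((Computable.fst.comp (Computable.fst.comp Computable.fst)).pair Computable.snd)
  obtain ⟨w, hw, hwx⟩ := ((φ.seq_hyperComputable.pair hc).pair hu).uniformize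
    (V := fun (p : (ℕ × ℕ) × List K) (w : List K) =>
      List.Forall₂ (fun e e' => ∃ g : E.Gal p.1.1, (E.νG p.1.1).code g = p.1.2 ∧
        ∃ s : E.L p.1.1, (s : K) = e ∧ (g s : K) = e') p.2 w) hV (by
    filter_upwards [hcx, hmem]
    rintro i ⟨g, hg, hgx⟩ hi
    refine ⟨(u i).map (galSeq x i), ?_⟩
    rw [List.forall₂_map_right_iff, List.forall₂_same]
    exact fun e he => ⟨g, hg, ⟨e, hi e he⟩, rfl, (hgx _).symm⟩)
  refine hw.congr ?_
  filter_upwards [hwx, hcx]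
  rintro i hi ⟨g, hg, hgx⟩
  have h' : List.Forall₂ (fun e e' => galSeq x i e = e') (u i) (w i) := by
    refine hi.imp ?_
    rintro _ _ ⟨g', hg', s, rfl, rfl⟩
    obtain rfl := (E.νG _).inj (hg.trans hg'.symm)
    exact hgx s
  have h'' := List.forall₂_map_left_iff (R := Eq) (f := galSeq x i) |>.2 h'
  rw [List.forall₂_eq_eq_eq] at h''
  exact h''.symm

end GalSeq

/-! ### Hyper-homomorphisms act by hyper-Galois elements -/

section HyperHom

variable {F K : Type*} [Field F] [Field K] [Algebra F K] {E : FullyComputable F K}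
  {C : Set ℕ} {φ : Index C} [Primcodable K]

variable (E φ) in
/-- The sequences of tuples that represent the elements of `∏_{C,φ} 𝒯_{L i}`. -/
def IsTupleSeq (u : ℕ → List K) : Prop :=
  HyperComputable C u ∧ ∀ᶠ i in almostAll C, ∀ e ∈ u i, e ∈ (E.L (φ.seq i)).toIntermediateField

variable (E φ) in
/-- The sequences of elements that represent the elements of `∏_{C,φ} L i`. -/
def IsElemSeq (a : ℕ → K) : Prop :=
  HyperComputable C a ∧ ∀ᶠ i in almostAll C, a i ∈ (E.L (φ.seq i)).toIntermediateField

theorem IsElemSeq.singleton {a : ℕ → K} (ha : IsElemSeq E φ a) :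
    IsTupleSeq E φ fun i => [a i] := by
  refine ⟨ha.1.map (Computable.list_cons.comp Computable.id (Computable.const [])), ?_⟩
  filter_upwards [ha.2] with i hi e he
  rwa [List.mem_singleton.1 he]

theorem IsTupleSeq.append {u v : ℕ → List K} (hu : IsTupleSeq E φ u) (hv : IsTupleSeq E φ v) :
    IsTupleSeq E φ fun i => u i ++ v i := by
  refine ⟨(hu.1.pair hv.1).map (Computable.list_append.comp Computable.fst Computable.snd), ?_⟩
  filter_upwards [hu.2, hv.2] with i h₁ h₂ e he
  exact (List.mem_append.1 he).elim (h₁ e) (h₂ e)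

theorem IsTupleSeq.getD {u : ℕ → List K} (hu : IsTupleSeq E φ u) {j : ℕ → ℕ}
    (hj : HyperComputable C j) : IsElemSeq E φ fun i => (u i)[j i]?.getD 0 := by
  refine ⟨(hu.1.pair hj).map (Computable.option_getD
    (Computable.list_getElem?.comp Computable.fst Computable.snd) (Computable.const 0)), ?_⟩
  filter_upwards [hu.2] with i hi
  cases h : (u i)[j i]? with
  | none => exact zero_mem _
  | some e => exact hi e (List.mem_of_getElem? h)

theorem isElemSeq_base (e : F) : IsElemSeq E φ fun _ => algebraMap F K e :=
  ⟨.const _, .of_forall fun _ => IntermediateField.algebraMap_mem _ e⟩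

/-- The relation between the data of Horner's rule and the list of its intermediate results. -/
theorem rePred_hornerTrace (hK : Computable E.νK.code) (s' : K) :
    REPred fun p : (K × List K) × List K => p.2.length = p.1.2.length + 1 ∧
      ∀ j < p.2.length, p.2[j]? = some (horner p.1.1 s' (p.1.2.take j)) := by
  have hhor : Computable fun p : ((K × List K) × List K) × ℕ =>
      horner p.1.1.1 s' (p.1.1.2.take p.2) := by
    have htake : Computable fun q : ℕ × List K => q.2.take q.1 :=
      (Primrec.list_take (α := K)).to_comp
    have htake' := htake.comp (g := fun p : ((K × List K) × List K) × ℕ => (p.2, p.1.1.2))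
      (Computable.snd.pair (Computable.snd.comp (Computable.fst.comp Computable.fst)))
    exact (computable_horner hK s').comp
      (g := fun p : ((K × List K) × List K) × ℕ => (p.1.1.1, p.1.1.2.take p.2))
      ((Computable.fst.comp (Computable.fst.comp Computable.fst)).pair htake')
  refine rePred_and (rePred_eq (Computable.list_length.comp Computable.snd) (Computable.succ.comp
    (Computable.list_length.comp (Computable.snd.comp Computable.fst)))) ?_
  refine rePred_forall_lt (V := fun (p : (K × List K) × List K) j =>
    p.2[j]? = some (horner p.1.1 s' (p.1.2.take j))) (rePred_eq ?_ ?_)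
    (Computable.list_length.comp Computable.snd)
  · exact Computable.list_getElem?.comp (Computable.snd.comp Computable.fst) Computable.snd
  · exact Computable.option_some.comp hhor

/-- The failures of Horner's recursion in a list of alleged intermediate results. -/
theorem rePred_hornerFails (hK : Computable E.νK.code) :
    REPred fun p : (List K × List K × K) × ℕ => ∃ q : K × K × K,
      (p.1.1[p.2]? = some q.1 ∧ p.1.1[p.2 + 1]? = some q.2.1 ∧ p.1.2.1[p.2]? = some q.2.2) ∧
        q.2.1 ≠ q.1 * p.1.2.2 + q.2.2 := by
  refine rePred_exists (V := fun (p : (List K × List K × K) × ℕ) (q : K × K × K) =>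
    (p.1.1[p.2]? = some q.1 ∧ p.1.1[p.2 + 1]? = some q.2.1 ∧ p.1.2.1[p.2]? = some q.2.2) ∧
      q.2.1 ≠ q.1 * p.1.2.2 + q.2.2) (rePred_and (rePred_and ?_ (rePred_and ?_ ?_)) ?_)
  · exact rePred_eq (Computable.list_getElem?.comp
      (Computable.fst.comp (Computable.fst.comp Computable.fst))
      (Computable.snd.comp Computable.fst))
      (Computable.option_some.comp (Computable.fst.comp Computable.snd))
  · exact rePred_eq (Computable.list_getElem?.comp
      (Computable.fst.comp (Computable.fst.comp Computable.fst))
      (Computable.succ.comp (Computable.snd.comp Computable.fst)))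
      (Computable.option_some.comp (Computable.fst.comp (Computable.snd.comp Computable.snd)))
  · exact rePred_eq (Computable.list_getElem?.comp (Computable.fst.comp
      (Computable.snd.comp (Computable.fst.comp Computable.fst)))
      (Computable.snd.comp Computable.fst))
      (Computable.option_some.comp (Computable.snd.comp (Computable.snd.comp Computable.snd)))
  · exact rePred_ne (Computable.fst.comp (Computable.snd.comp Computable.snd))
      ((computable_mul_add hK).comp
      (g := fun r : ((List K × List K × K) × ℕ) × K × K × K => (r.2.1, r.1.1.2.2, r.2.2.2))
      (Computable.pair (Computable.fst.comp Computable.snd) (Computable.pair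
        (Computable.snd.comp (Computable.snd.comp
          (Computable.fst.comp Computable.fst)))
          (Computable.snd.comp (Computable.snd.comp Computable.snd)))))

/-- The properties of hyper-automorphisms over `∏_C F` that are used to identify them, for a map
from sequences of tuples over the fields `L (φ i)` to sequences of tuples over `K`. -/
structure IsHyperHom (E : FullyComputable F K) (φ : Index C) (f : (ℕ → List K) → ℕ → List K) :
    Prop where
  congr : ∀ u v, IsTupleSeq E φ u → (∀ᶠ i in almostAll C, u i = v i) →
    ∀ᶠ i in almostAll C, f u i = f v i
  comp : ∀ u, IsTupleSeq E φ u → HyperComputable C (f u)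
  length : ∀ u, IsTupleSeq E φ u → ∀ᶠ i in almostAll C, (f u i).length = (u i).length
  append : ∀ u v, IsTupleSeq E φ u → IsTupleSeq E φ v →
    ∀ᶠ i in almostAll C, f (fun i => u i ++ v i) i = f u i ++ f v i
  mul_add : ∀ a b c, IsElemSeq E φ a → IsElemSeq E φ b → IsElemSeq E φ c →
    ∀ᶠ i in almostAll C, ∃ a' b' c', f (fun i => [a i, b i, c i]) i = [a', b', c'] ∧
      f (fun i => [a i * b i + c i]) i = [a' * b' + c']
  base : ∀ u, IsTupleSeq E φ u →
    (∀ᶠ i in almostAll C, ∀ e ∈ u i, e ∈ Set.range (algebraMap F K)) →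
    ∀ᶠ i in almostAll C, f u i = u i

namespace IsHyperHom

variable {f : (ℕ → List K) → ℕ → List K} (hf : IsHyperHom E φ f)

/-- The effect of a hyper-homomorphism on elements, regarded as `1`-tuples. -/
def onElem (f : (ℕ → List K) → ℕ → List K) (a : ℕ → K) (i : ℕ) : K :=
  (f (fun i => [a i]) i).headD 0

include hf

theorem onElem_spec {a : ℕ → K} (ha : IsElemSeq E φ a) :
    ∀ᶠ i in almostAll C, f (fun i => [a i]) i = [onElem f a i] := by
  filter_upwards [hf.length _ ha.singleton] with i hi
  obtain ⟨b, hb⟩ := List.length_eq_one_iff.1 hi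
  simp [onElem, hb]

theorem onElem_congr {a b : ℕ → K} (ha : IsElemSeq E φ a)
    (h : ∀ᶠ i in almostAll C, a i = b i) :
    ∀ᶠ i in almostAll C, onElem f a i = onElem f b i := by
  filter_upwards [hf.congr _ (fun i => [b i]) ha.singleton (h.mono fun i hi => by rw [hi])]
    with i hi
  rw [onElem, hi, onElem]

theorem onElem_hyperComputable {a : ℕ → K} (ha : IsElemSeq E φ a) :
    HyperComputable C (onElem f a) :=
  ((hf.comp _ ha.singleton).map (Computable.option_getD Primrec.list_head?.to_comp
    (Computable.const 0))).congr (.of_forall fun i => by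
      simp [onElem, List.headD_eq_head?_getD])

theorem onElem_base (e : F) :
    ∀ᶠ i in almostAll C, onElem f (fun _ => algebraMap F K e) i = algebraMap F K e := by
  have he := isElemSeq_base (E := E) (φ := φ) e
  filter_upwards [hf.base _ he.singleton (.of_forall fun i e' he' =>
    ⟨e, (List.mem_singleton.1 he').symm⟩)] with i hi
  rw [onElem, hi]
  rfl

theorem onElem_mul_add {a b c : ℕ → K} (ha : IsElemSeq E φ a) (hb : IsElemSeq E φ b)
    (hc : IsElemSeq E φ c) : ∀ᶠ i in almostAll C,
      onElem f (fun i => a i * b i + c i) i = onElem f a i * onElem f b i + onElem f c i := by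
  filter_upwards [hf.mul_add a b c ha hb hc, hf.onElem_spec ha, hf.onElem_spec hb,
    hf.onElem_spec hc, hf.append _ _ ha.singleton (hb.singleton.append hc.singleton),
    hf.append _ _ hb.singleton hc.singleton]
  rintro i ⟨a', b', c', h₁, h₂⟩ ha hb hc h₃ h₄
  rw [h₄, ha, hb, hc] at h₃
  have h₅ : [a', b', c'] = [onElem f a i, onElem f b i, onElem f c i] := h₁.symm.trans h₃
  obtain ⟨rfl, rfl, rfl⟩ : a' = _ ∧ b' = _ ∧ c' = _ := by simpa using h₅
  rw [onElem, h₂]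
  rfl

/-- A hyper-homomorphism acts on the coordinates of hyper-tuples, also at hyper-finite indices:
split the tuple at the coordinate and use that concatenation and arity are preserved. -/
theorem getElem?_eq {u : ℕ → List K} (hu : IsTupleSeq E φ u) {j : ℕ → ℕ}
    (hj : HyperComputable C j) {a : ℕ → K} (h : ∀ᶠ i in almostAll C, (u i)[j i]? = some (a i)) :
    ∀ᶠ i in almostAll C, (f u i)[j i]? = some (onElem f a i) := by
  have ha : IsElemSeq E φ a := by
    have h' := hu.getD hj
    have h'' : ∀ᶠ i in almostAll C, (u i)[j i]?.getD 0 = a i := h.mono fun i hi => by simp [hi]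
    refine ⟨h'.1.congr h'', ?_⟩
    filter_upwards [h'.2, h''] with i h₁ h₂
    rwa [← h₂]
  have ht : IsTupleSeq E φ fun i => (u i).take (j i) := by
    refine ⟨(hj.pair hu.1).map (Primrec.list_take (α := K)).to_comp, ?_⟩
    filter_upwards [hu.2] with i hi e he
    exact hi e (List.mem_of_mem_take he)
  have hd : IsTupleSeq E φ fun i => (u i).drop (j i + 1) := by
    refine ⟨((hj.map Computable.succ).pair hu.1).map (Primrec.list_drop (α := K)).to_comp, ?_⟩
    filter_upwards [hu.2] with i hi e he
    exact hi e (List.mem_of_mem_drop he)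
  have hsplit : ∀ᶠ i in almostAll C,
      u i = (u i).take (j i) ++ ([a i] ++ (u i).drop (j i + 1)) := by
    filter_upwards [h] with i hi
    obtain ⟨hlt, hi⟩ := List.getElem?_eq_some_iff.1 hi
    rw [← hi, List.singleton_append, List.getElem_cons_drop, List.take_append_drop]
  filter_upwards [hf.congr _ _ hu hsplit, hf.append _ _ ht (ha.singleton.append hd),
    hf.append _ _ ha.singleton hd, hf.length _ ht, hf.onElem_spec ha, h]
    with i h₁ h₂ h₃ h₄ h₅ h₆
  have hlt : j i < (u i).length := (List.getElem?_eq_some_iff.1 h₆).1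
  rw [List.length_take, min_eq_left hlt.le] at h₄
  rw [h₁, h₂, h₃, h₅, List.getElem?_append_right h₄.le, h₄, Nat.sub_self]
  rfl

variable (hC : IsCohesive C) (hK : Computable E.νK.code)
include hC hK

/-- A hyper-homomorphism commutes with the evaluation of polynomials over `F` of hyper-finite
degree. The sequence of intermediate results of Horner's rule is a hyper-tuple, and by cohesiveness
a failure of the recursion for its image would occur at some hyper-finite index. -/
theorem onElem_horner {a : ℕ → K} (ha : IsElemSeq E φ a) {c : ℕ → List K}
    (hc : IsTupleSeq E φ c)
    (hcF : ∀ᶠ i in almostAll C, ∀ e ∈ c i, e ∈ Set.range (algebraMap F K)) (s : F) :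
    ∀ᶠ i in almostAll C, onElem f (fun i => horner (a i) (algebraMap F K s) (c i)) i =
      horner (onElem f a i) (algebraMap F K s) (c i) := by
  set s' := algebraMap F K s with hs'
  -- `h` lists the values of the initial segments of `c`.
  obtain ⟨h, hh, hac⟩ := (ha.1.pair hc.1).uniformize (V := fun (p : K × List K) (h : List K) =>
    h.length = p.2.length + 1 ∧ ∀ j < h.length, h[j]? = some (horner p.1 s' (p.2.take j)))
    (rePred_hornerTrace hK s')
    (.of_forall fun i => ⟨(List.range ((c i).length + 1)).map fun j =>
      horner (a i) s' ((c i).take j), by simp, fun j hj => by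
        rw [List.length_map, List.length_range] at hj
        simp [hj]⟩)
  dsimp only at hac
  have hmem : IsTupleSeq E φ h := by
    refine ⟨hh, ?_⟩
    filter_upwards [hac, ha.2, hc.2]
    rintro i ⟨-, h₂⟩ hai hci e he
    obtain ⟨j, hj, rfl⟩ := List.getElem_of_mem he
    have h₃ := h₂ j hj
    rw [List.getElem?_eq_getElem hj, Option.some_inj] at h₃
    rw [h₃]
    have key (l : List K) (hl : ∀ e ∈ l, e ∈ (E.L (φ.seq i)).toIntermediateField) (x : K)
        (hx : x ∈ (E.L (φ.seq i)).toIntermediateField) :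
        horner (a i) x l ∈ (E.L (φ.seq i)).toIntermediateField := by
      induction l generalizing x with
      | nil => exact hx
      | cons e l ih =>
        exact ih (fun e he => hl e (List.mem_cons_of_mem _ he)) _
          (add_mem (mul_mem hx hai) (hl e List.mem_cons_self))
    exact key _ (fun e he => hci e (List.mem_of_mem_take he)) _
      (IntermediateField.algebraMap_mem _ s)
  have hstep (x : K) (l : List K) (j : ℕ) (hj : j < l.length) :
      horner x s' (l.take (j + 1)) = horner x s' (l.take j) * x + l[j] := by
    rw [List.take_succ_eq_append_getElem hj, horner, List.foldl_append]
    rfl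
  -- Either Horner's recursion holds for the image of `h`, or it fails at some index `j`.
  rcases HyperComputable.dichotomy hC
    ((hf.comp _ hmem).pair (hc.1.pair (hf.onElem_hyperComputable ha)))
    (V := fun (p : List K × List K × K) (j : ℕ) => ∃ q : K × K × K,
      (p.1[j]? = some q.1 ∧ p.1[j + 1]? = some q.2.1 ∧ p.2.1[j]? = some q.2.2) ∧
        q.2.1 ≠ q.1 * p.2.2 + q.2.2) (rePred_hornerFails hK) with hgood | ⟨j, hj, hjbad⟩
  · have hz : ∀ᶠ i in almostAll C, (f h i)[0]? = some s' := by
      have h₀ := hf.getElem?_eq hmem (HyperComputable.const 0)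
        (a := fun _ => algebraMap F K s) (hac.mono fun i hi => by
          rw [hi.2 0 (by omega)]
          rfl)
      filter_upwards [h₀, hf.onElem_base s] with i h₁ h₂
      rw [h₁, h₂]
    have hlast := hf.getElem?_eq hmem (hc.1.map Computable.list_length)
      (a := fun i => horner (a i) s' (c i)) (hac.mono fun i hi => by
        rw [hi.2 _ (by omega), List.take_length])
    filter_upwards [hgood, hz, hlast, hac, hf.length _ hmem] with i h₁ h₂ h₃ h₄ h₅
    have key : ∀ j ≤ (c i).length,
        (f h i)[j]? = some (horner (onElem f a i) s' ((c i).take j)) := by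
      intro j hj
      induction j with
      | zero => exact h₂
      | succ j ih =>
        have hlt : j + 1 < (f h i).length := by omega
        rw [List.getElem?_eq_getElem hlt, Option.some_inj, hstep _ _ _ hj]
        by_contra hne
        exact h₁ j ⟨(_, _, _), ⟨ih (Nat.le_of_succ_le hj), List.getElem?_eq_getElem hlt,
          List.getElem?_eq_getElem hj⟩, hne⟩
    rw [key _ le_rfl, Option.some_inj, List.take_length] at h₃
    exact h₃.symm
  · exfalso
    dsimp only at hjbad
    have hu := hmem.getD hj
    have hv := hmem.getD (hj.map Computable.succ)
    have hw := hc.getD hj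
    have hlt : ∀ᶠ i in almostAll C, j i < (c i).length := by
      filter_upwards [hjbad]
      rintro i ⟨q, ⟨-, -, h₃⟩, -⟩
      exact (List.getElem?_eq_some_iff.1 h₃).1
    have hu' := hf.getElem?_eq hmem hj (a := fun i => (h i)[j i]?.getD 0) (by
      filter_upwards [hlt, hac] with i h₁ h₂
      rw [h₂.2 _ (by omega)]
      rfl)
    have hv' := hf.getElem?_eq hmem (hj.map Computable.succ)
      (a := fun i => (h i)[(j i).succ]?.getD 0) (by
        filter_upwards [hlt, hac] with i h₁ h₂
        rw [h₂.2 _ (by omega)]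
        rfl)
    have hw' := hf.getElem?_eq hc hj (a := fun i => (c i)[j i]?.getD 0) (by
      filter_upwards [hlt] with i h₁
      rw [List.getElem?_eq_getElem h₁]
      rfl)
    have hrec := hf.onElem_congr hv (b := fun i =>
      (h i)[j i]?.getD 0 * a i + (c i)[j i]?.getD 0) (by
        filter_upwards [hlt, hac] with i h₁ h₂
        rw [h₂.2 _ (by omega), h₂.2 _ (by omega), List.getElem?_eq_getElem h₁]
        exact hstep _ _ _ h₁)
    have hfalse : ∀ᶠ i in almostAll C, False := by
      filter_upwards [hjbad, hu', hv', hw', hrec, hf.onElem_mul_add hu ha hw, hf.base _ hc hcF]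
      rintro i ⟨⟨x, y, z⟩, ⟨hx, hy, hz⟩, hne⟩ h₁ h₂ h₃ h₄ h₅ h₆
      rw [h₁, Option.some_inj] at hx
      rw [Nat.succ_eq_add_one, hy, Option.some_inj] at h₂
      rw [h₆, hz, Option.some_inj] at h₃
      apply hne
      dsimp only at hx h₂ h₃ ⊢
      rw [h₂, h₄, h₅, hx, h₃]
    have := hC.neBot
    exact hfalse.exists.elim fun _ h => h

end IsHyperHom

end HyperHom

/-! ### Conjugates of generators under hyper-homomorphisms -/

section Conjugates

variable {F K : Type*} [Field F] [Field K] [Algebra F K] {E : FullyComputable F K}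
  {C : Set ℕ} {φ : Index C} [Primcodable K] (hK : Computable E.νK.code)
include hK

variable (φ) in
/-- There is a sequence of generators of the extensions `L (φ i) / F`. -/
theorem exists_generator : ∃ a : ℕ → K, IsElemSeq E φ a ∧
    ∀ᶠ i in almostAll C, ∃ s : E.L (φ.seq i), (s : K) = a i ∧ ∀ g : E.Gal (φ.seq i),
      g s = s → g = 1 := by
  classical
  obtain ⟨-, h1, -, -⟩ := E.groups
  -- A code `m` of a group element passes the test if it fixes `x` only in case it codes `1`.
  have hV : REPred fun p : ℕ × K => ∀ g : E.Gal p.1, ∃ y : K,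
      (∃ g' : E.Gal p.1, (E.νG p.1).code g' = (E.νG p.1).code g ∧
        ∃ s : E.L p.1, (s : K) = p.2 ∧ (g' s : K) = y) ∧
      (if y = p.2 then (E.νG p.1).code g else (E.νG p.1).code 1) =
        (E.νG p.1).code 1 := by
    refine rePred_forall_gal (E := E) (V := fun (p : ℕ × K) (m : ℕ) => ∃ y : K,
      (∃ g' : E.Gal p.1, (E.νG p.1).code g' = m ∧
        ∃ s : E.L p.1, (s : K) = p.2 ∧ (g' s : K) = y) ∧
      (if y = p.2 then m else (E.νG p.1).code 1) = (E.νG p.1).code 1)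
      ?_ Computable.fst
    refine rePred_exists (V := fun (p : (ℕ × K) × ℕ) (y : K) =>
      (∃ g' : E.Gal p.1.1, (E.νG p.1.1).code g' = p.2 ∧
        ∃ s : E.L p.1.1, (s : K) = p.1.2 ∧ (g' s : K) = y) ∧
      (if y = p.1.2 then p.2 else (E.νG p.1.1).code 1) =
        (E.νG p.1.1).code 1) (rePred_and ?_ (rePred_eq ?_ ?_))
    · exact rePred_comp (rePred_action hK)
        (f := fun p : ((ℕ × K) × ℕ) × K => ((p.1.1.1, p.1.2), (p.1.1.2, p.2)))
        (((Computable.fst.comp (Computable.fst.comp Computable.fst)).pair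
          (Computable.snd.comp Computable.fst)).pair
          ((Computable.snd.comp (Computable.fst.comp Computable.fst)).pair Computable.snd))
    · have hd : Computable fun q : K × K => decide (q.1 = q.2) :=
        (PrimrecPred.computablePred (p := fun q : K × K => q.1 = q.2) Primrec.eq).decide
      refine (Computable.cond (hd.comp (g := fun p : ((ℕ × K) × ℕ) × K => (p.2, p.1.1.2))
        (Computable.snd.pair (Computable.snd.comp (Computable.fst.comp Computable.fst))))
        (Computable.snd.comp Computable.fst)
        (h1.comp (Computable.fst.comp (Computable.fst.comp Computable.fst)))).of_eq fun p => ?_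
      exact Bool.cond_decide ..
    · exact h1.comp (Computable.fst.comp (Computable.fst.comp Computable.fst))
  have key (n : ℕ) (s : E.L n) : (∀ g : E.Gal n, ∃ y : K,
      (∃ g' : E.Gal n, (E.νG n).code g' = (E.νG n).code g ∧
        ∃ s' : E.L n, (s' : K) = s ∧ (g' s' : K) = y) ∧
      (if y = s then (E.νG n).code g else (E.νG n).code 1) =
        (E.νG n).code 1) ↔ ∀ g : E.Gal n, g s = s → g = 1 := by
    refine forall_congr' fun g => ⟨?_, fun h => ?_⟩
    · rintro ⟨y, ⟨g', hg', s', hs', rfl⟩, h⟩ hgs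
      obtain rfl := (E.νG n).inj hg'
      obtain rfl := Subtype.ext hs'
      rw [if_pos (congrArg Subtype.val hgs)] at h
      exact (E.νG n).inj h
    · refine ⟨(g s : K), ⟨g, rfl, s, rfl, rfl⟩, ?_⟩
      by_cases hgs : (g s : K) = s
      · rw [h (Subtype.ext hgs)]
        exact ite_self _
      · rw [if_neg hgs]
  obtain ⟨a, ha, h⟩ := φ.seq_hyperComputable.uniformize
    (V := fun (n : ℕ) (x : K) => x ∈ (E.L n).toIntermediateField ∧ ∀ g : E.Gal n, ∃ y : K,
      (∃ g' : E.Gal n, (E.νG n).code g' = (E.νG n).code g ∧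
        ∃ s : E.L n, (s : K) = x ∧ (g' s : K) = y) ∧
      (if y = x then (E.νG n).code g else (E.νG n).code 1) =
        (E.νG n).code 1) (rePred_and (rePred_mem_field hK) hV) (.of_forall fun i => by
    obtain ⟨s, hs⟩ := exists_trivial_stabilizer (E.L (φ.seq i))
    exact ⟨s, s.2, (key _ s).2 hs⟩)
  exact ⟨a, ⟨ha, h.mono fun i hi => hi.1⟩, h.mono fun i hi => ⟨⟨a i, hi.1⟩, rfl,
    (key _ ⟨a i, hi.1⟩).1 hi.2⟩⟩

theorem rePred_forall_base : REPred fun c : List K => ∀ e ∈ c, e ∈ Set.range (algebraMap F K) :=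
  rePred_forall_mem (V := fun (_ : List K) (e : K) => e ∈ Set.range (algebraMap F K))
    (rePred_comp (effectiveEmbedding_base hK).rePred_mem_range
      (f := fun p : List K × K => (0, p.2)) ((Computable.const 0).pair Computable.snd))
    Computable.id

/-- There is a sequence of monic polynomials over `F` of the degrees `[L (φ i) : F]` that vanish
at all conjugates of given generators. -/
theorem exists_conjPoly {a : ℕ → K} (ha : IsElemSeq E φ a)
    (hgen : ∀ᶠ i in almostAll C, ∃ s : E.L (φ.seq i), (s : K) = a i ∧ ∀ g : E.Gal (φ.seq i),
      g s = s → g = 1) : ∃ c : ℕ → List K, HyperComputable C c ∧ ∀ᶠ i in almostAll C,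
      (∀ e ∈ c i, e ∈ Set.range (algebraMap F K)) ∧
      (c i).length = Nat.card (E.Gal (φ.seq i)) ∧
      ∀ g : E.Gal (φ.seq i), ∃ s : E.L (φ.seq i), (s : K) = a i ∧
        horner (g s : K) 1 (c i) = 0 := by
  have h₁ : REPred fun p : (ℕ × K) × List K => ∀ e ∈ p.2, e ∈ Set.range (algebraMap F K) :=
    rePred_comp (rePred_forall_base hK) Computable.snd
  have h₂ : REPred fun p : (ℕ × K) × List K => p.2.length = Nat.card (E.Gal p.1.1) :=
    rePred_eq (Computable.list_length.comp Computable.snd)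
      (E.order.comp (Computable.fst.comp Computable.fst))
  have h₃ : REPred fun p : (ℕ × K) × List K => ∀ g : E.Gal p.1.1, ∃ y : K,
      (∃ g' : E.Gal p.1.1, (E.νG p.1.1).code g' = (E.νG p.1.1).code g ∧
        ∃ s : E.L p.1.1, (s : K) = p.1.2 ∧ (g' s : K) = y) ∧ horner y 1 p.2 = 0 := by
    refine rePred_forall_gal (E := E) (V := fun (p : (ℕ × K) × List K) (m : ℕ) => ∃ y : K,
      (∃ g' : E.Gal p.1.1, (E.νG p.1.1).code g' = m ∧
        ∃ s : E.L p.1.1, (s : K) = p.1.2 ∧ (g' s : K) = y) ∧ horner y 1 p.2 = 0)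
      ?_ (Computable.fst.comp Computable.fst)
    refine rePred_exists (V := fun (q : ((ℕ × K) × List K) × ℕ) (y : K) =>
      (∃ g' : E.Gal q.1.1.1, (E.νG q.1.1.1).code g' = q.2 ∧
        ∃ s : E.L q.1.1.1, (s : K) = q.1.1.2 ∧ (g' s : K) = y) ∧ horner y 1 q.1.2 = 0)
      (rePred_and ?_ (rePred_eq ?_ (Computable.const 0)))
    · exact rePred_comp (rePred_action hK)
        (f := fun q : (((ℕ × K) × List K) × ℕ) × K => ((q.1.1.1.1, q.1.2), (q.1.1.1.2, q.2)))
        (((Computable.fst.comp (Computable.fst.comp (Computable.fst.comp Computable.fst))).pair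
          (Computable.snd.comp Computable.fst)).pair
          ((Computable.snd.comp (Computable.fst.comp (Computable.fst.comp Computable.fst))).pair
            Computable.snd))
    · exact (computable_horner hK 1).comp
        (g := fun q : (((ℕ × K) × List K) × ℕ) × K => (q.2, q.1.1.2))
        (Computable.snd.pair (Computable.snd.comp (Computable.fst.comp Computable.fst)))
  obtain ⟨c, hc, h⟩ := (φ.seq_hyperComputable.pair ha.1).uniformize
    (V := fun (p : ℕ × K) (c : List K) => (∀ e ∈ c, e ∈ Set.range (algebraMap F K)) ∧
      c.length = Nat.card (E.Gal p.1) ∧ ∀ g : E.Gal p.1, ∃ y : K,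
      (∃ g' : E.Gal p.1, (E.νG p.1).code g' = (E.νG p.1).code g ∧
        ∃ s : E.L p.1, (s : K) = p.2 ∧ (g' s : K) = y) ∧ horner y 1 c = 0)
    (rePred_and h₁ (rePred_and h₂ h₃)) (by
      filter_upwards [hgen]
      rintro i ⟨s, hs, hstab⟩
      obtain ⟨c, hc, h⟩ := exists_horner_conj_eq_zero (K := K) hstab
      refine ⟨c.map (algebraMap F K), fun e he => ?_, by rwa [List.length_map], fun g =>
        ⟨_, ⟨g, rfl, s, hs, rfl⟩, h g⟩⟩
      obtain ⟨b, -, rfl⟩ := List.mem_map.1 he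
      exact ⟨b, rfl⟩)
  refine ⟨c, hc, ?_⟩
  filter_upwards [h]
  rintro i ⟨h₁, h₂, h₃⟩
  refine ⟨h₁, h₂, fun g => ?_⟩
  obtain ⟨y, ⟨g', hg', s, hs, rfl⟩, h⟩ := h₃ g
  obtain rfl := (E.νG _).inj hg'
  exact ⟨s, hs, h⟩

omit hK in
theorem isTupleSeq_of_base {c : ℕ → List K} (hc : HyperComputable C c)
    (h : ∀ᶠ i in almostAll C, ∀ e ∈ c i, e ∈ Set.range (algebraMap F K)) : IsTupleSeq E φ c := by
  refine ⟨hc, ?_⟩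
  filter_upwards [h] with i hi e he
  obtain ⟨b, rfl⟩ := hi e he
  exact IntermediateField.algebraMap_mem _ b

/-- Every sequence of elements of `L (φ i)` is a polynomial expression over `F`, of hyper-finite
degree, in a sequence of generators. -/
theorem exists_horner_seq {a b : ℕ → K} (ha : IsElemSeq E φ a) (hb : IsElemSeq E φ b)
    (hgen : ∀ᶠ i in almostAll C, ∃ s : E.L (φ.seq i), (s : K) = a i ∧ ∀ g : E.Gal (φ.seq i),
      g s = s → g = 1) : ∃ c : ℕ → List K, HyperComputable C c ∧ ∀ᶠ i in almostAll C,
      (∀ e ∈ c i, e ∈ Set.range (algebraMap F K)) ∧ horner (a i) 0 (c i) = b i := by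
  refine (ha.1.pair hb.1).uniformize (V := fun (p : K × K) (c : List K) =>
    (∀ e ∈ c, e ∈ Set.range (algebraMap F K)) ∧ horner p.1 0 c = p.2) (rePred_and
      (rePred_comp (rePred_forall_base hK) Computable.snd) (rePred_eq ?_
        (Computable.snd.comp Computable.fst))) ?_
  · exact (computable_horner hK 0).comp (g := fun q : (K × K) × List K => (q.1.1, q.2))
      ((Computable.fst.comp Computable.fst).pair Computable.snd)
  · filter_upwards [hgen, hb.2]
    rintro i ⟨s, hs, hstab⟩ hbi
    obtain ⟨c, hc⟩ := exists_horner_eq hstab ⟨b i, hbi⟩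
    refine ⟨c.map (algebraMap F K), fun e he => ?_, hs ▸ hc⟩
    obtain ⟨e, -, rfl⟩ := List.mem_map.1 he
    exact ⟨e, rfl⟩

variable [IsGalois F K]

omit [Primcodable K] hK in
/-- An element of `∏_{C,φ} Gal(L i / F)` is determined by its effect on generators. -/
theorem galSeq_eq_of_generator {x y : ProdAlong φ E.νG} {a : ℕ → K}
    (hgen : ∀ᶠ i in almostAll C, ∃ s : E.L (φ.seq i), (s : K) = a i ∧ ∀ g : E.Gal (φ.seq i),
      g s = s → g = 1)
    (h : ∀ᶠ i in almostAll C, galSeq x i (a i) = galSeq y i (a i)) : x = y := by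
  obtain ⟨c, -, hx⟩ := exists_galSeq_code x
  obtain ⟨d, -, hy⟩ := exists_galSeq_code y
  refine galSeq_ext ?_
  filter_upwards [hgen, h, hx, hy]
  rintro i ⟨s, hs, hstab⟩ h ⟨g, -, hg⟩ ⟨g', -, hg'⟩ e he
  rw [← hs, hg, hg'] at h
  have h₁ : g'⁻¹ * g = 1 := hstab _ (by
    rw [AlgEquiv.mul_apply, Subtype.ext h]
    exact g'.symm_apply_apply s)
  rw [hg ⟨e, he⟩, hg' ⟨e, he⟩, inv_mul_eq_one.1 h₁]

/-- Hyper-homomorphisms over `∏_C F` act coordinatewise by elements of `∏_{C,φ} Gal(L i / F)`. -/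
theorem IsHyperHom.exists_galSeq (hC : IsCohesive C) {f : (ℕ → List K) → ℕ → List K}
    (hf : IsHyperHom E φ f) : ∃ x : ProdAlong φ E.νG, ∀ u, IsTupleSeq E φ u →
      ∀ᶠ i in almostAll C, f u i = (u i).map (galSeq x i) := by
  obtain ⟨a, ha, hgen⟩ := exists_generator (E := E) φ hK
  obtain ⟨c, hc, hconj⟩ := exists_conjPoly hK ha hgen
  have hcF : ∀ᶠ i in almostAll C, ∀ e ∈ c i, e ∈ Set.range (algebraMap F K) :=
    hconj.mono fun i hi => hi.1
  -- The image of the generator is a conjugate of the generator.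
  have hact : ∀ᶠ i in almostAll C, ∃ m : ℕ, ∃ g : E.Gal (φ.seq i), (E.νG (φ.seq i)).code g = m ∧
      ∃ s : E.L (φ.seq i), (s : K) = a i ∧ (g s : K) = onElem f a i := by
    have hroot := hf.onElem_horner hC hK ha (isTupleSeq_of_base hc hcF) hcF 1
    have hzero := hf.onElem_base 0
    simp only [map_one, map_zero] at hroot hzero
    have hh : IsElemSeq E φ fun i => horner (a i) 1 (c i) := by
      refine (isElemSeq_base (E := E) (φ := φ) 0) |> fun h => ⟨h.1.congr ?_, ?_⟩
      · filter_upwards [hconj] with i hi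
        obtain ⟨s, hs, h⟩ := hi.2.2 1
        rw [map_zero, ← h, ← hs]
        rfl
      · filter_upwards [hconj] with i hi
        obtain ⟨s, hs, h⟩ := hi.2.2 1
        rw [← hs]
        exact h ▸ zero_mem _
    have hcongr := hf.onElem_congr hh (b := fun _ => 0) (by
      filter_upwards [hconj] with i hi
      obtain ⟨s, hs, h⟩ := hi.2.2 1
      rw [← h, ← hs]
      rfl)
    filter_upwards [hroot, hzero, hcongr, hconj, hgen]
    rintro i h₁ h₂ h₃ ⟨-, hlen, h₄⟩ ⟨s, hs, hstab⟩
    obtain ⟨g, hg⟩ := exists_eq_of_horner_eq_zero (a := fun g : E.Gal (φ.seq i) => (g s : K))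
      (fun g g' hgg' => by
        have h₁ : g'⁻¹ * g = 1 := hstab _ (by
          rw [AlgEquiv.mul_apply, Subtype.ext hgg']
          exact g'.symm_apply_apply s)
        exact (inv_mul_eq_one.1 h₁).symm) hlen (fun g => by
        obtain ⟨s', hs', h⟩ := h₄ g
        obtain rfl := Subtype.ext (hs'.trans hs.symm)
        exact h) (y := onElem f a i) (by rw [← h₁, h₃, h₂])
    exact ⟨_, g, rfl, s, hs, hg.symm⟩
  obtain ⟨m, hm, hma⟩ := ((φ.seq_hyperComputable.pair
    (ha.1.pair (hf.onElem_hyperComputable ha))).uniformize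
    (V := fun (p : ℕ × K × K) (m : ℕ) => ∃ g : E.Gal p.1, (E.νG p.1).code g = m ∧
      ∃ s : E.L p.1, (s : K) = p.2.1 ∧ (g s : K) = p.2.2)
    (rePred_comp (rePred_action hK) (f := fun q : (ℕ × K × K) × ℕ => ((q.1.1, q.2), q.1.2))
      (((Computable.fst.comp Computable.fst).pair Computable.snd).pair
        (Computable.snd.comp Computable.fst))) hact)
  obtain ⟨x, hx⟩ := FullyComputable.exists_galSeq hm (hma.mono fun i ⟨g, hg, _⟩ => ⟨g, hg⟩)
  have hxa : ∀ᶠ i in almostAll C, onElem f a i = galSeq x i (a i) := by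
    filter_upwards [hma, hx]
    rintro i ⟨g, hg, s, hs, hgs⟩ ⟨g', hg', hgx⟩
    obtain rfl := (E.νG _).inj (hg.trans hg'.symm)
    rw [← hs, hgx, ← hgs]
  -- The other elements are polynomial expressions in the generator.
  have helem (b : ℕ → K) (hb : IsElemSeq E φ b) :
      ∀ᶠ i in almostAll C, onElem f b i = galSeq x i (b i) := by
    obtain ⟨d, hd, h⟩ := exists_horner_seq hK ha hb hgen
    have hdF : ∀ᶠ i in almostAll C, ∀ e ∈ d i, e ∈ Set.range (algebraMap F K) :=
      h.mono fun i hi => hi.1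
    have h₁ := hf.onElem_horner hC hK ha (isTupleSeq_of_base hd hdF) hdF 0
    rw [map_zero] at h₁
    have h₂ := hf.onElem_congr hb (b := fun i => horner (a i) 0 (d i))
      (h.mono fun i hi => hi.2.symm)
    filter_upwards [h, h₁, h₂, hxa] with i h h₁ h₂ h₃
    have h₄ := map_horner ((galSeq x i : K →ₐ[F] K) : K →+* K) (a i) 0 (d i)
    rw [map_zero, List.map_congr_left (g := id) (fun e he => by
      obtain ⟨e, rfl⟩ := h.1 e he
      exact (galSeq x i).commutes e), List.map_id] at h₄
    rw [h₂, h₁, h₃, ← h.2]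
    exact h₄.symm
  -- For hyper-tuples, look for a coordinate at which the claim fails.
  refine ⟨x, fun u hu => ?_⟩
  have hbad : REPred fun p : (List K × List K) × ℕ => ∃ q : K × K,
      (p.1.1[p.2]? = some q.1 ∧ p.1.2[p.2]? = some q.2) ∧ q.1 ≠ q.2 := by
    refine rePred_exists (V := fun (p : (List K × List K) × ℕ) (q : K × K) =>
      (p.1.1[p.2]? = some q.1 ∧ p.1.2[p.2]? = some q.2) ∧ q.1 ≠ q.2)
      (rePred_and (rePred_and (rePred_eq ?_ ?_) (rePred_eq ?_ ?_))
        (rePred_ne (Computable.fst.comp Computable.snd) (Computable.snd.comp Computable.snd)))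
    · exact Computable.list_getElem?.comp (Computable.fst.comp (Computable.fst.comp Computable.fst))
        (Computable.snd.comp Computable.fst)
    · exact Computable.option_some.comp (Computable.fst.comp Computable.snd)
    · exact Computable.list_getElem?.comp (Computable.snd.comp (Computable.fst.comp Computable.fst))
        (Computable.snd.comp Computable.fst)
    · exact Computable.option_some.comp (Computable.snd.comp Computable.snd)
  rcases HyperComputable.dichotomy hC
    ((hf.comp _ hu).pair (map_galSeq_hyperComputable hK x hu.1 hu.2))
    (V := fun (p : List K × List K) (j : ℕ) => ∃ q : K × K,
      (p.1[j]? = some q.1 ∧ p.2[j]? = some q.2) ∧ q.1 ≠ q.2) hbad with h | ⟨j, hj, hjbad⟩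
  · filter_upwards [h, hf.length _ hu] with i h hlen
    refine List.ext_getElem (by rw [List.length_map, hlen]) fun j h₁ h₂ => ?_
    by_contra hne
    exact h j ⟨(_, _), ⟨List.getElem?_eq_getElem h₁, List.getElem?_eq_getElem h₂⟩, hne⟩
  · exfalso
    have hfu := hf.getElem?_eq hu hj (a := fun i => (u i)[j i]?.getD 0) (by
      filter_upwards [hjbad]
      rintro i ⟨q, ⟨-, h⟩, -⟩
      rw [List.getElem?_map, Option.map_eq_some_iff] at h
      obtain ⟨e, he, -⟩ := h
      rw [he]
      rfl)
    have hfalse : ∀ᶠ i in almostAll C, False := by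
      filter_upwards [hjbad, hfu, helem _ (hu.getD hj)]
      rintro i ⟨⟨y, z⟩, ⟨hy, hz⟩, hne⟩ h₁ h₂
      rw [List.getElem?_map, Option.map_eq_some_iff] at hz
      obtain ⟨e, he, rfl⟩ := hz
      rw [hy, Option.some_inj, h₂, he] at h₁
      exact hne h₁
    have := hC.neBot
    exact hfalse.exists.elim fun _ h => h

end Conjugates

end FullyComputable

/-! ### Hyper-automorphisms and coordinatewise automorphisms -/

/-- A multiplicative relation between groups that is bijective is an isomorphism. -/
theorem exists_mulEquiv {G H : Type*} [Group G] [Group H] (R : G → H → Prop)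
    (hmul : ∀ g g' h h', R g h → R g' h' → R (g * g') (h * h')) (hex : ∀ g, ∃ h, R g h)
    (huniq : ∀ g h h', R g h → R g h' → h = h') (hex' : ∀ h, ∃ g, R g h)
    (huniq' : ∀ g g' h, R g h → R g' h → g = g') : ∃ e : G ≃* H, ∀ g, R g (e g) := by
  choose e he using hex
  refine ⟨MulEquiv.ofBijective (MonoidHom.mk' e fun g g' =>
    huniq _ _ _ (he _) (hmul _ _ _ _ (he g) (he g'))) ⟨fun g g' h => ?_, fun h => ?_⟩, he⟩
  · exact huniq' _ _ _ (he g) (by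
      have h : e g = e g' := h
      rw [h]
      exact he g')
  · obtain ⟨g, hg⟩ := hex' h
    exact ⟨g, huniq _ _ _ (he g) hg⟩

section MapLemmas

variable {C : Set ℕ} {ψ : Index C} {B : ℕ → Type*} [∀ n, Field (B n)] {μ : ∀ n, Numbering (B n)}
  {F K : Type*} [Field F] [Field K] [Algebra F K] [∀ n, Algebra (B n) K] [∀ n, Algebra F (B n)]
  [∀ n, IsScalarTower F (B n) K] [Primcodable K] {νF : Numbering F}

/-- Permutations that are given coordinatewise by automorphisms of `K/F`, where the automorphisms
may depend on the finitely many hyper-tuples under consideration, are hyper-automorphisms. -/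
theorem mem_HAut_of_map (hF : EffectiveEmbedding (fun _ => νF) K) (hB : EffectiveEmbedding μ K)
    {σ : Equiv.Perm (HyperTuples ψ μ)}
    (h : ∀ a b c, ∃ s : ℕ → K ≃ₐ[F] K, ∀ᶠ i in almostAll C,
      tupleSeq K (σ a) i = (tupleSeq K a i).map (s i) ∧
      tupleSeq K (σ b) i = (tupleSeq K b i).map (s i) ∧
      tupleSeq K (σ c) i = (tupleSeq K c i).map (s i)) : σ ∈ HAut νF ψ μ := by
  refine ⟨⟨fun a b => ?_, fun a b c => ?_, fun a N => ?_⟩, fun p a b => ?_, fun a ha => ?_⟩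
  · obtain ⟨s, hs⟩ := h a b b
    rw [isPrefix_iff K, isPrefix_iff K]
    refine eventually_congr ?_
    filter_upwards [hs] with i hs
    rw [hs.1, hs.2.1, List.prefix_map_iff_of_injective (s i).injective]
  · obtain ⟨s, hs⟩ := h a b c
    rw [isConcat_iff K, isConcat_iff K]
    refine eventually_congr ?_
    filter_upwards [hs] with i hs
    rw [hs.1, hs.2.1, hs.2.2, ← List.map_append,
      (List.map_injective_iff.2 (s i).injective).eq_iff]
  · obtain ⟨s, hs⟩ := h a a a
    rw [isArity_iff K, isArity_iff K]
    refine eventually_congr ?_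
    filter_upwards [hs] with i hs
    rw [hs.1, List.length_map]
  · obtain ⟨s, hs⟩ := h a b b
    rw [isValue_iff K, isValue_iff K]
    refine eventually_congr ?_
    filter_upwards [hs] with i hs
    have he := evalTuple_map ((s i : K →ₐ[F] K) : K →+* K) (polySeq p i) (tupleSeq K a i)
    have he' : evalTuple (polySeq p i) ((tupleSeq K a i).map (s i)) =
      s i (evalTuple (polySeq p i) (tupleSeq K a i)) := he
    rw [hs.1, hs.2.1, List.length_map, he', ← List.map_singleton (f := ⇑(s i)),
      (List.map_injective_iff.2 (s i).injective).eq_iff]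
  · obtain ⟨s, hs⟩ := h a a a
    refine tupleSeq_ext (K := K) ?_
    filter_upwards [hs, (isBaseTuple_iff hF hB).1 ha] with i hs hi
    rw [hs.1]
    refine (List.map_congr_left fun e he => ?_).trans (List.map_id _)
    obtain ⟨b, rfl⟩ := hi e he
    exact (s i).commutes b

open Classical in
/-- The map on sequences of tuples induced by a permutation of hyper-tuples, with a junk value for
the sequences that do not represent hyper-tuples. -/
noncomputable def seqMap (K : Type*) [Field K] [∀ n, Algebra (B n) K]
    (σ : Equiv.Perm (HyperTuples ψ μ)) (u : ℕ → List K) : ℕ → List K :=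
  if h : ∃ x : HyperTuples ψ μ, ∀ᶠ i in almostAll C, tupleSeq K x i = u i then
    tupleSeq K (σ h.choose) else u

omit [Primcodable K] in
theorem seqMap_eq {σ : Equiv.Perm (HyperTuples ψ μ)} {u : ℕ → List K} {x : HyperTuples ψ μ}
    (h : ∀ᶠ i in almostAll C, tupleSeq K x i = u i) : seqMap K σ u = tupleSeq K (σ x) := by
  have hex : ∃ x : HyperTuples ψ μ, ∀ᶠ i in almostAll C, tupleSeq K x i = u i := ⟨x, h⟩
  have hx : hex.choose = x := by
    refine tupleSeq_ext (K := K) ?_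
    filter_upwards [hex.choose_spec, h] with i h₁ h₂
    rw [h₁, h₂]
  rw [seqMap, dif_pos hex, hx]

open MvPolynomial in
theorem numVars_mul_add : numVars (X 0 * X 1 + X 2) = 3 := by
  have h₁ : (X 0 * X 1 : MvPolynomial ℕ ℤ) =
      monomial (Finsupp.single 0 1 + Finsupp.single 1 1) 1 := by
    rw [X, X, monomial_mul, one_mul]
  have h₂ : (X 0 * X 1 : MvPolynomial ℕ ℤ).vars = {0, 1} := by
    rw [h₁, vars_monomial one_ne_zero, Finsupp.support_add_eq, Finsupp.support_single _ one_ne_zero,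
      Finsupp.support_single _ one_ne_zero]
    · rfl
    · rw [Finsupp.support_single _ one_ne_zero, Finsupp.support_single _ one_ne_zero]
      decide
  rw [numVars, vars_add_of_disjoint (by rw [h₂, vars_X]; decide), h₂, vars_X]
  decide

open MvPolynomial in
theorem evalTuple_mul_add {A : Type*} [Field A] (a b c : A) :
    evalTuple (X 0 * X 1 + X 2) [a, b, c] = a * b + c := by
  simp [evalTuple]

theorem exists_hyperPoly (q : MvPolynomial ℕ ℤ) :
    ∃ p : HyperPoly C, ∀ᶠ i in almostAll C, polySeq p i = q := by
  let ρ : Rep C fun _ => polyNumbering := ⟨fun _ => Part.some q, by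
    simp only [Part.map_some]
    exact (Computable.const _).partrec, .of_forall fun _ => trivial⟩
  refine ⟨CohProd.mk ρ, ?_⟩
  filter_upwards [CohProd.out_mk ρ]
  rintro i ⟨a, ha, ha'⟩
  rw [polySeq_eq ha]
  exact Part.mem_some_iff.1 ha'

end MapLemmas

namespace FullyComputable

section Perm

variable {F K : Type*} [Field F] [Field K] [Algebra F K] {E : FullyComputable F K}
  {C : Set ℕ} {φ ψ : Index C} [Primcodable K] (hK : Computable E.νK.code)
  {B : ℕ → Type*} [∀ n, Field (B n)] {μ : ∀ n, Numbering (B n)}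
  [∀ n, Algebra (B n) K] [∀ n, Algebra F (B n)] [∀ n, IsScalarTower F (B n) K]
include hK

theorem isHyperHom_seqMap (hB : EffectiveEmbedding μ K)
    (hφ : ∀ᶠ i in almostAll C, ∀ e ∈ (E.L (φ.seq i)).toIntermediateField,
      e ∈ Set.range (algebraMap (B (ψ.seq i)) K))
    {σ : Equiv.Perm (HyperTuples ψ μ)} (hσ : σ ∈ HAut E.νF ψ μ) :
    IsHyperHom E φ (seqMap K σ) := by
  have hex (u : ℕ → List K) (hu : IsTupleSeq E φ u) :
      ∃ x : HyperTuples ψ μ, ∀ᶠ i in almostAll C, tupleSeq K x i = u i := by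
    refine hB.exists_tuple hu.1 ?_
    filter_upwards [hu.2, hφ] with i h₁ h₂ e he
    exact h₂ e (h₁ e he)
  refine ⟨fun u v hu huv => ?_, fun u hu => ?_, fun u hu => ?_, fun u v hu hv => ?_,
    fun a b c ha hb hc => ?_, fun u hu hbase => ?_⟩
  · obtain ⟨x, hx⟩ := hex u hu
    rw [seqMap_eq hx, seqMap_eq (u := v) (x := x)]
    · exact .of_forall fun _ => rfl
    · filter_upwards [hx, huv] with i h₁ h₂
      rw [h₁, h₂]
  · obtain ⟨x, hx⟩ := hex u hu
    rw [seqMap_eq hx]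
    exact hB.tupleSeq_hyperComputable _
  · obtain ⟨x, hx⟩ := hex u hu
    rw [seqMap_eq hx]
    obtain ⟨N, hN⟩ := HyperNat.exists_seq (hu.1.map Computable.list_length)
    have h₁ : IsArity x N := by
      rw [isArity_iff K]
      filter_upwards [hx, hN] with i h₁ h₂
      rw [h₁, h₂]
    have h₂ := (isArity_iff K).1 ((hσ.1.2.2 x N).1 h₁)
    filter_upwards [h₂, hN] with i h₁ h₂
    rw [h₁, h₂]
  · obtain ⟨x, hx⟩ := hex u hu
    obtain ⟨y, hy⟩ := hex v hv
    obtain ⟨z, hz⟩ := hex _ (hu.append hv)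
    rw [seqMap_eq hx, seqMap_eq hy, seqMap_eq hz]
    refine (isConcat_iff K).1 ((hσ.1.2.1 x y z).1 ((isConcat_iff K).2 ?_))
    filter_upwards [hx, hy, hz] with i h₁ h₂ h₃
    rw [h₁, h₂, h₃]
  · obtain ⟨x, hx⟩ := hex _ (ha.singleton.append (hb.singleton.append hc.singleton))
    have habc : IsElemSeq E φ fun i => a i * b i + c i := by
      refine ⟨(ha.1.pair (hb.1.pair hc.1)).map (computable_mul_add hK), ?_⟩
      filter_upwards [ha.2, hb.2, hc.2] with i h₁ h₂ h₃
      exact add_mem (mul_mem h₁ h₂) h₃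
    obtain ⟨y, hy⟩ := hex _ habc.singleton
    simp only [List.singleton_append] at hx
    rw [seqMap_eq hx, seqMap_eq hy]
    obtain ⟨p, hp⟩ := exists_hyperPoly (C := C)
      (MvPolynomial.X 0 * MvPolynomial.X 1 + MvPolynomial.X 2)
    have h₁ : IsValue p x y := by
      rw [isValue_iff K]
      filter_upwards [hx, hy, hp] with i h₁ h₂ h₃
      rw [h₁, h₂, h₃, numVars_mul_add, evalTuple_mul_add]
      exact ⟨rfl, rfl⟩
    filter_upwards [(isValue_iff K).1 ((hσ.2.1 p x y).1 h₁), hp]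
    rintro i ⟨h₁, h₂⟩ h₃
    rw [h₃] at h₁ h₂
    rw [numVars_mul_add, List.length_eq_three] at h₁
    obtain ⟨a', b', c', h₁⟩ := h₁
    rw [h₁, evalTuple_mul_add] at h₂
    exact ⟨a', b', c', h₁, h₂⟩
  · obtain ⟨x, hx⟩ := hex u hu
    rw [seqMap_eq hx, hσ.2.2 x]
    · exact hx
    · rw [isBaseTuple_iff (effectiveEmbedding_base hK) hB]
      filter_upwards [hx, hbase] with i h₁ h₂
      rwa [h₁]

variable [IsGalois F K]

theorem galSeq_ext_tuple {x y : ProdAlong φ E.νG} (h : ∀ u, IsTupleSeq E φ u →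
    ∀ᶠ i in almostAll C, (u i).map (galSeq x i) = (u i).map (galSeq y i)) : x = y := by
  obtain ⟨a, ha, hgen⟩ := exists_generator (E := E) φ hK
  refine galSeq_eq_of_generator hgen ?_
  filter_upwards [h _ ha.singleton] with i hi
  simpa using hi

omit [IsGalois F K] in
theorem isTupleSeq_tupleSeq (a : HyperTuples φ E.νL) : IsTupleSeq E φ (tupleSeq K a) :=
  ⟨(effectiveEmbedding_field hK).tupleSeq_hyperComputable a, mem_tupleSeq_field⟩

/-- The coordinatewise action of `∏_{C,φ} Gal(L i / F)` is by hyper-automorphisms. -/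
theorem exists_perm (x : ProdAlong φ E.νG) : ∃ τ ∈ HAut E.νF φ E.νL, ∀ a,
    ∀ᶠ i in almostAll C, tupleSeq K (τ a) i = (tupleSeq K a i).map (galSeq x i) := by
  have key (x : ProdAlong φ E.νG) (a : HyperTuples φ E.νL) : ∃ b : HyperTuples φ E.νL,
      ∀ᶠ i in almostAll C, tupleSeq K b i = (tupleSeq K a i).map (galSeq x i) := by
    obtain ⟨h₁, h₂⟩ := isTupleSeq_tupleSeq hK a
    refine exists_tuple_field hK (map_galSeq_hyperComputable hK x h₁ h₂) ?_
    filter_upwards [h₂] with i hi e he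
    obtain ⟨e', he', rfl⟩ := List.mem_map.1 he
    exact map_mem_field _ (hi e' he')
  choose act hact using key
  have hinv (x : ProdAlong φ E.νG) (a : HyperTuples φ E.νL) : act x⁻¹ (act x a) = a := by
    refine tupleSeq_ext (K := K) ?_
    filter_upwards [hact x⁻¹ (act x a), hact x a, galSeq_inv x, mem_tupleSeq_field (x := a)]
      with i h₁ h₂ h₃ h₄
    rw [h₁, h₂, List.map_map]
    exact (List.map_congr_left fun e he => h₃ e (h₄ e he)).trans (List.map_id _)
  refine ⟨⟨act x, act x⁻¹, hinv x, fun a => ?_⟩, ?_, hact x⟩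
  · have := hinv x⁻¹ a
    rwa [inv_inv] at this
  · refine mem_HAut_of_map (effectiveEmbedding_base hK) (effectiveEmbedding_field hK)
      fun a b c => ⟨galSeq x, ?_⟩
    filter_upwards [hact x a, hact x b, hact x c] with i h₁ h₂ h₃
    exact ⟨h₁, h₂, h₃⟩

/-- The group `HAut(∏_{C,N} L i / ∏_C F)` is isomorphic to `∏_{C,N} Gal(L i / F)`, via the
coordinatewise action. -/
theorem exists_mulEquiv_galAt (hC : IsCohesive C) (N : HyperNat C) :
    ∃ γ : E.HAutAt N ≃* E.GalAt N, ∀ τ, E.ActsAs (γ τ) τ.1 := by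
  refine exists_mulEquiv (fun (τ : E.HAutAt N) (g : E.GalAt N) => E.ActsAs g τ.1) ?_ ?_ ?_ ?_ ?_
  · intro τ τ' g g' h h'
    rw [actsAs_iff] at h h' ⊢
    intro a
    filter_upwards [h (τ'.1 a), h' a, galSeq_mul g g', mem_tupleSeq_field (x := a)]
      with i h₁ h₂ h₃ h₄
    rw [Subgroup.coe_mul, Equiv.Perm.mul_apply, h₁, h₂, List.map_map]
    exact List.map_congr_left fun e he => (h₃ e (h₄ e he)).symm
  · intro τ
    obtain ⟨x, hx⟩ := (isHyperHom_seqMap (φ := N.rep) hK (effectiveEmbedding_field hK)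
      (.of_forall fun i e he => ⟨⟨e, he⟩, rfl⟩) τ.2).exists_galSeq hK hC
    refine ⟨x, actsAs_iff.2 fun a => ?_⟩
    have h := hx _ (isTupleSeq_tupleSeq hK a)
    rwa [seqMap_eq (x := a) (.of_forall fun _ => rfl)] at h
  · intro τ g g' h h'
    rw [actsAs_iff] at h h'
    refine galSeq_ext_tuple hK fun u hu => ?_
    obtain ⟨a, ha⟩ := exists_tuple_field hK hu.1 hu.2
    filter_upwards [ha, h a, h' a] with i h₁ h₂ h₃
    rw [← h₁, ← h₂, h₃]
  · intro g
    obtain ⟨τ, hτ, h⟩ := exists_perm hK g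
    exact ⟨⟨τ, hτ⟩, actsAs_iff.2 h⟩
  · intro τ τ' g h h'
    rw [actsAs_iff] at h h'
    ext a : 2
    refine tupleSeq_ext (K := K) ?_
    filter_upwards [h a, h' a] with i h₁ h₂
    rw [h₁, h₂]

end Perm

/-! ### The projective limit -/

section Limit

variable {F K : Type*} [Field F] [Field K] [Algebra F K] {E : FullyComputable F K}
  {C : Set ℕ} [Primcodable K]

theorem IsTupleSeq.mono {N M : HyperNat C} (h : N < M) {u : ℕ → List K}
    (hu : IsTupleSeq E N.rep u) : IsTupleSeq E M.rep u := by
  refine ⟨hu.1, ?_⟩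
  filter_upwards [hu.2, HyperNat.lt_iff.1 h] with i h₁ h₂ e he
  exact (strictMono_nat_of_lt_succ E.lt_succ h₂).le (h₁ e he)

/-- Every hyper-tuple over `K` is a hyper-tuple over `∏_{C,N} L i` for some `N`. -/
theorem exists_isTupleSeq (hK : Computable E.νK.code) {u : ℕ → List K}
    (hu : HyperComputable C u) : ∃ N : HyperNat C, IsTupleSeq E N.rep u := by
  have hV : REPred fun p : List K × ℕ => ∀ e ∈ p.1, e ∈ (E.L p.2).toIntermediateField :=
    rePred_forall_mem (V := fun (p : List K × ℕ) (e : K) => e ∈ (E.L p.2).toIntermediateField)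
      (rePred_comp (rePred_mem_field hK) (f := fun q : (List K × ℕ) × K => (q.1.2, q.2))
        ((Computable.snd.comp Computable.fst).pair Computable.snd)) Computable.fst
  obtain ⟨w, hw, h⟩ := hu.uniformize
    (V := fun (l : List K) (n : ℕ) => ∀ e ∈ l, e ∈ (E.L n).toIntermediateField) hV
    (.of_forall fun i => by
      induction u i with
      | nil => exact ⟨0, by simp⟩
      | cons e l ih =>
        obtain ⟨n, hn⟩ := ih
        obtain ⟨m, hm⟩ := E.union e
        have hmono := (strictMono_nat_of_lt_succ E.lt_succ).monotone
        refine ⟨max m n, fun e' he' => ?_⟩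
        rcases List.mem_cons.1 he' with rfl | he'
        · exact hmono (le_max_left m n) hm
        · exact hmono (le_max_right m n) (hn e' he'))
  obtain ⟨N, hN⟩ := HyperNat.exists_seq hw
  refine ⟨N, hu, ?_⟩
  filter_upwards [h, hN] with i h₁ h₂
  rwa [h₂]

variable [IsGalois F K] (hK : Computable E.νK.code)
include hK

omit hK [Primcodable K] in
theorem galSeq_compat {g : ∀ N, E.GalAt N}
    (hg : g ∈ projLim fun (N M : HyperNat C) (_ : N < M) => E.quot N M) {N M : HyperNat C}
    (h : N < M) : ∀ᶠ i in almostAll C, ∀ e ∈ (E.L (N.rep.seq i)).toIntermediateField,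
      galSeq (g M) i e = galSeq (g N) i e := by
  have hq := galSeq_quot h (g M)
  have hg' : E.quot N M (g M) = g N := hg N M h
  rw [hg'] at hq
  filter_upwards [hq] with i hi e he
  exact (hi e he).symm

/-- The coordinatewise actions of a compatible family of hyper-Galois elements fit together to a
permutation of the hyper-tuples over `K`. -/
theorem exists_perm_top {g : ∀ N, E.GalAt N}
    (hg : g ∈ projLim fun (N M : HyperNat C) (_ : N < M) => E.quot N M) :
    ∃ σ ∈ E.HAutTop C, ∀ b N, IsTupleSeq E N.rep (tupleSeq K b) →
      ∀ᶠ i in almostAll C, tupleSeq K (σ b) i = (tupleSeq K b i).map (galSeq (g N) i) := by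
  have hT := effectiveEmbedding_top hK
  have hindep {g : ∀ N, E.GalAt N}
      (hg : g ∈ projLim fun (N M : HyperNat C) (_ : N < M) => E.quot N M)
      {u : ℕ → List K} {N M : HyperNat C} (hN : IsTupleSeq E N.rep u)
      (hM : IsTupleSeq E M.rep u) : ∀ᶠ i in almostAll C,
        (u i).map (galSeq (g N) i) = (u i).map (galSeq (g M) i) := by
    obtain ⟨P, hP, hP', -⟩ := HyperNat.exists_gt N M M
    filter_upwards [hN.2, hM.2, galSeq_compat hg hP, galSeq_compat hg hP'] with i h₁ h₂ h₃ h₄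
    exact List.map_congr_left fun e he => by rw [← h₃ e (h₁ e he), h₄ e (h₂ e he)]
  have key (g : ∀ N, E.GalAt N)
      (hg : g ∈ projLim fun (N M : HyperNat C) (_ : N < M) => E.quot N M)
      (b : HyperTuples (idIndex C) fun _ => E.νK) : ∃ c : HyperTuples (idIndex C) fun _ => E.νK,
      ∀ N : HyperNat C, IsTupleSeq E N.rep (tupleSeq K b) →
        ∀ᶠ i in almostAll C, tupleSeq K c i = (tupleSeq K b i).map (galSeq (g N) i) := by
    obtain ⟨M, hM⟩ := exists_isTupleSeq hK (hT.tupleSeq_hyperComputable b)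
    obtain ⟨c, hc⟩ := hT.exists_tuple (φ := idIndex C)
      (map_galSeq_hyperComputable hK (g M) hM.1 hM.2) (.of_forall fun i e _ => ⟨e, rfl⟩)
    refine ⟨c, fun N hN => ?_⟩
    filter_upwards [hc, hindep hg hN hM] with i h₁ h₂
    rw [h₁, h₂]
  have _ : Nonempty (HyperTuples (idIndex C) fun _ => E.νK) :=
    (hT.exists_tuple (HyperComputable.const []) (.of_forall fun _ _ _ => ⟨_, rfl⟩)).nonempty
  choose! act hact using key
  have hinv {g : ∀ N, E.GalAt N}
      (hg : g ∈ projLim fun (N M : HyperNat C) (_ : N < M) => E.quot N M)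
      (b : HyperTuples (idIndex C) fun _ => E.νK) : act g⁻¹ (act g b) = b := by
    obtain ⟨N, hN⟩ := exists_isTupleSeq hK (hT.tupleSeq_hyperComputable b)
    have h := hact g hg b N hN
    have hN' : IsTupleSeq E N.rep (tupleSeq K (act g b)) := by
      refine ⟨hT.tupleSeq_hyperComputable _, ?_⟩
      filter_upwards [h, hN.2] with i h₁ h₂ e he
      rw [h₁] at he
      obtain ⟨e', he', rfl⟩ := List.mem_map.1 he
      exact map_mem_field _ (h₂ e' he')
    refine tupleSeq_ext (K := K) ?_
    filter_upwards [hact g⁻¹ (inv_mem hg) _ N hN', h, galSeq_inv (g N), hN.2] with i h₁ h₂ h₃ h₄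
    rw [h₁, h₂, List.map_map]
    exact (List.map_congr_left fun e he => h₃ e (h₄ e he)).trans (List.map_id _)
  refine ⟨⟨act g, act g⁻¹, hinv hg, fun b => ?_⟩, ?_, hact g hg⟩
  · have := hinv (inv_mem hg) b
    rwa [inv_inv] at this
  · refine mem_HAut_of_map (effectiveEmbedding_base hK) hT fun a b c => ?_
    obtain ⟨N₁, h₁⟩ := exists_isTupleSeq hK (hT.tupleSeq_hyperComputable a)
    obtain ⟨N₂, h₂⟩ := exists_isTupleSeq hK (hT.tupleSeq_hyperComputable b)
    obtain ⟨N₃, h₃⟩ := exists_isTupleSeq hK (hT.tupleSeq_hyperComputable c)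
    obtain ⟨M, hM₁, hM₂, hM₃⟩ := HyperNat.exists_gt N₁ N₂ N₃
    refine ⟨galSeq (g M), ?_⟩
    filter_upwards [hact g hg a M (h₁.mono hM₁), hact g hg b M (h₂.mono hM₂),
      hact g hg c M (h₃.mono hM₃)] with i h₁ h₂ h₃
    exact ⟨h₁, h₂, h₃⟩

/-- The group `HAut(∏_C K / ∏_C F)` is isomorphic to the projective limit of the groups
`∏_{C,N} Gal(L i / F)`, which act coordinatewise. -/
theorem exists_mulEquiv_top (hC : IsCohesive C) :
    ∃ e : E.HAutTop C ≃* projLim fun (N M : HyperNat C) (_ : N < M) => E.quot N M,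
      ∀ (σ : E.HAutTop C) (N : HyperNat C) (u : ℕ → List K), IsTupleSeq E N.rep u →
        ∀ᶠ i in almostAll C, seqMap K σ.1 u i = (u i).map (galSeq ((e σ).1 N) i) := by
  have hT := effectiveEmbedding_top hK
  have hex {u : ℕ → List K} (hu : HyperComputable C u) :
      ∃ b : HyperTuples (idIndex C) fun _ => E.νK, ∀ᶠ i in almostAll C, tupleSeq K b i = u i :=
    hT.exists_tuple hu (.of_forall fun i e _ => ⟨e, rfl⟩)
  refine exists_mulEquiv (fun (σ : E.HAutTop C)
    (g : projLim fun (N M : HyperNat C) (_ : N < M) => E.quot N M) =>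
    ∀ (N : HyperNat C) (u : ℕ → List K), IsTupleSeq E N.rep u →
      ∀ᶠ i in almostAll C, seqMap K σ.1 u i = (u i).map (galSeq (g.1 N) i)) ?_ ?_ ?_ ?_ ?_
  · intro σ σ' g g' h h' N u hu
    obtain ⟨b, hb⟩ := hex hu.1
    have h₁ := h' N u hu
    have hu' : IsTupleSeq E N.rep fun i => (u i).map (galSeq (g'.1 N) i) := by
      refine ⟨map_galSeq_hyperComputable hK _ hu.1 hu.2, ?_⟩
      filter_upwards [hu.2] with i h₂ e he
      obtain ⟨e', he', rfl⟩ := List.mem_map.1 he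
      exact map_mem_field _ (h₂ e' he')
    have h₂ := h N _ hu'
    rw [seqMap_eq hb] at h₁ ⊢
    rw [seqMap_eq h₁] at h₂
    filter_upwards [h₂, galSeq_mul (g.1 N) (g'.1 N), hu.2] with i h₂ h₃ h₄
    refine h₂.trans ?_
    rw [List.map_map]
    exact List.map_congr_left fun e he => (h₃ e (h₄ e he)).symm
  · intro σ
    have hN (N : HyperNat C) := (isHyperHom_seqMap (φ := N.rep) hK hT
      (.of_forall fun i e _ => ⟨e, rfl⟩) σ.2).exists_galSeq hK hC
    choose g hg using hN
    refine ⟨⟨g, fun N M h => galSeq_ext_tuple hK fun u hu => ?_⟩, hg⟩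
    filter_upwards [hg N u hu, hg M u (hu.mono h), galSeq_quot h (g M), hu.2] with i h₁ h₂ h₃ h₄
    rw [← h₁, h₂]
    exact List.map_congr_left fun e he => h₃ e (h₄ e he)
  · intro σ g g' h h'
    ext N : 2
    refine galSeq_ext_tuple hK fun u hu => ?_
    filter_upwards [h N u hu, h' N u hu] with i h₁ h₂
    rw [← h₁, h₂]
  · intro g
    obtain ⟨σ, hσ, h⟩ := exists_perm_top hK g.2
    refine ⟨⟨σ, hσ⟩, fun N u hu => ?_⟩
    obtain ⟨b, hb⟩ := hex hu.1
    have hu' : IsTupleSeq E N.rep (tupleSeq K b) := by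
      refine ⟨hT.tupleSeq_hyperComputable b, ?_⟩
      filter_upwards [hb, hu.2] with i h₁ h₂
      rwa [h₁]
    rw [seqMap_eq hb]
    filter_upwards [h b N hu', hb] with i h₁ h₂
    rw [h₁, h₂]
  · intro σ σ' g h h'
    ext b : 2
    refine tupleSeq_ext (K := K) ?_
    obtain ⟨N, hN⟩ := exists_isTupleSeq hK (hT.tupleSeq_hyperComputable b)
    have h₁ := h N _ hN
    have h₂ := h' N _ hN
    rw [seqMap_eq (x := b) (.of_forall fun _ => rfl)] at h₁ h₂
    filter_upwards [h₁, h₂] with i h₁ h₂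
    rw [h₁, h₂]

end Limit

end FullyComputable

/-- Isomorphisms `γ i` carry the projective limit along transported maps to that along `f`. -/
noncomputable def projLimCongr {I : Type*} [LT I] {G H : I → Type*} [∀ i, Group (G i)]
    [∀ i, Group (H i)] (γ : ∀ i, H i ≃* G i) (f : ∀ n m : I, n < m → (G m →* G n)) :
    projLim (fun n m h => ((γ n).symm.toMonoidHom.comp (f n m h)).comp (γ m).toMonoidHom) ≃*
      projLim f where
  toFun τ := ⟨fun n => γ n (τ.1 n), fun n m h => ((γ n).symm_apply_eq).1 (τ.2 n m h)⟩
  invFun g := ⟨fun n => (γ n).symm (g.1 n), fun n m h => by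
    have h' := g.2 n m h
    simp [h']⟩
  left_inv τ := Subtype.ext (funext fun n => (γ n).symm_apply_apply _)
  right_inv g := Subtype.ext (funext fun n => (γ n).apply_symm_apply _)
  map_mul' τ τ' := Subtype.ext (funext fun n => map_mul (γ n) _ _)

end HyperGalois

open FullyComputable in
theorem mainTheorem3 {F K : Type*} [Field F] [Field K] [Algebra F K] [IsGalois F K]
    (E : FullyComputable F K) (C : Set ℕ) (hC : IsCohesive C) :
    ∃ res : ∀ N M : HyperNat C, N < M → (E.HAutAt M →* E.HAutAt N),
      (∀ (N M : HyperNat C) (h : N < M) (σ : E.HAutAt M),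
        IsRestriction K σ.1 (res N M h σ).1) ∧
      ∃ (Θ : E.HAutTop C ≃* projLim res)
        (γ : ∀ N : HyperNat C, E.HAutAt N ≃* E.GalAt N)
        (Λ : projLim res ≃* projLim fun (N M : HyperNat C) (_ : N < M) => E.quot N M),
        (∀ (σ : E.HAutTop C) (N : HyperNat C), IsRestriction K σ.1 ((Θ σ).1 N).1) ∧
        (∀ (N : HyperNat C) (τ : E.HAutAt N), E.ActsAs (γ N τ) τ.1) ∧
        ∀ (τ : projLim res) (N : HyperNat C), (Λ τ).1 N = γ N (τ.1 N) := by
  have := E.infinite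
  obtain ⟨_, hK⟩ := E.νK.exists_primcodable (by
    obtain ⟨_, h⟩ := E.topField.dom
    exact ⟨fun n => inferInstanceAs (Decidable ((0, n).2 ∈ Set.range E.νK.code)),
      h.comp ((Computable.const 0).pair Computable.id)⟩)
  choose γ hγ using exists_mulEquiv_galAt (E := E) hK hC
  obtain ⟨e, he⟩ := exists_mulEquiv_top (E := E) hK hC
  have hγ' := fun N τ => actsAs_iff.1 (hγ N τ)
  refine ⟨fun N M _ => ((γ N).symm.toMonoidHom.comp (E.quot N M)).comp (γ M).toMonoidHom,
    fun N M h σ a => ?_, e.trans (projLimCongr γ fun N M _ => E.quot N M).symm, γ,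
    projLimCongr γ fun N M _ => E.quot N M, fun σ N a => ?_, hγ, fun τ N => rfl⟩
  · have ha := isTupleSeq_tupleSeq hK a
    obtain ⟨b, hb⟩ := exists_tuple_field hK (ha.mono h).1 (ha.mono h).2
    refine ⟨b, sameTuple_iff.2 (hb.mono fun i hi => hi.symm), sameTuple_iff.2 ?_⟩
    have h₁ := hγ' N ((γ N).symm (E.quot N M (γ M σ))) a
    rw [MulEquiv.apply_symm_apply] at h₁
    filter_upwards [h₁, hγ' M σ b, hb, galSeq_quot h (γ M σ), ha.2] with i h₁ h₂ h₃ h₄ h₅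
    rw [h₂, h₃]
    exact h₁.trans (List.map_congr_left fun x hx => h₄ x (h₅ x hx))
  · have ha := isTupleSeq_tupleSeq hK a
    obtain ⟨b, hb⟩ := (effectiveEmbedding_top hK).exists_tuple (φ := idIndex C) ha.1
      (.of_forall fun i x _ => ⟨x, rfl⟩)
    refine ⟨b, sameTuple_iff.2 (hb.mono fun i hi => hi.symm), sameTuple_iff.2 ?_⟩
    have h₁ := hγ' N ((γ N).symm ((e σ).1 N)) a
    rw [MulEquiv.apply_symm_apply] at h₁
    have h₂ := he σ N _ ha
    rw [seqMap_eq hb] at h₂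
    filter_upwards [h₁, h₂] with i h₁ h₂
    rw [h₂]
    exact h₁
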